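/- Let $\theta_1,\theta_2,\theta_3\in\mathbb C\setminus\{0\}$ and pairwise distinct $\rho_1,\rho_2,\rho_3\in\mathbb C$ satisfy the Fuchs relation $3\theta_1+3\theta_2+2\theta_3+2\rho_1+2\rho_2+2\rho_3=0$. Let $\mathcal M$ be the set of triples $(A_1,A_2,A_3)$ of complex $6\times6$ matrices such that $A_1,A_2,A_3$ are diagonalizable with eigenvalues $(\theta_1,\theta_1,\theta_1,0,0,0)$, $(\theta_2,\theta_2,\theta_2,0,0,0)$, $(\theta_3,\theta_3,0,0,0,0)$ respectively and $A_\infty:=-(A_1+A_2+A_3)=\mathrm{diag}(\rho_1,\rho_1,\rho_2,\rho_2,\rho_3,\rho_3)$; these are the Fuchsian systems $\frac{dY}{dx}=\left(\frac{A_1}{x-t}+\frac{A_2}{x-1}+\frac{A_3}{x}\right)Y$ of spectral type $\{42,33,33,222\}$. Their isomonodromic deformation is governed by the Schlesinger system $$\frac{dA_2}{dt}=\frac{[A_1,A_2]}{t-1},\qquad \frac{dA_3}{dt}=\frac{[A_1,A_3]}{t},\qquad \frac{dA_1}{dt}=-\frac{[A_1,A_2]}{t-1}-\frac{[A_1,A_3]}{t}.$$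 **Normal form.** A *normal form* consists of complex numbers $b_1,\dots,b_7,c_1,\dots,c_7,a_1,\dots,a_{27}$ such that the matrices $$\widetilde A_i=\begin{pmatrix}I_3\\ \widetilde B_i\end{pmatrix}\begin{pmatrix}\theta_iI_3-\widetilde C_i\widetilde B_i&\widetilde C_i\end{pmatrix}\ (i=1,2),\qquad \widetilde A_3=\begin{pmatrix}I_2\\O\end{pmatrix}\begin{pmatrix}\theta_3&0&a_{12}&a_{13}&a_{14}&a_{15}\\0&\theta_3&a_{16}&a_{17}&a_{18}&a_{19}\end{pmatrix},$$ $$\widetilde B_1=\begin{pmatrix}0&b_1&0\\b_2&a_1&b_3\\b_4&a_2&b_5\end{pmatrix},\ \widetilde C_1=\begin{pmatrix}a_3&c_2&c_4\\c_1&0&1\\a_4&c_3&c_5\end{pmatrix},\ \widetilde B_2=\begin{pmatrix}a_5&a_6&1\\a_7&a_8&b_6\\a_9&a_{10}&b_7\end{pmatrix},\ \widetilde C_2=\begin{pmatrix}1&0&1\\0&1&0\\a_{11}&c_6&c_7\end{pmatrix},$$ satisfy $$-(\widetilde A_1+\widetilde A_2+\widetilde A_3)=\begin{pmatrix}\rho_1&0&0&0&0&0\\0&\rho_1&0&0&0&0\\a_{20}&a_{21}&\rho_2&0&0&0\\a_{22}&a_{23}&0&\rho_2&0&0\\a_{24}&a_{25}&0&0&\rho_3&0\\a_{26}&a_{27}&0&0&0&\rho_3\end{pmatrix}.$$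 It is *regular* if $b_1b_6c_3\neq0$. Put $\lambda_1=1-c_1$, $\lambda_j=-c_j$ $(j=2,\dots,5)$, $\mu_1=b_1$, $\mu_2=b_2$, $\mu_3=b_3-b_6$, $\mu_4=b_4$, $\mu_5=b_5-b_7-1$, and, for $t\ne0,1$ and a regular normal form, $$q_1=\frac{\mu_1+\lambda_5}{\lambda_3},\quad p_1=-\lambda_3\Big(\lambda_1-\frac{\theta_2+\rho_2}{\mu_1}\Big),\quad \frac{q_2}{t}=\lambda_4,\quad tp_2=\mu_4,\quad \frac{q_3}{t}=-\lambda_2,\quad tp_3=-\mu_2.$$ **Hamiltonian.** With $$H_{\rm VI}(\alpha_0,\alpha_1,\alpha_3,\alpha_4;q,p;t)=q(q-1)(q-t)p\Big(p-\frac{\alpha_1-1}{q-t}-\frac{\alpha_3}{q-1}-\frac{\alpha_4}{q}\Big)+\alpha_2(\alpha_0+\alpha_2)q,\quad \alpha_0+\alpha_1+2\alpha_2+\alpha_3+\alpha_4=1,$$ let $H=H^{42,33,33,222}$ be the polynomial in $(q_j,p_j)_{j=1,2,3}$ $$\begin{aligned}H={}&H_{\rm VI}(\theta_1+\theta_2+\rho_2,\theta_1+2\theta_2+\theta_3+\rho_2+2\rho_3+1,-\theta_1-\theta_3,-\theta_1-\theta_2-2\rho_2-2\rho_3;q_1,p_1;t)\\&+q_1p_1(tp_1+\rho_2)-\tfrac{\theta_1-\theta_2+2\rho_2}{2}q_2p_2\\&+H_{\rm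 VI}\big(-\tfrac{\theta_1-\theta_2+2\rho_2}{2},-\tfrac{\theta_1+\theta_2+2\theta_3+2\rho_2}{2},\theta_1+2\theta_2+\theta_3+2\rho_3+1,2\rho_2;q_2,p_2;t\big)\\&-2(t+1)q_3^2p_3^2+\{-\theta_1-\theta_2-2\theta_3-1+(3\theta_1+3\theta_2+2\theta_3+4\rho_2+4\rho_3+1)t\}q_3p_3\\&-q_1q_3(q_1p_1-\theta_2)(q_1p_1+\theta_1+\rho_2)-q_1q_2p_1\big(q_1p_1+\tfrac{\theta_1-\theta_2+2\rho_2}{2}\big)\\&+q_2q_3p_3\big(2q_2p_2+q_3p_3-\tfrac{\theta_1+3\theta_2+2\rho_2+4\rho_3}{2}\big)\\&+tq_3p_2(-2q_1p_1+3q_2p_2+4q_3p_3-2\theta_1-2\theta_2-2\rho_2-4\rho_3)\\&+q_2p_3\big(2q_1p_1-q_3p_3+\tfrac{\theta_1-\theta_2+2\rho_2}{2}\big)+2(t+1)q_3p_3(q_1p_1-q_2p_2)\\&-2t\{(t+1)q_3p_2^2+p_1p_2(q_1+q_2)+q_3p_3(p_1-2p_2)\}+2tp_1\{(t+1)p_2-p_3\}.\end{aligned}$$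 **Theorem.** 1. There are a polynomial $G$ and a $6\times 6$ matrix $F$ of polynomials in the entries of $(A_1,A_2,A_3)$ such that $G$ does not vanish identically on $\mathcal M$, and for every $A\in\mathcal M$ with $G(A)\neq0$ the matrix $P=F(A)$ is invertible and the matrices $P^{-1}A_iP$ $(i=1,2,3)$ are the matrices $\widetilde A_i$ of a regular normal form. 2. Every normal form satisfies $c_3+c_6=0$, $c_5+c_7=0$, $\lambda_1\mu_1+\mu_1\mu_5-\theta_2-\rho_2=0$ and $\lambda_1\mu_1-\lambda_3\mu_3-\lambda_5\mu_5-\theta_1-\theta_2-2\rho_2=0$. 3. For each $t\ne0,1$ the map $(b,c,a)\mapsto(q_1,q_2,q_3,p_1,p_2,p_3)$ is injective on regular normal forms, and its image is the complement in $\mathbb C^6$ of the zero set of a nonzero polynomial. 4. These coordinates are canonical, at every stage of the elimination. Fix $t\neq0,1$. Let $B_i,C_i$ ($B_1,B_2$ of size $6\times3$, $B_3$ of size $6\times2$, $C_i$ of the transposed size) and $P$ (invertible) be holomorphic matrix functions on an open set of $\mathbb C^2$ such that $(B_1C_1,B_2C_2,B_3C_3)\in\mathcal M$ and the matrices $P^{-1}B_iC_iP$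 are the $\widetilde A_i$ of regular normal forms. Then $b_j,c_j$ are holomorphic and $$\sum_{i=1}^3\mathrm{tr}(dB_i\wedge dC_i)=\sum_{j=1}^7db_j\wedge dc_j=\sum_{j=1}^5d\lambda_j\wedge d\mu_j=\sum_{j=1}^3dq_j\wedge dp_j.$$ 5. For each $t\neq0,1$ there is a constant $k$ (depending on $t,\theta,\rho$ only) such that on all regular normal forms $$t(t-1)\Big(\frac{\mathrm{tr}\,\widetilde A_1\widetilde A_2}{t-1}+\frac{\mathrm{tr}\,\widetilde A_1\widetilde A_3}{t}+\frac{q_2p_2}{t}+\frac{q_3p_3}{t}\Big)=H^{42,33,33,222}(q,p;t)+k.$$ 6. Let $U\subset\mathbb C\setminus\{0,1\}$ be open, let $t\mapsto A(t)\in\mathcal M$ solve the Schlesinger system on $U$, and let $P$ be a holomorphic function from $U$ to the invertible $6\times 6$ matrices such that for every $t\in U$ the matrices $P(t)^{-1}A_i(t)P(t)$ are the matrices $\widetilde A_i$ of a regular normal form. Then the functions $q_j,p_j$ $(j=1,2,3)$ of this normal form satisfy on $U$ the Hamiltonian system $\mathcal H^{42,33,33,222}$: $$t(t-1)\frac{dq_j}{dt}=\{H,q_j\},\qquad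 t(t-1)\frac{dp_j}{dt}=\{H,p_j\}\qquad(j=1,2,3),$$ where $H=H^{42,33,33,222}$ and $\{q_i,p_j\}=-\delta_{ij}$, $\{q_i,q_j\}=\{p_i,p_j\}=0$. -/

import Mathlib

open MvPolynomial

namespace Painleve42

/-- The exponents of the Riemann scheme
`x = t : θ₁,θ₁,θ₁,0,0,0`, `x = 1 : θ₂,θ₂,θ₂,0,0,0`, `x = 0 : θ₃,θ₃,0,0,0,0`,
`x = ∞ : ρ₁,ρ₁,ρ₂,ρ₂,ρ₃,ρ₃`. -/
structure Exponents where
  (θ₁ θ₂ θ₃ ρ₁ ρ₂ ρ₃ : ℂ)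

abbrev Mat6 := Matrix (Fin 6) (Fin 6) ℂ

/-- The eigenvalues, with multiplicity, of the residue matrices at `x = t, 1, 0`. -/
def Exponents.residueEigenvalues (κ : Exponents) : Fin 3 → Fin 6 → ℂ :=
  ![![κ.θ₁, κ.θ₁, κ.θ₁, 0, 0, 0],
    ![κ.θ₂, κ.θ₂, κ.θ₂, 0, 0, 0],
    ![κ.θ₃, κ.θ₃, 0, 0, 0, 0]]

/-- The diagonal entries of the residue matrix at `x = ∞`. -/
def Exponents.infinityEigenvalues (κ : Exponents) : Fin 6 → ℂ :=
  ![κ.ρ₁, κ.ρ₁, κ.ρ₂, κ.ρ₂, κ.ρ₃, κ.ρ₃]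

/-- The spectral type is `{42, 33, 33, 222}`, i.e. exponents that are not equal in the Riemann
scheme by construction are different, and the Fuchs relation holds. -/
structure Exponents.IsAdmissible (κ : Exponents) : Prop where
  θ₁_ne : κ.θ₁ ≠ 0
  θ₂_ne : κ.θ₂ ≠ 0
  θ₃_ne : κ.θ₃ ≠ 0
  ρ₁₂_ne : κ.ρ₁ ≠ κ.ρ₂
  ρ₁₃_ne : κ.ρ₁ ≠ κ.ρ₃
  ρ₂₃_ne : κ.ρ₂ ≠ κ.ρ₃
  fuchs : 3 * κ.θ₁ + 3 * κ.θ₂ + 2 * κ.θ₃ + 2 * κ.ρ₁ + 2 * κ.ρ₂ + 2 * κ.ρ₃ = 0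

/-- `A` is diagonalizable, with eigenvalues (with multiplicity) given by `d`. -/
def IsDiagonalizableTo (A : Mat6) (d : Fin 6 → ℂ) : Prop :=
  ∃ S : Mat6, IsUnit S.det ∧ A = S * Matrix.diagonal d * S⁻¹

/-- The triples `(A₁, A₂, A₃)` of residue matrices (at `x = t, 1, 0`) of the Fuchsian systems
`dY/dx = (A₁/(x-t) + A₂/(x-1) + A₃/x) Y` with the Riemann scheme given by `κ`, normalized so that
`A_∞ = -(A₁ + A₂ + A₃)` is diagonal. -/
def fuchsianSystems (κ : Exponents) : Set (Fin 3 → Mat6) :=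
  {A | (∀ i, IsDiagonalizableTo (A i) (κ.residueEigenvalues i)) ∧
    -(∑ i, A i) = Matrix.diagonal κ.infinityEigenvalues}

/-- The right-hand side of the Schlesinger system with singular points `t, 1, 0, ∞`. -/
noncomputable def schlesingerField (t : ℂ) (A : Fin 3 → Mat6) : Fin 3 → Mat6 :=
  ![-((t - 1)⁻¹ • ⁅A 0, A 1⁆ + t⁻¹ • ⁅A 0, A 2⁆),
    (t - 1)⁻¹ • ⁅A 0, A 1⁆,
    t⁻¹ • ⁅A 0, A 2⁆]

/-- `A` solves the Schlesinger system on `U`. -/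
def SolvesSchlesinger (U : Set ℂ) (A : ℂ → Fin 3 → Mat6) : Prop :=
  ∀ t ∈ U, ∀ i k l, HasDerivAt (fun s => A s i k l) (schlesingerField t (A t) i k l) t

/-! ### The normal form of the residue matrices -/

/-- The variables that occur in the normal form of the residue matrices. -/
structure Vars where
  (b₁ b₂ b₃ b₄ b₅ b₆ b₇ : ℂ)
  (c₁ c₂ c₃ c₄ c₅ c₆ c₇ : ℂ)
  (a₁ a₂ a₃ a₄ a₅ a₆ a₇ a₈ a₉ a₁₀ a₁₁ : ℂ)
  (a₁₂ a₁₃ a₁₄ a₁₅ a₁₆ a₁₇ a₁₈ a₁₉ : ℂ)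
  (a₂₀ a₂₁ a₂₂ a₂₃ a₂₄ a₂₅ a₂₆ a₂₇ : ℂ)

/-- The matrix `(I₃ ; B) (θ I₃ - C B, C)`. -/
def blockProduct (θ : ℂ) (B C : Matrix (Fin 3) (Fin 3) ℂ) : Mat6 :=
  (Matrix.fromRows (1 : Matrix (Fin 3) (Fin 3) ℂ) B *
      Matrix.fromCols (θ • (1 : Matrix (Fin 3) (Fin 3) ℂ) - C * B) C).submatrix
    (finSumFinEquiv (m := 3) (n := 3)).symm (finSumFinEquiv (m := 3) (n := 3)).symm

namespace Vars

variable (x : Vars)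

def B₁ : Matrix (Fin 3) (Fin 3) ℂ :=
  !![0, x.b₁, 0; x.b₂, x.a₁, x.b₃; x.b₄, x.a₂, x.b₅]

def C₁ : Matrix (Fin 3) (Fin 3) ℂ :=
  !![x.a₃, x.c₂, x.c₄; x.c₁, 0, 1; x.a₄, x.c₃, x.c₅]

def B₂ : Matrix (Fin 3) (Fin 3) ℂ :=
  !![x.a₅, x.a₆, 1; x.a₇, x.a₈, x.b₆; x.a₉, x.a₁₀, x.b₇]

def C₂ : Matrix (Fin 3) (Fin 3) ℂ :=
  !![1, 0, 1; 0, 1, 0; x.a₁₁, x.c₆, x.c₇]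

/-- The residue matrices `Ã₁, Ã₂, Ã₃` in normal form. -/
def residues (κ : Exponents) : Fin 3 → Mat6 :=
  ![blockProduct κ.θ₁ x.B₁ x.C₁,
    blockProduct κ.θ₂ x.B₂ x.C₂,
    (!![1, 0; 0, 1; 0, 0; 0, 0; 0, 0; 0, 0] : Matrix (Fin 6) (Fin 2) ℂ) *
      !![κ.θ₃, 0, x.a₁₂, x.a₁₃, x.a₁₄, x.a₁₅; 0, κ.θ₃, x.a₁₆, x.a₁₇, x.a₁₈, x.a₁₉]]

/-- The residue matrix `Ã_∞` in normal form. -/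
def residueInfinity (κ : Exponents) : Mat6 :=
  !![κ.ρ₁, 0, 0, 0, 0, 0;
     0, κ.ρ₁, 0, 0, 0, 0;
     x.a₂₀, x.a₂₁, κ.ρ₂, 0, 0, 0;
     x.a₂₂, x.a₂₃, 0, κ.ρ₂, 0, 0;
     x.a₂₄, x.a₂₅, 0, 0, κ.ρ₃, 0;
     x.a₂₆, x.a₂₇, 0, 0, 0, κ.ρ₃]

/-- The relations between the variables: `Ã_∞ = -(Ã₁ + Ã₂ + Ã₃)`. -/
def IsNormalForm (κ : Exponents) : Prop :=
  -(∑ i, x.residues κ i) = x.residueInfinity κ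

/-- The normal form is regular: the canonical coordinates below are defined (`b₁ ≠ 0`, `c₃ ≠ 0`),
and so is the gauge transformation that leads to the normal form (`b₆ ≠ 0`; it is undetermined
where the block of `Ã₂` that maps the third and fourth basis vectors to the first two
is singular, and the determinant of this block is `b₆`). -/
def IsRegular : Prop := x.b₁ ≠ 0 ∧ x.b₆ ≠ 0 ∧ x.c₃ ≠ 0

def b : Fin 7 → ℂ := ![x.b₁, x.b₂, x.b₃, x.b₄, x.b₅, x.b₆, x.b₇]

def c : Fin 7 → ℂ := ![x.c₁, x.c₂, x.c₃, x.c₄, x.c₅, x.c₆, x.c₇]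

/-- The intermediate coordinates `λ₁, …, λ₅`. -/
def lam : Fin 5 → ℂ := ![1 - x.c₁, -x.c₂, -x.c₃, -x.c₄, -x.c₅]

/-- The intermediate coordinates `μ₁, …, μ₅`. -/
def mu : Fin 5 → ℂ := ![x.b₁, x.b₂, x.b₃ - x.b₆, x.b₄, x.b₅ - x.b₇ - 1]

/-- The coordinates `q₁, q₂, q₃`, where
`q₁ = (μ₁ + λ₅) / λ₃`, `q₂ / t = λ₄`, `q₃ / t = -λ₂`. -/
noncomputable def q (t : ℂ) : Fin 3 → ℂ :=
  ![(x.mu 0 + x.lam 4) / x.lam 2, t * x.lam 3, -(t * x.lam 1)]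

/-- The coordinates `p₁, p₂, p₃`, where
`p₁ = -λ₃ (λ₁ - (θ₂ + ρ₂) / μ₁)`, `t p₂ = μ₄`, `t p₃ = -μ₂`. -/
noncomputable def p (κ : Exponents) (t : ℂ) : Fin 3 → ℂ :=
  ![-(x.lam 2 * (x.lam 0 - (κ.θ₂ + κ.ρ₂) / x.mu 0)), x.mu 3 / t, -(x.mu 1 / t)]

/-- The Hamiltonian `tr Ã₁Ã₂ / (t - 1) + tr Ã₁Ã₃ / t` of the Schlesinger system in normal form. -/
noncomputable def schlesingerHamiltonian (κ : Exponents) (t : ℂ) : ℂ :=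
  (x.residues κ 0 * x.residues κ 1).trace / (t - 1) + (x.residues κ 0 * x.residues κ 2).trace / t

end Vars

/-- The value at `A` of a polynomial in the entries of three matrices. -/
noncomputable def evalEntries (A : Fin 3 → Mat6) (G : MvPolynomial (Fin 3 × Fin 6 × Fin 6) ℂ) : ℂ :=
  eval (fun s => A s.1 s.2.1 s.2.2) G

/-- `P` transforms the system `A` into the regular normal form `x`. -/
def IsNormalization (κ : Exponents) (A : Fin 3 → Mat6) (P : Mat6) (x : Vars) : Prop :=
  IsUnit P.det ∧ (∀ i, P⁻¹ * A i * P = x.residues κ i) ∧ x.IsNormalForm κ ∧ x.IsRegular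

/-! ### The polynomial Hamiltonian system -/

/-- Polynomials in `q₁, q₂, q₃` (indices `Sum.inl j`) and `p₁, p₂, p₃` (indices `Sum.inr j`). -/
abbrev PhasePoly := MvPolynomial (Fin 3 ⊕ Fin 3) ℂ

/-- The Poisson bracket with `{q_i, p_j} = -δ_{ij}`, `{p_i, p_j} = {q_i, q_j} = 0`. -/
noncomputable def poisson (F G : PhasePoly) : PhasePoly :=
  ∑ j : Fin 3, (pderiv (Sum.inr j) F * pderiv (Sum.inl j) G
    - pderiv (Sum.inl j) F * pderiv (Sum.inr j) G)

/-- The Hamiltonian of the sixth Painlevé equation,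
`q(q-1)(q-t)p (p - (α₁-1)/(q-t) - α₃/(q-1) - α₄/q) + α₂(α₀+α₂) q`
with `α₀ + α₁ + 2α₂ + α₃ + α₄ = 1`. -/
noncomputable def HVI (α₀ α₁ α₃ α₄ : ℂ) (q p : PhasePoly) (t : ℂ) : PhasePoly :=
  let α₂ : ℂ := (1 - α₀ - α₁ - α₃ - α₄) / 2
  q * (q - 1) * (q - C t) * p ^ 2 - C (α₁ - 1) * (q * (q - 1) * p) - C α₃ * (q * (q - C t) * p)
    - C α₄ * ((q - 1) * (q - C t) * p) + C (α₂ * (α₀ + α₂)) * q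

/-- The Hamiltonian `H^{42,33,33,222}` at time `t`. -/
noncomputable def hamiltonian (κ : Exponents) (t : ℂ) : PhasePoly :=
  let θ₁ := κ.θ₁
  let θ₂ := κ.θ₂
  let θ₃ := κ.θ₃
  let ρ₂ := κ.ρ₂
  let ρ₃ := κ.ρ₃
  let q₁ : PhasePoly := X (Sum.inl 0)
  let q₂ : PhasePoly := X (Sum.inl 1)
  let q₃ : PhasePoly := X (Sum.inl 2)
  let p₁ : PhasePoly := X (Sum.inr 0)
  let p₂ : PhasePoly := X (Sum.inr 1)
  let p₃ : PhasePoly := X (Sum.inr 2)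
  HVI (θ₁ + θ₂ + ρ₂) (θ₁ + 2 * θ₂ + θ₃ + ρ₂ + 2 * ρ₃ + 1) (-θ₁ - θ₃)
      (-θ₁ - θ₂ - 2 * ρ₂ - 2 * ρ₃) q₁ p₁ t
    + q₁ * p₁ * (C t * p₁ + C ρ₂) - C ((θ₁ - θ₂ + 2 * ρ₂) / 2) * (q₂ * p₂)
    + HVI (-((θ₁ - θ₂ + 2 * ρ₂) / 2)) (-((θ₁ + θ₂ + 2 * θ₃ + 2 * ρ₂) / 2))
      (θ₁ + 2 * θ₂ + θ₃ + 2 * ρ₃ + 1) (2 * ρ₂) q₂ p₂ t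
    - C (2 * (t + 1)) * q₃ ^ 2 * p₃ ^ 2
    + C (-θ₁ - θ₂ - 2 * θ₃ - 1 + (3 * θ₁ + 3 * θ₂ + 2 * θ₃ + 4 * ρ₂ + 4 * ρ₃ + 1) * t) * (q₃ * p₃)
    - q₁ * q₃ * (q₁ * p₁ - C θ₂) * (q₁ * p₁ + C (θ₁ + ρ₂))
    - q₁ * q₂ * p₁ * (q₁ * p₁ + C ((θ₁ - θ₂ + 2 * ρ₂) / 2))
    + q₂ * q₃ * p₃ * (C 2 * (q₂ * p₂) + q₃ * p₃ - C ((θ₁ + 3 * θ₂ + 2 * ρ₂ + 4 * ρ₃) / 2))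
    + C t * q₃ * p₂ * (-(C 2 * (q₁ * p₁)) + C 3 * (q₂ * p₂) + C 4 * (q₃ * p₃)
      - C (2 * θ₁ + 2 * θ₂ + 2 * ρ₂ + 4 * ρ₃))
    + q₂ * p₃ * (C 2 * (q₁ * p₁) - q₃ * p₃ + C ((θ₁ - θ₂ + 2 * ρ₂) / 2))
    + C (2 * (t + 1)) * q₃ * p₃ * (q₁ * p₁ - q₂ * p₂)
    - C (2 * t) * (C (t + 1) * q₃ * p₂ ^ 2 + p₁ * p₂ * (q₁ + q₂) + q₃ * p₃ * (p₁ - C 2 * p₂))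
    + C (2 * t) * p₁ * (C (t + 1) * p₂ - p₃)

/-- The value of a polynomial in `(q, p)` at a point. -/
noncomputable def evalAt (q p : Fin 3 → ℂ) (F : PhasePoly) : ℂ := eval (Sum.elim q p) F

/-- The functions `q, p` satisfy on `U` the system
`t(t-1) dq_j/dt = {H, q_j}`, `t(t-1) dp_j/dt = {H, p_j}` (`j = 1, 2, 3`), `H = H^{42,33,33,222}`. -/
def SolvesHamiltonianSystem (κ : Exponents) (U : Set ℂ) (q p : ℂ → Fin 3 → ℂ) : Prop :=
  ∀ t ∈ U, ∀ j : Fin 3, ∃ dq dp : ℂ,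
    HasDerivAt (fun s => q s j) dq t ∧ HasDerivAt (fun s => p s j) dp t ∧
    t * (t - 1) * dq = evalAt (q t) (p t) (poisson (hamiltonian κ t) (X (Sum.inl j))) ∧
    t * (t - 1) * dp = evalAt (q t) (p t) (poisson (hamiltonian κ t) (X (Sum.inr j)))

/-! ### Two-parameter families and the symplectic form -/

/-- The value of `df ∧ dg` at `z` on the pair of coordinate vectors of `ℂ²`. -/
noncomputable def wedge (f g : ℂ × ℂ → ℂ) (z : ℂ × ℂ) : ℂ :=
  fderiv ℂ f z (1, 0) * fderiv ℂ g z (0, 1) - fderiv ℂ f z (0, 1) * fderiv ℂ g z (1, 0)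

/-- The ranks of the residue matrices at `x = t, 1, 0`. -/
def rk : Fin 3 → ℕ := ![3, 3, 2]

/-- The symplectic form `∑ᵢ tr(dBᵢ ∧ dCᵢ)`, evaluated on a two-parameter family. -/
noncomputable def symplecticForm (B : (i : Fin 3) → ℂ × ℂ → Matrix (Fin 6) (Fin (rk i)) ℂ)
    (C : (i : Fin 3) → ℂ × ℂ → Matrix (Fin (rk i)) (Fin 6) ℂ) (z : ℂ × ℂ) : ℂ :=
  ∑ i, ∑ k, ∑ l, wedge (fun w => B i w k l) (fun w => C i w l k) z

end Painleve42

/-! Each residue satisfies `A² = θA`, so it factors as `A = BC` with `CB = θ`, and tr(dB ∧ dC)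
depends on `A` alone: it is the Kirillov–Kostant form of the orbit (`kks`, `kks_factor`). Canonicity
and dynamics are both computed with `kks`, which needs no choice of factors.

Coordinates (statements 2, 3). Solving the entries of Ã_∞ = -∑ Ã_i for the a_j leaves six equations
between λ, μ, b₆, b₇ (`Core.Relations`). Two of them are the constraints of statement 2; they
express λ₁, λ₅, μ₃, μ₅ by q₁, p₁, s = μ₁ and l = λ₃ (`Darboux.coreOf`). The other four become αs +
βl = 0, (ρ₂ - ρ₃)sl + γs + δl = 0 and two linear equations for b₆, b₇, with α, β, γ, δ polynomial in
the canonical coordinates (`Darboux.coreOf_relations_iff`). With N = αδ - βγ they have exactly one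
solution with s, l, b₆ nonzero when αβN ≠ 0, and none otherwise.

Canonicity (statement 4). Passing from A_i to P⁻¹A_iP adds commutators with Ω = P⁻¹dP to the
differentials. The form pairs a commutator by a plain trace (`kks_commutator`), and the correction
terms sum to zero because ∑ A_i is constant, dÃ_∞ lives in the lower left block, and Ω is block
lower triangular since ρ₁ ≠ ρ₂, ρ₃ (`sum_kks_gauge`, `isBlockLower_gauge`). In the normal form every
a_j of the factors faces a constant, so only the pairs b_j, c_j survive; the constraints then reduce
seven pairs to five and to three (`sum_b_c_eq_sum_lam_mu`, `elimination_identity`).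

Hamiltonian (statements 5, 6). In tr Ã₁Ã₂ and tr Ã₁Ã₃ the quantities s, l, b₆, b₇ cancel, and what
remains is polynomial. The Schlesinger flow is dA_i/dt = [U_i, A_i] with U_i the gradient of the
Schlesinger Hamiltonian in A_i, so pairing the flow with any variation gives the differential of
that Hamiltonian (`sum_kks_schlesinger`); the gauge term drops out as before. The explicit t in q₂,
q₃, p₂, p₃ accounts for the extra q₂p₂/t + q₃p₃/t.

Normalization (statement 1). A unipotent shear moves the image of A₃ to the span of the first two
basis vectors, and a block diagonal matrix built from image vectors of A₁, A₂ does the rest, all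
rationally in the entries. Applied to a regular normal form the block diagonal matrix is scalar
(`GaugeData.D_eq_of_normalForm`), so one regular normal form, which exists by the analysis of αβN,
shows that no denominator or genericity condition vanishes identically. Clearing denominators only
rescales the gauge matrix. -/

namespace Painleve42

open Matrix

/-! ### Block form of the normal form and its scalar equations -/

/-- The identification of `6 × 6` matrices with `2 × 2` block matrices of `3 × 3` matrices. -/
noncomputable def blockEquiv : Matrix (Fin 3 ⊕ Fin 3) (Fin 3 ⊕ Fin 3) ℂ ≃ₐ[ℂ] Mat6 :=
  Matrix.reindexAlgEquiv ℂ ℂ (finSumFinEquiv (m := 3) (n := 3))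

theorem finSumFinEquiv_three :
    (finSumFinEquiv (Sum.inl 0) : Fin (3 + 3)) = 0 ∧
    (finSumFinEquiv (Sum.inl 1) : Fin (3 + 3)) = 1 ∧
    (finSumFinEquiv (Sum.inl 2) : Fin (3 + 3)) = 2 ∧
    (finSumFinEquiv (Sum.inr 0) : Fin (3 + 3)) = 3 ∧
    (finSumFinEquiv (Sum.inr 1) : Fin (3 + 3)) = 4 ∧
    (finSumFinEquiv (Sum.inr 2) : Fin (3 + 3)) = 5 :=
  ⟨rfl, rfl, rfl, rfl, rfl, rfl⟩

theorem blockProduct_eq (θ : ℂ) (B C : Matrix (Fin 3) (Fin 3) ℂ) :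
    blockProduct θ B C = blockEquiv
      (fromBlocks (θ • (1 : Matrix (Fin 3) (Fin 3) ℂ) - C * B) C
        (B * (θ • (1 : Matrix (Fin 3) (Fin 3) ℂ) - C * B)) (B * C)) := by
  rw [blockProduct, fromRows_mul_fromCols, Matrix.one_mul, Matrix.one_mul]
  rfl

theorem residues_two_eq (κ : Exponents) (x : Vars) :
    x.residues κ 2 = blockEquiv
      (fromBlocks !![κ.θ₃, 0, x.a₁₂; 0, κ.θ₃, x.a₁₆; 0, 0, 0]
        !![x.a₁₃, x.a₁₄, x.a₁₅; x.a₁₇, x.a₁₈, x.a₁₉; 0, 0, 0] 0 0) := by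
  rw [← EquivLike.inv_apply_eq]
  ext i j
  rcases i with i | i <;> rcases j with j | j <;> fin_cases i <;> fin_cases j <;>
    simp [Vars.residues, blockEquiv, EquivLike.inv, finSumFinEquiv_three]

theorem residueInfinity_eq (κ : Exponents) (x : Vars) :
    x.residueInfinity κ = blockEquiv
      (fromBlocks !![κ.ρ₁, 0, 0; 0, κ.ρ₁, 0; x.a₂₀, x.a₂₁, κ.ρ₂] 0
        !![x.a₂₂, x.a₂₃, 0; x.a₂₄, x.a₂₅, 0; x.a₂₆, x.a₂₇, 0]
        !![κ.ρ₂, 0, 0; 0, κ.ρ₃, 0; 0, 0, κ.ρ₃]) := by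
  rw [← EquivLike.inv_apply_eq]
  ext i j
  rcases i with i | i <;> rcases j with j | j <;> fin_cases i <;> fin_cases j <;>
    simp [Vars.residueInfinity, blockEquiv, EquivLike.inv, finSumFinEquiv_three]

theorem isNormalForm_iff_blocks (κ : Exponents) (x : Vars) :
    x.IsNormalForm κ ↔
      -((κ.θ₁ • 1 - x.C₁ * x.B₁) + (κ.θ₂ • 1 - x.C₂ * x.B₂) +
          !![κ.θ₃, 0, x.a₁₂; 0, κ.θ₃, x.a₁₆; 0, 0, 0]) =
        !![κ.ρ₁, 0, 0; 0, κ.ρ₁, 0; x.a₂₀, x.a₂₁, κ.ρ₂] ∧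
      -(x.C₁ + x.C₂ + !![x.a₁₃, x.a₁₄, x.a₁₅; x.a₁₇, x.a₁₈, x.a₁₉; 0, 0, 0]) = 0 ∧
      -(x.B₁ * (κ.θ₁ • 1 - x.C₁ * x.B₁) + x.B₂ * (κ.θ₂ • 1 - x.C₂ * x.B₂)) =
        !![x.a₂₂, x.a₂₃, 0; x.a₂₄, x.a₂₅, 0; x.a₂₆, x.a₂₇, 0] ∧
      -(x.B₁ * x.C₁ + x.B₂ * x.C₂) = !![κ.ρ₂, 0, 0; 0, κ.ρ₃, 0; 0, 0, κ.ρ₃] := by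
  have h0 : x.residues κ 0 = blockProduct κ.θ₁ x.B₁ x.C₁ := rfl
  have h1 : x.residues κ 1 = blockProduct κ.θ₂ x.B₂ x.C₂ := rfl
  rw [Vars.IsNormalForm, Fin.sum_univ_three, residueInfinity_eq, residues_two_eq, h0, h1,
    blockProduct_eq, blockProduct_eq, ← map_add, ← map_add, ← map_neg,
    blockEquiv.injective.eq_iff, fromBlocks_add, fromBlocks_add, fromBlocks_neg,
    Matrix.fromBlocks_inj]
  simp only [add_zero]

/-- The equations between the variables of a normal form, entry by entry. The names refer to
the positions in the `2 × 2` block form of `Ã_∞`. -/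
structure Vars.Relations (x : Vars) (κ : Exponents) : Prop where
  tl11 : x.c₂ * x.b₂ + x.c₄ * x.b₄ + x.a₅ + x.a₉ = κ.θ₁ + κ.θ₂ + κ.θ₃ + κ.ρ₁
  tl12 : x.a₃ * x.b₁ + x.c₂ * x.a₁ + x.c₄ * x.a₂ + x.a₆ + x.a₁₀ = 0
  a₁₂_eq : x.a₁₂ = 1 + x.b₇ + x.c₂ * x.b₃ + x.c₄ * x.b₅
  a₇_eq : x.a₇ = -x.b₄
  tl22 : x.a₈ + x.c₁ * x.b₁ + x.a₂ = κ.θ₁ + κ.θ₂ + κ.θ₃ + κ.ρ₁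
  a₁₆_eq : x.a₁₆ = x.b₆ + x.b₅
  a₂₀_eq : x.a₂₀ = x.a₁₁ * x.a₅ + x.c₆ * x.a₇ + x.c₇ * x.a₉ + x.c₃ * x.b₂ + x.c₅ * x.b₄
  a₂₁_eq : x.a₂₁ = x.a₁₁ * x.a₆ + x.c₆ * x.a₈ + x.c₇ * x.a₁₀ + x.a₄ * x.b₁ + x.c₃ * x.a₁
      + x.c₅ * x.a₂
  tl33 : x.a₁₁ + x.c₆ * x.b₆ + x.c₇ * x.b₇ + x.c₃ * x.b₃ + x.c₅ * x.b₅ = κ.θ₁ + κ.θ₂ + κ.ρ₂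
  a₁₃_eq : x.a₁₃ = -1 - x.a₃
  a₁₄_eq : x.a₁₄ = -x.c₂
  a₁₅_eq : x.a₁₅ = -1 - x.c₄
  a₁₇_eq : x.a₁₇ = -x.c₁
  a₁₈_eq : x.a₁₈ = -1
  a₁₉_eq : x.a₁₉ = -1
  a₁₁_eq : x.a₁₁ = -x.a₄
  c₆_eq : x.c₆ = -x.c₃
  c₇_eq : x.c₇ = -x.c₅
  a₂₂_eq : x.a₂₂ = x.a₁₁ * x.a₅ + x.c₆ * x.a₇ + x.c₇ * x.a₉ + x.a₆ * x.a₇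
      - x.a₅ * (κ.θ₂ - (x.a₅ + x.a₉)) + x.b₁ * x.b₄
  a₂₃_eq : x.a₂₃ = x.a₁₁ * x.a₆ + x.c₆ * x.a₈ + x.c₇ * x.a₁₀ - x.a₆ * (κ.θ₂ - x.a₈)
      + x.a₅ * (x.a₁₀ + x.a₆) - x.b₁ * (κ.θ₁ - (x.c₁ * x.b₁ + x.a₂))
  bl13 : x.a₁₁ + x.c₆ * x.b₆ + x.c₇ * x.b₇ - κ.θ₂ + x.a₆ * x.b₆ + x.a₅ * (x.b₇ + 1)
      + x.b₁ * x.b₅ = 0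
  a₂₄_eq : x.a₂₄ = x.b₆ * (x.c₇ * x.a₉ + x.c₆ * x.a₇ + x.a₁₁ * x.a₅) + x.a₈ * x.a₇
      - x.a₇ * (κ.θ₂ - (x.a₅ + x.a₉)) + x.b₃ * (x.c₅ * x.b₄ + x.c₃ * x.b₂) + x.a₁ * x.b₄
      - x.b₂ * (κ.θ₁ - (x.c₂ * x.b₂ + x.c₄ * x.b₄))
  a₂₅_eq : x.a₂₅ = x.b₆ * (x.c₇ * x.a₁₀ + x.c₆ * x.a₈ + x.a₁₁ * x.a₆) - x.a₈ * (κ.θ₂ - x.a₈)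
      + x.a₇ * (x.a₁₀ + x.a₆) + x.b₃ * (x.c₅ * x.a₂ + x.c₃ * x.a₁ + x.a₄ * x.b₁)
      - x.a₁ * (κ.θ₁ - (x.c₁ * x.b₁ + x.a₂)) + x.b₂ * (x.c₄ * x.a₂ + x.c₂ * x.a₁ + x.a₃ * x.b₁)
  bl23 : -(x.b₆ * (κ.θ₂ - (x.a₁₁ + x.c₆ * x.b₆ + x.c₇ * x.b₇))) + x.a₈ * x.b₆ + x.a₇ * (x.b₇ + 1)
      - x.b₃ * (κ.θ₁ - (x.c₃ * x.b₃ + x.c₅ * x.b₅)) + x.a₁ * x.b₅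
      + x.b₂ * (x.c₄ * x.b₅ + x.c₂ * x.b₃) = 0
  a₂₆_eq : x.a₂₆ = x.b₇ * (x.c₇ * x.a₉ + x.c₆ * x.a₇ + x.a₁₁ * x.a₅) + x.a₁₀ * x.a₇
      - x.a₉ * (κ.θ₂ - (x.a₅ + x.a₉)) + x.b₅ * (x.c₅ * x.b₄ + x.c₃ * x.b₂) + x.a₂ * x.b₄
      - x.b₄ * (κ.θ₁ - (x.c₂ * x.b₂ + x.c₄ * x.b₄))
  a₂₇_eq : x.a₂₇ = x.b₇ * (x.c₇ * x.a₁₀ + x.c₆ * x.a₈ + x.a₁₁ * x.a₆) - x.a₁₀ * (κ.θ₂ - x.a₈)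
      + x.a₉ * (x.a₁₀ + x.a₆) + x.b₅ * (x.c₅ * x.a₂ + x.c₃ * x.a₁ + x.a₄ * x.b₁)
      - x.a₂ * (κ.θ₁ - (x.c₁ * x.b₁ + x.a₂)) + x.b₄ * (x.c₄ * x.a₂ + x.c₂ * x.a₁ + x.a₃ * x.b₁)
  bl33 : -(x.b₇ * (κ.θ₂ - (x.a₁₁ + x.c₆ * x.b₆ + x.c₇ * x.b₇))) + x.a₁₀ * x.b₆ + x.a₉ * (x.b₇ + 1)
      - x.b₅ * (κ.θ₁ - (x.c₃ * x.b₃ + x.c₅ * x.b₅)) + x.a₂ * x.b₅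
      + x.b₄ * (x.c₄ * x.b₅ + x.c₂ * x.b₃) = 0
  br11 : x.b₁ * x.c₁ + x.a₅ + x.a₁₁ = -κ.ρ₂
  br12 : x.a₆ = -x.c₆
  br13 : x.a₅ = -x.c₇ - x.b₁
  br21 : x.b₂ * x.a₃ + x.a₁ * x.c₁ + x.b₃ * x.a₄ + x.a₇ + x.b₆ * x.a₁₁ = 0
  br22 : x.b₂ * x.c₂ + x.b₃ * x.c₃ + x.a₈ + x.b₆ * x.c₆ = -κ.ρ₃
  br23 : x.b₂ * x.c₄ + x.a₁ + x.b₃ * x.c₅ + x.a₇ + x.b₆ * x.c₇ = 0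
  br31 : x.b₄ * x.a₃ + x.a₂ * x.c₁ + x.b₅ * x.a₄ + x.a₉ + x.b₇ * x.a₁₁ = 0
  br32 : x.b₄ * x.c₂ + x.b₅ * x.c₃ + x.a₁₀ + x.b₇ * x.c₆ = 0
  br33 : x.b₄ * x.c₄ + x.a₂ + x.b₅ * x.c₅ + x.a₉ + x.b₇ * x.c₇ = -κ.ρ₃

theorem isNormalForm_iff (κ : Exponents) (x : Vars) : x.IsNormalForm κ ↔ x.Relations κ := by
  rw [isNormalForm_iff_blocks]
  simp only [← Matrix.ext_iff, Fin.forall_fin_succ, Vars.B₁,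
    Vars.C₁, Vars.B₂, Vars.C₂, Matrix.one_fin_three, Matrix.smul_of]
  simp
  constructor
  · rintro ⟨⟨⟨h1, h2, h3⟩, ⟨h4, h5, h6⟩, ⟨h7, h8, h9⟩⟩, ⟨⟨h10, h11, h12⟩, ⟨h13, h14, h15⟩,
      ⟨h16, h17, h18⟩⟩, ⟨⟨h19, h20, h21⟩, ⟨h22, h23, h24⟩, ⟨h25, h26, h27⟩⟩, ⟨⟨h28, h29, h30⟩,
      ⟨h31, h32, h33⟩, ⟨h34, h35, h36⟩⟩⟩
    exact ⟨by linear_combination h1, by linear_combination h2, by linear_combination -h3,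
      by linear_combination h4, by linear_combination h5, by linear_combination -h6,
      by linear_combination -h7, by linear_combination -h8, by linear_combination h9,
      by linear_combination -h10, by linear_combination -h11, by linear_combination -h12,
      by linear_combination -h13, by linear_combination -h14, by linear_combination -h15,
      by linear_combination -h16, by linear_combination -h17, by linear_combination -h18,
      by linear_combination -h19, by linear_combination -h20, by linear_combination h21,
      by linear_combination -h22, by linear_combination -h23, by linear_combination h24,
      by linear_combination -h25, by linear_combination -h26, by linear_combination h27,
      by linear_combination -h28, by linear_combination -h29, by linear_combination -h30,
      by linear_combination -h31, by linear_combination -h32, by linear_combination -h33,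
      by linear_combination -h34, by linear_combination -h35, by linear_combination -h36⟩
  · intro h
    exact ⟨⟨⟨by linear_combination h.tl11,
      by linear_combination h.tl12,
      by linear_combination -h.a₁₂_eq⟩,
      ⟨by linear_combination h.a₇_eq,
      by linear_combination h.tl22,
      by linear_combination -h.a₁₆_eq⟩,
      ⟨by linear_combination -h.a₂₀_eq,
      by linear_combination -h.a₂₁_eq,
      by linear_combination h.tl33⟩⟩,
      ⟨⟨by linear_combination -h.a₁₃_eq,
      by linear_combination -h.a₁₄_eq,
      by linear_combination -h.a₁₅_eq⟩,
      ⟨by linear_combination -h.a₁₇_eq,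
      by linear_combination -h.a₁₈_eq,
      by linear_combination -h.a₁₉_eq⟩,
      ⟨by linear_combination -h.a₁₁_eq,
      by linear_combination -h.c₆_eq,
      by linear_combination -h.c₇_eq⟩⟩,
      ⟨⟨by linear_combination -h.a₂₂_eq,
      by linear_combination -h.a₂₃_eq,
      by linear_combination h.bl13⟩,
      ⟨by linear_combination -h.a₂₄_eq,
      by linear_combination -h.a₂₅_eq,
      by linear_combination h.bl23⟩,
      ⟨by linear_combination -h.a₂₆_eq,
      by linear_combination -h.a₂₇_eq,
      by linear_combination h.bl33⟩⟩,
      ⟨⟨by linear_combination -h.br11,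
      by linear_combination -h.br12,
      by linear_combination -h.br13⟩,
      ⟨by linear_combination -h.br21,
      by linear_combination -h.br22,
      by linear_combination -h.br23⟩,
      ⟨by linear_combination -h.br31,
      by linear_combination -h.br32,
      by linear_combination -h.br33⟩⟩⟩

end Painleve42

/-! ### The intermediate coordinates λ, μ -/

namespace Painleve42

namespace Vars

/-- The entries of `Ã_∞` below the diagonal, as functions of the other variables. -/
def fillInfinity (κ : Exponents) (x : Vars) : Vars :=
  { x with
    a₂₀ := x.a₁₁ * x.a₅ + x.c₆ * x.a₇ + x.c₇ * x.a₉ + x.c₃ * x.b₂ + x.c₅ * x.b₄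
    a₂₁ := x.a₁₁ * x.a₆ + x.c₆ * x.a₈ + x.c₇ * x.a₁₀ + x.a₄ * x.b₁ + x.c₃ * x.a₁ + x.c₅ * x.a₂
    a₂₂ := x.a₁₁ * x.a₅ + x.c₆ * x.a₇ + x.c₇ * x.a₉ + x.a₆ * x.a₇
      - x.a₅ * (κ.θ₂ - (x.a₅ + x.a₉)) + x.b₁ * x.b₄
    a₂₃ := x.a₁₁ * x.a₆ + x.c₆ * x.a₈ + x.c₇ * x.a₁₀ - x.a₆ * (κ.θ₂ - x.a₈)
      + x.a₅ * (x.a₁₀ + x.a₆) - x.b₁ * (κ.θ₁ - (x.c₁ * x.b₁ + x.a₂))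
    a₂₄ := x.b₆ * (x.c₇ * x.a₉ + x.c₆ * x.a₇ + x.a₁₁ * x.a₅) + x.a₈ * x.a₇
      - x.a₇ * (κ.θ₂ - (x.a₅ + x.a₉)) + x.b₃ * (x.c₅ * x.b₄ + x.c₃ * x.b₂) + x.a₁ * x.b₄
      - x.b₂ * (κ.θ₁ - (x.c₂ * x.b₂ + x.c₄ * x.b₄))
    a₂₅ := x.b₆ * (x.c₇ * x.a₁₀ + x.c₆ * x.a₈ + x.a₁₁ * x.a₆) - x.a₈ * (κ.θ₂ - x.a₈)
      + x.a₇ * (x.a₁₀ + x.a₆) + x.b₃ * (x.c₅ * x.a₂ + x.c₃ * x.a₁ + x.a₄ * x.b₁)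
      - x.a₁ * (κ.θ₁ - (x.c₁ * x.b₁ + x.a₂)) + x.b₂ * (x.c₄ * x.a₂ + x.c₂ * x.a₁ + x.a₃ * x.b₁)
    a₂₆ := x.b₇ * (x.c₇ * x.a₉ + x.c₆ * x.a₇ + x.a₁₁ * x.a₅) + x.a₁₀ * x.a₇
      - x.a₉ * (κ.θ₂ - (x.a₅ + x.a₉)) + x.b₅ * (x.c₅ * x.b₄ + x.c₃ * x.b₂) + x.a₂ * x.b₄
      - x.b₄ * (κ.θ₁ - (x.c₂ * x.b₂ + x.c₄ * x.b₄))
    a₂₇ := x.b₇ * (x.c₇ * x.a₁₀ + x.c₆ * x.a₈ + x.a₁₁ * x.a₆) - x.a₁₀ * (κ.θ₂ - x.a₈)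
      + x.a₉ * (x.a₁₀ + x.a₆) + x.b₅ * (x.c₅ * x.a₂ + x.c₃ * x.a₁ + x.a₄ * x.b₁)
      - x.a₂ * (κ.θ₁ - (x.c₁ * x.b₁ + x.a₂)) + x.b₄ * (x.c₄ * x.a₂ + x.c₂ * x.a₁ + x.a₃ * x.b₁) }

end Vars

/-- The intermediate coordinates `λ, μ`, together with `b₆, b₇`, which determine a normal form. -/
structure Core where
  (l₁ l₂ l₃ l₄ l₅ m₁ m₂ m₃ m₄ m₅ b₆ b₇ : ℂ)

def Vars.core (x : Vars) : Core where
  l₁ := 1 - x.c₁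
  l₂ := -x.c₂
  l₃ := -x.c₃
  l₄ := -x.c₄
  l₅ := -x.c₅
  m₁ := x.b₁
  m₂ := x.b₂
  m₃ := x.b₃ - x.b₆
  m₄ := x.b₄
  m₅ := x.b₅ - x.b₇ - 1
  b₆ := x.b₆
  b₇ := x.b₇

namespace Core

variable (κ : Exponents) (y : Core)

def a₁ : ℂ := y.m₂ * y.l₄ + y.m₃ * y.l₅ + y.m₄

def a₂ : ℂ :=
  κ.θ₁ + κ.θ₂ + κ.θ₃ + κ.ρ₁ + κ.ρ₃ - y.m₁ + y.l₁ * y.m₁ - y.m₂ * y.l₂ - y.l₃ * y.m₃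

/-- The product `a₃ b₁`. -/
def a₃b₁ : ℂ := y.l₂ * y.a₁ + y.l₄ * y.a₂ κ - y.m₄ * y.l₂ - y.m₅ * y.l₃

def a₄ : ℂ := κ.ρ₂ - y.l₁ * y.m₁ - y.l₅

def a₉ : ℂ :=
  κ.θ₁ + κ.θ₂ + κ.θ₃ + κ.ρ₁ + y.l₂ * y.m₂ + y.l₄ * y.m₄ + y.l₅ + y.m₁

/-- The normal form with given intermediate coordinates. -/
noncomputable def toVars : Vars :=
  Vars.fillInfinity κ
    { b₁ := y.m₁
      b₂ := y.m₂
      b₃ := y.m₃ + y.b₆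
      b₄ := y.m₄
      b₅ := y.m₅ + y.b₇ + 1
      b₆ := y.b₆
      b₇ := y.b₇
      c₁ := 1 - y.l₁
      c₂ := -y.l₂
      c₃ := -y.l₃
      c₄ := -y.l₄
      c₅ := -y.l₅
      c₆ := y.l₃
      c₇ := y.l₅
      a₁ := y.a₁
      a₂ := y.a₂ κ
      a₃ := y.a₃b₁ κ / y.m₁
      a₄ := y.a₄ κ
      a₅ := -y.l₅ - y.m₁
      a₆ := -y.l₃
      a₇ := -y.m₄
      a₈ := -κ.ρ₃ + y.m₂ * y.l₂ + y.m₃ * y.l₃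
      a₉ := y.a₉ κ
      a₁₀ := y.m₄ * y.l₂ + (y.m₅ + 1) * y.l₃
      a₁₁ := -y.a₄ κ
      a₁₂ := 1 + y.b₇ - y.l₂ * (y.m₃ + y.b₆) - y.l₄ * (y.m₅ + y.b₇ + 1)
      a₁₃ := -1 - y.a₃b₁ κ / y.m₁
      a₁₄ := y.l₂
      a₁₅ := -1 + y.l₄
      a₁₆ := y.b₆ + (y.m₅ + y.b₇ + 1)
      a₁₇ := y.l₁ - 1
      a₁₈ := -1
      a₁₉ := -1
      a₂₀ := 0
      a₂₁ := 0
      a₂₂ := 0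
      a₂₃ := 0
      a₂₄ := 0
      a₂₅ := 0
      a₂₆ := 0
      a₂₇ := 0 }

/-- The equations between the intermediate coordinates that define the normal forms. -/
structure Relations : Prop where
  e₁ : y.l₁ * y.m₁ + y.m₁ * y.m₅ - κ.θ₂ - κ.ρ₂ = 0
  e₂ : y.l₁ * y.m₁ - y.l₃ * y.m₃ - y.l₅ * y.m₅ - κ.θ₁ - κ.θ₂ - 2 * κ.ρ₂ = 0
  e₃ : y.m₂ * y.a₃b₁ κ + y.m₁ * (y.a₁ * (1 - y.l₁) + y.m₃ * y.a₄ κ - y.m₄) = 0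
  e₄ : y.m₄ * y.a₃b₁ κ + y.m₁ * (y.a₂ κ * (1 - y.l₁) + (y.m₅ + 1) * y.a₄ κ + y.a₉ κ) = 0
  e₅ : (κ.ρ₃ - κ.ρ₂) * y.b₆ + y.m₃ * (κ.θ₁ + y.m₂ * y.l₂ + y.l₃ * y.m₃) - y.m₄ * y.m₅ = 0
  e₆ : (κ.ρ₃ - κ.ρ₂) * y.b₇ + (y.m₅ + 1) * (κ.θ₁ - y.a₂ κ + y.l₃ * y.m₃ + y.l₅ * (y.m₅ + 1))
    + y.m₄ * (y.l₂ * y.m₃ + y.l₄ * (y.m₅ + 1)) - y.a₉ κ = 0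

end Core

variable {κ : Exponents} {x : Vars}

/-- Subtracting from `bl13` the first row of the lower right block times the third column (1, b₆,
b₇) of B̃₂ leaves only differences of B̃₁ and B̃₂, so that b₅ and b₇ survive only through μ₅. -/
theorem Vars.Relations.core_e₁ (h : x.Relations κ) :
    x.core.l₁ * x.core.m₁ + x.core.m₁ * x.core.m₅ - κ.θ₂ - κ.ρ₂ = 0 := by
  simp only [Vars.core]
  linear_combination h.bl13 - h.br11 - x.b₆ * h.br12 - x.b₇ * h.br13

theorem Vars.Relations.core_e₂ (h : x.Relations κ) :
    x.core.l₁ * x.core.m₁ - x.core.l₃ * x.core.m₃ - x.core.l₅ * x.core.m₅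
      - κ.θ₁ - κ.θ₂ - 2 * κ.ρ₂ = 0 := by
  simp only [Vars.core]
  linear_combination h.tl33 - h.br11 + h.br13 - x.b₆ * h.c₆_eq - (x.b₇ + 1) * h.c₇_eq

/-- Each of these a_j occurs linearly in some entry of Ã_∞. For a₃ the coefficient is b₁, hence the
product a₃b₁. -/
theorem Vars.Relations.a_eqs (h : x.Relations κ) :
    x.a₁ = x.core.a₁ ∧ x.a₂ = x.core.a₂ κ ∧ x.a₃ * x.b₁ = x.core.a₃b₁ κ ∧ x.a₄ = x.core.a₄ κ ∧
    x.a₅ = x.c₅ - x.b₁ ∧ x.a₆ = x.c₃ ∧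
    x.a₈ = -κ.ρ₃ + x.core.m₂ * x.core.l₂ + x.core.m₃ * x.core.l₃ ∧ x.a₉ = x.core.a₉ κ ∧
    x.a₁₀ = x.core.m₄ * x.core.l₂ + (x.core.m₅ + 1) * x.core.l₃ := by
  have h5 : x.a₅ = x.c₅ - x.b₁ := by linear_combination h.br13 - h.c₇_eq
  have h6 : x.a₆ = x.c₃ := by linear_combination h.br12 - h.c₆_eq
  have h1 : x.a₁ = x.core.a₁ := by
    simp only [Vars.core, Core.a₁]
    linear_combination h.br23 - h.a₇_eq - x.b₆ * h.c₇_eq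
  have h8 : x.a₈ = -κ.ρ₃ + x.core.m₂ * x.core.l₂ + x.core.m₃ * x.core.l₃ := by
    simp only [Vars.core]
    linear_combination h.br22 - x.b₆ * h.c₆_eq
  have h2 : x.a₂ = x.core.a₂ κ := by
    rw [Core.a₂]
    simp only [Vars.core] at h8 ⊢
    linear_combination h.tl22 - h8
  have h9 : x.a₉ = x.core.a₉ κ := by
    simp only [Vars.core, Core.a₉]
    linear_combination h.tl11 - h5
  have h10 : x.a₁₀ = x.core.m₄ * x.core.l₂ + (x.core.m₅ + 1) * x.core.l₃ := by
    simp only [Vars.core]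
    linear_combination h.br32 - x.b₇ * h.c₆_eq
  have h4 : x.a₄ = x.core.a₄ κ := by
    simp only [Vars.core, Core.a₄]
    linear_combination h.a₁₁_eq - h.br11 + h5
  refine ⟨h1, h2, ?_, h4, h5, h6, h8, h9, h10⟩
  rw [Core.a₃b₁, ← h1, ← h2]
  simp only [Vars.core] at h10 ⊢
  linear_combination h.tl12 - h6 - h10

/-- These are the entries of Ã_∞ not used up in solving for the a_j. `br21` and `br31` are
multiplied by b₁ because only the product a₃b₁ is polynomial in the core; `bl23` and `bl33` become
linear in b₆ and b₇ once `tl33` is used. -/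
theorem Vars.Relations.core_relations (h : x.Relations κ) :
    x.core.Relations κ := by
  obtain ⟨h1, h2, h3, h4, h5, h6, h8, h9, h10⟩ := h.a_eqs
  have e23 := h.bl23
  have e33 := h.bl33
  refine ⟨h.core_e₁, h.core_e₂, ?_, ?_, ?_, ?_⟩
  · rw [← h1, ← h3, ← h4]
    simp only [Vars.core]
    linear_combination x.b₁ * h.br21 - x.b₁ * x.b₆ * h.a₁₁_eq - x.b₁ * h.a₇_eq
  · rw [← h2, ← h3, ← h4, ← h9]
    simp only [Vars.core]
    linear_combination x.b₁ * h.br31 - x.b₁ * x.b₇ * h.a₁₁_eq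
  · simp only [Vars.core, Core.a₁] at h1 h8 ⊢
    linear_combination -h.bl23 + x.b₆ * h.tl33 + x.b₆ * h8 + x.b₅ * h1 + (x.b₇ + 1) * h.a₇_eq
  · rw [← h2, ← h9]
    simp only [Vars.core] at h10 ⊢
    linear_combination -h.bl33 + x.b₇ * h.tl33 + x.b₆ * h10 + x.b₇ * h.br33 - x.b₇ ^ 2 * h.c₇_eq

/-- The core determines all variables; recovering a₃ from a₃b₁ is the only division, and the reason
for assuming b₁ ≠ 0. -/
theorem Vars.Relations.toVars_core (h : x.Relations κ) (hb : x.b₁ ≠ 0) :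
    x.core.toVars κ = x := by
  obtain ⟨h1, h2, h3, h4, h5, h6, h8, h9, h10⟩ := h.a_eqs
  have h3' : x.core.a₃b₁ κ / x.core.m₁ = x.a₃ := by
    rw [← h3]; exact mul_div_cancel_right₀ _ hb
  have h7 : -x.core.m₄ = x.a₇ := h.a₇_eq.symm
  rw [Core.toVars, h3', ← h1, ← h2, ← h4, ← h9, ← h8, ← h10, h7, ← h.a₁₁_eq]
  have g5 : -x.core.l₅ - x.core.m₁ = x.a₅ := by rw [h5]; simp [Vars.core]
  have g6 : -x.core.l₃ = x.a₆ := by rw [h6]; simp [Vars.core]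
  have g12 : 1 + x.core.b₇ - x.core.l₂ * (x.core.m₃ + x.core.b₆)
      - x.core.l₄ * (x.core.m₅ + x.core.b₇ + 1) = x.a₁₂ := by
    simp only [Vars.core]; linear_combination -h.a₁₂_eq
  have g16 : x.core.b₆ + (x.core.m₅ + x.core.b₇ + 1) = x.a₁₆ := by
    simp only [Vars.core]; linear_combination -h.a₁₆_eq
  have gc6 : x.core.l₃ = x.c₆ := h.c₆_eq.symm
  have gc7 : x.core.l₅ = x.c₇ := h.c₇_eq.symm
  have g14 : x.core.l₂ = x.a₁₄ := h.a₁₄_eq.symm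
  have g15 : -1 + x.core.l₄ = x.a₁₅ := by
    simp only [Vars.core]; linear_combination -h.a₁₅_eq
  have g17 : x.core.l₁ - 1 = x.a₁₇ := by
    simp only [Vars.core]; linear_combination -h.a₁₇_eq
  have gb3 : x.core.m₃ + x.core.b₆ = x.b₃ := by simp [Vars.core]
  have gb5 : x.core.m₅ + x.core.b₇ + 1 = x.b₅ := by simp only [Vars.core]; ring
  have gc1 : 1 - x.core.l₁ = x.c₁ := by simp [Vars.core]
  have gc2 : -x.core.l₂ = x.c₂ := by simp [Vars.core]
  have gc3 : -x.core.l₃ = x.c₃ := by simp [Vars.core]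
  have gc4 : -x.core.l₄ = x.c₄ := by simp [Vars.core]
  have gc5 : -x.core.l₅ = x.c₅ := by simp [Vars.core]
  rw [g5, g12, g16, g15, g17, gb3, gb5, gc1, gc2, gc4, gc5, gc7, g14, ← h.a₁₃_eq, gc3, gc6]
  have h20 := h.a₂₀_eq
  have h21 := h.a₂₁_eq
  have h22 := h.a₂₂_eq
  have h23 := h.a₂₃_eq
  have h24 := h.a₂₄_eq
  have h25 := h.a₂₅_eq
  have h26 := h.a₂₆_eq
  have h27 := h.a₂₇_eq
  have h18 := h.a₁₈_eq
  have h19 := h.a₁₉_eq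
  clear h3' h3 h7 g5 g6 g12 g16 gc6 gc7 g14 g15 g17 gb3 gb5 gc1 gc2 gc3 gc4 gc5 h1 h2 h4 h8 h9
    h10 h5 h
  cases x
  simp only [Vars.core, Vars.fillInfinity, Vars.mk.injEq, true_and] at *
  simp only [h6, h18, h19, h20, h21, h22, h23, h24, h25, h26, h27, and_self]

theorem Core.Relations.toVars {y : Core} (hκ : κ.IsAdmissible) (h : y.Relations κ)
    (hm : y.m₁ ≠ 0) : (y.toVars κ).Relations κ := by
  have h3 : y.a₃b₁ κ / y.m₁ * y.m₁ = y.a₃b₁ κ := div_mul_cancel₀ _ hm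
  obtain ⟨e1, e2, e3, e4, e5, e6⟩ := h
  have f := hκ.fuchs
  constructor
  all_goals simp only [Core.toVars, Vars.fillInfinity]
  all_goals try simp only [Core.a₁, Core.a₂, Core.a₄, Core.a₉]
  all_goals try ring1
  case tl12 => rw [h3]; simp only [Core.a₃b₁, Core.a₁, Core.a₂]; ring
  case tl33 => linear_combination e2
  case bl13 => linear_combination e1
  case br21 =>
    refine mul_left_cancel₀ hm ?_
    simp only [Core.a₁, Core.a₄] at e3
    linear_combination e3 + y.m₂ * h3
  case br31 =>
    refine mul_left_cancel₀ hm ?_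
    simp only [Core.a₂, Core.a₄, Core.a₉] at e4
    linear_combination e4 + y.m₄ * h3
  -- Given the other diagonal entries this one is the trace of the matrix identity, so it follows
  -- from the Fuchs relation.
  case br33 => linear_combination e2 + f
  case bl23 => linear_combination -e5 + y.b₆ * e2
  case bl33 =>
    simp only [Core.a₂, Core.a₉] at e6
    linear_combination -e6 + 2 * y.b₇ * e2 + y.b₇ * f

end Painleve42

/-! ### Canonical coordinates: solving for the normal form -/

namespace Painleve42

/-- The part of the last equation between the intermediate coordinates that is free of `b₇`. -/
def Core.b₇Const (κ : Exponents) (y : Core) : ℂ :=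
  (y.m₅ + 1) * (κ.θ₁ - y.a₂ κ + y.l₃ * y.m₃ + y.l₅ * (y.m₅ + 1))
    + y.m₄ * (y.l₂ * y.m₃ + y.l₄ * (y.m₅ + 1)) - y.a₉ κ

/-- The canonical coordinates in the normalization that does not involve `t`. -/
structure Darboux where
  (q₁ p₁ l₂ m₂ l₄ m₄ : ℂ)

namespace Darboux

variable (κ : Exponents) (d : Darboux)

/-- The product `λ₃ μ₃`. -/
def g : ℂ := -(κ.θ₁ + κ.ρ₂) - d.q₁ * d.p₁

/-- The part of a₂ free of s and l: after substitution of `coreOf`, a₂ = K - s(1 + p₁/l). -/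
def K : ℂ := κ.θ₁ + κ.θ₂ + κ.θ₃ + κ.ρ₁ + κ.ρ₃ + (κ.θ₂ + κ.ρ₂) - d.l₂ * d.m₂ - d.g κ

/-- α, β, γ, δ are the coefficients of s and l in the equations `e₃` and `e₄`, multiplied by l = λ₃:
l·e₃ = αs + βl and l·e₄ = (ρ₂ - ρ₃)sl + γs + δl. -/
def α : ℂ := d.g κ * (d.q₁ * d.p₁ + κ.ρ₂ - d.l₂ * d.m₂) + d.m₄ * d.p₁

def β : ℂ :=
  d.m₂ * (d.l₂ * d.g κ * d.q₁ + d.l₄ * (κ.θ₁ + κ.θ₂ + κ.θ₃ + κ.ρ₁ + κ.ρ₃ - d.g κ) - d.p₁)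
    - (κ.θ₂ + κ.ρ₂) * (d.g κ * d.q₁ + d.m₄)

def γ : ℂ := d.p₁ * (d.K κ + κ.ρ₂) - d.m₄ * d.l₂ * d.g κ - d.m₄ * d.l₄ * d.p₁

def δ : ℂ :=
  d.m₄ * (d.l₂ * d.g κ * d.q₁
    + d.l₄ * (κ.θ₁ + κ.θ₂ + κ.θ₃ + κ.ρ₁ + κ.ρ₃ + (κ.θ₂ + κ.ρ₂) - d.g κ) - d.p₁)
    - d.K κ * (κ.θ₂ + κ.ρ₂)

/-- The determinant of the linear parts of those two equations. Elimination gives s = N/(α(ρ₃ - ρ₂))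
and l = -N/(β(ρ₃ - ρ₂)). -/
def N : ℂ := d.α κ * d.δ κ - d.β κ * d.γ κ

/-- The intermediate coordinates with given canonical coordinates, as functions of `μ₁ = s` and
`λ₃ = l`. -/
noncomputable def coreOf (s l b₆ b₇ : ℂ) : Core where
  l₁ := (κ.θ₂ + κ.ρ₂) / s - d.p₁ / l
  l₂ := d.l₂
  l₃ := l
  l₄ := d.l₄
  l₅ := d.q₁ * l - s
  m₁ := s
  m₂ := d.m₂
  m₃ := d.g κ / l
  m₄ := d.m₄
  m₅ := d.p₁ / l
  b₆ := b₆
  b₇ := b₇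

variable {κ d} {s l : ℂ} (b₆ b₇ : ℂ)

theorem coreOf_e₁ (hs : s ≠ 0) (hl : l ≠ 0) :
    (d.coreOf κ s l b₆ b₇).l₁ * (d.coreOf κ s l b₆ b₇).m₁
      + (d.coreOf κ s l b₆ b₇).m₁ * (d.coreOf κ s l b₆ b₇).m₅ - κ.θ₂ - κ.ρ₂ = 0 := by
  simp only [coreOf]
  field_simp
  ring

theorem coreOf_e₂ (hs : s ≠ 0) (hl : l ≠ 0) :
    (d.coreOf κ s l b₆ b₇).l₁ * (d.coreOf κ s l b₆ b₇).m₁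
      - (d.coreOf κ s l b₆ b₇).l₃ * (d.coreOf κ s l b₆ b₇).m₃
      - (d.coreOf κ s l b₆ b₇).l₅ * (d.coreOf κ s l b₆ b₇).m₅ - κ.θ₁ - κ.θ₂ - 2 * κ.ρ₂ = 0 := by
  simp only [coreOf, g]
  field_simp
  ring

theorem coreOf_e₃ (hs : s ≠ 0) (hl : l ≠ 0) (y : Core) (hy : y = d.coreOf κ s l b₆ b₇) :
    l * (y.m₂ * y.a₃b₁ κ + y.m₁ * (y.a₁ * (1 - y.l₁) + y.m₃ * y.a₄ κ - y.m₄))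
      = d.α κ * s + d.β κ * l := by
  subst hy
  simp only [coreOf, Core.a₃b₁, Core.a₁, Core.a₂, Core.a₄, α, β]
  generalize d.g κ = g
  field_simp
  ring

/-- The Fuchs relation serves to remove ρ₁. The quadratic coefficient ρ₂ - ρ₃ is nonzero, which
makes the system for s and l solvable. -/
theorem coreOf_e₄ (hκ : κ.IsAdmissible) (hs : s ≠ 0) (hl : l ≠ 0) (y : Core)
    (hy : y = d.coreOf κ s l b₆ b₇) :
    l * (y.m₄ * y.a₃b₁ κ + y.m₁ * (y.a₂ κ * (1 - y.l₁) + (y.m₅ + 1) * y.a₄ κ + y.a₉ κ))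
      = (κ.ρ₂ - κ.ρ₃) * s * l + d.γ κ * s + d.δ κ * l := by
  have f := hκ.fuchs
  have hρ : κ.ρ₁ = -(3 * κ.θ₁ + 3 * κ.θ₂ + 2 * κ.θ₃ + 2 * κ.ρ₂ + 2 * κ.ρ₃) / 2 := by
    linear_combination f / 2
  subst hy
  simp only [coreOf, Core.a₃b₁, Core.a₁, Core.a₂, Core.a₄, Core.a₉, γ, δ, K, g, hρ]
  field_simp
  ring

/-- The same α as in `coreOf_e₃` appears, so for l ≠ 0 the regularity condition b₆ ≠ 0 amounts to α
≠ 0. -/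
theorem coreOf_e₅ (hl : l ≠ 0) (y : Core) (hy : y = d.coreOf κ s l b₆ b₇) :
    l * ((κ.ρ₃ - κ.ρ₂) * y.b₆ + y.m₃ * (κ.θ₁ + y.m₂ * y.l₂ + y.l₃ * y.m₃) - y.m₄ * y.m₅)
      = (κ.ρ₃ - κ.ρ₂) * b₆ * l - d.α κ := by
  subst hy
  simp only [coreOf, α, g]
  field_simp
  ring

/-- `e₁` and `e₂` are built into `coreOf`; the other four equations are triangular, with s and l in
the first two and b₆, b₇ in the last two. The zeros in `coreOf κ s l 0 0` stand for b₆, b₇, on which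
`b₇Const` does not depend. -/
theorem coreOf_relations_iff (hκ : κ.IsAdmissible) (hs : s ≠ 0) (hl : l ≠ 0) :
    (d.coreOf κ s l b₆ b₇).Relations κ ↔
      d.α κ * s + d.β κ * l = 0 ∧ (κ.ρ₂ - κ.ρ₃) * s * l + d.γ κ * s + d.δ κ * l = 0 ∧
      (κ.ρ₃ - κ.ρ₂) * b₆ * l = d.α κ ∧
      (κ.ρ₃ - κ.ρ₂) * b₇ = -(d.coreOf κ s l 0 0).b₇Const κ := by
  have h3 := coreOf_e₃ (κ := κ) (d := d) b₆ b₇ hs hl _ rfl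
  have h4 := coreOf_e₄ (κ := κ) (d := d) b₆ b₇ hκ hs hl _ rfl
  have h5 := coreOf_e₅ (κ := κ) (d := d) (s := s) b₆ b₇ hl _ rfl
  constructor
  · rintro ⟨-, -, e3, e4, e5, e6⟩
    refine ⟨?_, ?_, ?_, ?_⟩
    · rw [← h3, e3, mul_zero]
    · rw [← h4, e4, mul_zero]
    · rw [e5] at h5
      linear_combination -h5
    · simp only [coreOf, Core.b₇Const, Core.a₂, Core.a₉] at e6 ⊢
      linear_combination e6
  · rintro ⟨e3, e4, e5, e6⟩
    refine ⟨coreOf_e₁ _ _ hs hl, coreOf_e₂ _ _ hs hl, ?_, ?_, ?_, ?_⟩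
    · refine mul_left_cancel₀ hl ?_
      rw [h3, e3, mul_zero]
    · refine mul_left_cancel₀ hl ?_
      rw [h4, e4, mul_zero]
    · refine mul_left_cancel₀ hl ?_
      rw [h5, e5, mul_zero, sub_self]
    · simp only [coreOf, Core.b₇Const, Core.a₂, Core.a₉] at e6 ⊢
      linear_combination e6

variable (κ d) in
/-- The intermediate coordinates of the regular normal form with given canonical coordinates. -/
noncomputable def core : Core :=
  let s := d.N κ / (d.α κ * (κ.ρ₃ - κ.ρ₂))
  let l := -(d.N κ / (d.β κ * (κ.ρ₃ - κ.ρ₂)))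
  d.coreOf κ s l (d.α κ / (l * (κ.ρ₃ - κ.ρ₂)))
    (-(d.coreOf κ s l 0 0).b₇Const κ / (κ.ρ₃ - κ.ρ₂))

theorem core_relations (hκ : κ.IsAdmissible) (hα : d.α κ ≠ 0) (hβ : d.β κ ≠ 0) (hN : d.N κ ≠ 0) :
    (d.core κ).Relations κ := by
  have hρ : κ.ρ₃ - κ.ρ₂ ≠ 0 := sub_ne_zero.2 hκ.ρ₂₃_ne.symm
  have hs : d.N κ / (d.α κ * (κ.ρ₃ - κ.ρ₂)) ≠ 0 := div_ne_zero hN (mul_ne_zero hα hρ)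
  have hl : -(d.N κ / (d.β κ * (κ.ρ₃ - κ.ρ₂))) ≠ 0 :=
    neg_ne_zero.2 (div_ne_zero hN (mul_ne_zero hβ hρ))
  rw [core, coreOf_relations_iff _ _ hκ hs hl]
  refine ⟨?_, ?_, ?_, ?_⟩
  · field_simp
    ring
  · rw [N]
    field_simp
    ring
  · field_simp
  · field_simp

/-- b₆ ≠ 0 forces α ≠ 0, then αs + βl = 0 forces β ≠ 0, and eliminating between the two equations
gives N = sα(ρ₃ - ρ₂), which is nonzero and determines s. All the other coordinates follow. -/
theorem eq_core (hκ : κ.IsAdmissible) (hs : s ≠ 0) (hl : l ≠ 0) (hb : b₆ ≠ 0)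
    (h : (d.coreOf κ s l b₆ b₇).Relations κ) :
    d.α κ ≠ 0 ∧ d.β κ ≠ 0 ∧ d.N κ ≠ 0 ∧ d.coreOf κ s l b₆ b₇ = d.core κ := by
  have hρ : κ.ρ₃ - κ.ρ₂ ≠ 0 := sub_ne_zero.2 hκ.ρ₂₃_ne.symm
  obtain ⟨e3, e4, e5, e6⟩ := (coreOf_relations_iff _ _ hκ hs hl).1 h
  have hα : d.α κ ≠ 0 := by
    rw [← e5]
    exact mul_ne_zero (mul_ne_zero hρ hb) hl
  have hβ : d.β κ ≠ 0 := by
    intro h0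
    rw [h0, zero_mul, add_zero] at e3
    exact mul_ne_zero hα hs e3
  have hN' : d.N κ = s * (d.α κ * (κ.ρ₃ - κ.ρ₂)) := by
    refine mul_left_cancel₀ hl ?_
    rw [N]
    -- The combination that removes γs is divisible by l.
    linear_combination d.α κ * e4 - d.γ κ * e3
  have hN : d.N κ ≠ 0 := by
    rw [hN']
    exact mul_ne_zero hs (mul_ne_zero hα hρ)
  have hs' : d.N κ / (d.α κ * (κ.ρ₃ - κ.ρ₂)) = s := by
    rw [hN']
    exact mul_div_cancel_right₀ _ (mul_ne_zero hα hρ)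
  have hl' : -(d.N κ / (d.β κ * (κ.ρ₃ - κ.ρ₂))) = l := by
    rw [hN']
    field_simp
    linear_combination -e3
  have hb' : d.α κ / (l * (κ.ρ₃ - κ.ρ₂)) = b₆ := by
    rw [← e5]
    field_simp
  refine ⟨hα, hβ, hN, ?_⟩
  rw [core, hs', hl', hb', ← e6, mul_div_cancel_left₀ _ hρ]

theorem core_m₁_ne (hκ : κ.IsAdmissible) (hα : d.α κ ≠ 0) (hN : d.N κ ≠ 0) :
    (d.core κ).m₁ ≠ 0 :=
  div_ne_zero hN (mul_ne_zero hα (sub_ne_zero.2 hκ.ρ₂₃_ne.symm))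

theorem core_l₃_ne (hκ : κ.IsAdmissible) (hβ : d.β κ ≠ 0) (hN : d.N κ ≠ 0) :
    (d.core κ).l₃ ≠ 0 :=
  neg_ne_zero.2 (div_ne_zero hN (mul_ne_zero hβ (sub_ne_zero.2 hκ.ρ₂₃_ne.symm)))

theorem core_b₆_ne (hκ : κ.IsAdmissible) (hα : d.α κ ≠ 0) (hβ : d.β κ ≠ 0) (hN : d.N κ ≠ 0) :
    (d.core κ).b₆ ≠ 0 :=
  div_ne_zero hα (mul_ne_zero (core_l₃_ne hκ hβ hN) (sub_ne_zero.2 hκ.ρ₂₃_ne.symm))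

end Darboux

/-- The canonical coordinates of intermediate coordinates. -/
noncomputable def Core.darboux (κ : Exponents) (y : Core) : Darboux where
  q₁ := (y.m₁ + y.l₅) / y.l₃
  p₁ := -(y.l₃ * (y.l₁ - (κ.θ₂ + κ.ρ₂) / y.m₁))
  l₂ := y.l₂
  m₂ := y.m₂
  l₄ := y.l₄
  m₄ := y.m₄

theorem Darboux.darboux_coreOf {κ : Exponents} {d : Darboux} {s l : ℂ} (b₆ b₇ : ℂ)
    (hl : l ≠ 0) : (d.coreOf κ s l b₆ b₇).darboux κ = d := by
  simp only [Core.darboux, Darboux.coreOf]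
  congr 1
  · field_simp
    ring
  · field_simp
    ring

/-- The constraint `e₁` says p₁ = λ₃μ₅, and q₁λ₃ = μ₁ + λ₅ by definition. With these, `e₁` gives λ₁
and the difference of `e₁` and `e₂` gives λ₃μ₃ = g. -/
theorem Core.Relations.eq_coreOf {κ : Exponents} {y : Core} (h : y.Relations κ) (hs : y.m₁ ≠ 0)
    (hl : y.l₃ ≠ 0) : y = (y.darboux κ).coreOf κ y.m₁ y.l₃ y.b₆ y.b₇ := by
  have e1 := h.e₁
  have e2 := h.e₂
  have hp : (y.darboux κ).p₁ = y.l₃ * y.m₅ := by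
    simp only [Core.darboux]
    field_simp
    linear_combination -e1
  have hq : (y.darboux κ).q₁ * y.l₃ = y.m₁ + y.l₅ := div_mul_cancel₀ _ hl
  rw [Darboux.coreOf, Darboux.g, hp, hq, mul_div_cancel_left₀ _ hl]
  have h1 : (κ.θ₂ + κ.ρ₂) / y.m₁ - y.m₅ = y.l₁ := by
    field_simp
    linear_combination -e1
  have h3 : (-(κ.θ₁ + κ.ρ₂) - (y.darboux κ).q₁ * (y.l₃ * y.m₅)) / y.l₃ = y.m₃ := by
    rw [← mul_assoc, hq, div_eq_iff hl]
    linear_combination e2 - e1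
  rw [h1, h3, add_sub_cancel_left]
  rfl

/-- The canonical coordinates of a normal form, in the normalization that does not involve `t`. -/
noncomputable def Vars.darboux (κ : Exponents) (x : Vars) : Darboux := x.core.darboux κ

/-- The normal form with given canonical coordinates. -/
noncomputable def Darboux.toVars (κ : Exponents) (d : Darboux) : Vars := (d.core κ).toVars κ

theorem Core.core_toVars (κ : Exponents) (y : Core) : (y.toVars κ).core = y := by
  have h : y.m₅ + y.b₇ + 1 - y.b₇ - 1 = y.m₅ := by ring
  simp [Core.toVars, Vars.core, Vars.fillInfinity, h]

/-- The condition on the canonical coordinates of a regular normal form. -/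
def Darboux.IsRegular (κ : Exponents) (d : Darboux) : Prop :=
  d.α κ ≠ 0 ∧ d.β κ ≠ 0 ∧ d.N κ ≠ 0

variable {κ : Exponents}

/-- Together with `Darboux.IsRegular.toVars` this makes `darboux` and `toVars` inverse bijections
between regular normal forms and the points with αβN ≠ 0. Time enters the coordinates only through a
rescaling, so this settles statement 3 for all t at once. -/
theorem Vars.toVars_darboux (hκ : κ.IsAdmissible) {x : Vars} (h : x.IsNormalForm κ)
    (hx : x.IsRegular) : (x.darboux κ).IsRegular κ ∧ (x.darboux κ).toVars κ = x := by
  have hr := (isNormalForm_iff κ x).1 h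
  obtain ⟨hb1, hb6, hc3⟩ := hx
  have hc := hr.core_relations
  have hl : x.core.l₃ ≠ 0 := neg_ne_zero.2 hc3
  have he := hc.eq_coreOf hb1 hl
  rw [he] at hc
  obtain ⟨hα, hβ, hN, e⟩ := Darboux.eq_core _ _ hκ hb1 hl hb6 hc
  refine ⟨⟨hα, hβ, hN⟩, ?_⟩
  rw [Darboux.toVars, Vars.darboux, ← e]
  exact (congrArg (Core.toVars κ) he).symm.trans (hr.toVars_core hb1)

theorem Darboux.IsRegular.toVars (hκ : κ.IsAdmissible) {d : Darboux} (h : d.IsRegular κ) :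
    (d.toVars κ).IsNormalForm κ ∧ (d.toVars κ).IsRegular ∧ (d.toVars κ).darboux κ = d := by
  obtain ⟨hα, hβ, hN⟩ := h
  have hm := Darboux.core_m₁_ne hκ hα hN
  have hl := Darboux.core_l₃_ne hκ hβ hN
  refine ⟨(isNormalForm_iff _ _).2 ((Darboux.core_relations hκ hα hβ hN).toVars hκ hm),
    ⟨hm, Darboux.core_b₆_ne hκ hα hβ hN, neg_ne_zero.2 hl⟩, ?_⟩
  rw [Vars.darboux, Darboux.toVars, Core.core_toVars, Darboux.core]
  exact Darboux.darboux_coreOf _ _ hl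

namespace Darboux

noncomputable def ofQP (t : ℂ) (q p : Fin 3 → ℂ) : Darboux where
  q₁ := q 0
  p₁ := p 0
  l₂ := -(q 2 / t)
  m₂ := -(t * p 2)
  l₄ := q 1 / t
  m₄ := t * p 1

noncomputable def q (t : ℂ) (d : Darboux) : Fin 3 → ℂ := ![d.q₁, t * d.l₄, -(t * d.l₂)]

noncomputable def p (t : ℂ) (d : Darboux) : Fin 3 → ℂ := ![d.p₁, d.m₄ / t, -(d.m₂ / t)]

theorem q_ofQP {t : ℂ} (ht : t ≠ 0) (q p : Fin 3 → ℂ) : (ofQP t q p).q t = q := by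
  ext i
  fin_cases i <;> simp [Darboux.q, ofQP] <;> field_simp

theorem p_ofQP {t : ℂ} (ht : t ≠ 0) (q p : Fin 3 → ℂ) : (ofQP t q p).p t = p := by
  ext i
  fin_cases i <;> simp [Darboux.p, ofQP] <;> field_simp

theorem ofQP_q_p {t : ℂ} (ht : t ≠ 0) (d : Darboux) : ofQP t (d.q t) (d.p t) = d := by
  cases d
  simp only [Darboux.q, Darboux.p, ofQP, mk.injEq, Matrix.cons_val, true_and]
  refine ⟨?_, ?_, ?_, ?_⟩ <;> field_simp

end Darboux

theorem Vars.q_eq (κ : Exponents) (x : Vars) (t : ℂ) : x.q t = (x.darboux κ).q t := rfl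

theorem Vars.p_eq (κ : Exponents) (x : Vars) (t : ℂ) : x.p κ t = (x.darboux κ).p t := rfl

/-- The polynomial whose zeros are the values of `(q, p)` where there is no regular normal form. -/
noncomputable def singularLocus (κ : Exponents) (t : ℂ) : PhasePoly :=
  let q₁ : PhasePoly := X (Sum.inl 0)
  let q₂ : PhasePoly := X (Sum.inl 1)
  let q₃ : PhasePoly := X (Sum.inl 2)
  let p₁ : PhasePoly := X (Sum.inr 0)
  let p₂ : PhasePoly := X (Sum.inr 1)
  let p₃ : PhasePoly := X (Sum.inr 2)
  let σ : ℂ := κ.θ₁ + κ.θ₂ + κ.θ₃ + κ.ρ₁ + κ.ρ₃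
  let e : ℂ := κ.θ₂ + κ.ρ₂
  let g : PhasePoly := -C (κ.θ₁ + κ.ρ₂) - q₁ * p₁
  let k : PhasePoly := C (σ + e) - q₃ * p₃ - g
  let α : PhasePoly := g * (q₁ * p₁ + C κ.ρ₂ - q₃ * p₃) + C t * p₂ * p₁
  let β : PhasePoly := q₃ * p₃ * g * q₁ - q₂ * p₃ * (C σ - g) + C t * p₃ * p₁
    - C e * (g * q₁ + C t * p₂)
  let γ : PhasePoly := p₁ * (k + C κ.ρ₂) + q₃ * p₂ * g - q₂ * p₂ * p₁
  let δ : PhasePoly := -(q₃ * p₂ * g * q₁) + q₂ * p₂ * (C (σ + e) - g) - C t * p₂ * p₁ - C e * k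
  α * β * (α * δ - β * γ)

theorem evalAt_singularLocus {t : ℂ} (ht : t ≠ 0) (q p : Fin 3 → ℂ) :
    evalAt q p (singularLocus κ t) = (Darboux.ofQP t q p).α κ * (Darboux.ofQP t q p).β κ *
      (Darboux.ofQP t q p).N κ := by
  have h1 : q 1 / t * t = q 1 := div_mul_cancel₀ _ ht
  have h2 : q 2 / t * t = q 2 := div_mul_cancel₀ _ ht
  simp only [evalAt, singularLocus, Darboux.N, map_mul, map_sub, map_add, map_neg, eval_X, eval_C,
    Sum.elim_inl, Sum.elim_inr]
  have hα : (Darboux.ofQP t q p).α κ = (-(κ.θ₁ + κ.ρ₂) - q 0 * p 0) *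
      (q 0 * p 0 + κ.ρ₂ - q 2 * p 2) + t * p 1 * p 0 := by
    simp only [Darboux.α, Darboux.g, Darboux.ofQP]
    field_simp
  have hβ : (Darboux.ofQP t q p).β κ = q 2 * p 2 * (-(κ.θ₁ + κ.ρ₂) - q 0 * p 0) * q 0
      - q 1 * p 2 * (κ.θ₁ + κ.θ₂ + κ.θ₃ + κ.ρ₁ + κ.ρ₃ - (-(κ.θ₁ + κ.ρ₂) - q 0 * p 0))
      + t * p 2 * p 0 - (κ.θ₂ + κ.ρ₂) * ((-(κ.θ₁ + κ.ρ₂) - q 0 * p 0) * q 0 + t * p 1) := by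
    simp only [Darboux.β, Darboux.g, Darboux.ofQP]
    field_simp
    ring
  have hγ : (Darboux.ofQP t q p).γ κ = p 0 * (κ.θ₁ + κ.θ₂ + κ.θ₃ + κ.ρ₁ + κ.ρ₃ + (κ.θ₂ + κ.ρ₂)
      - q 2 * p 2 - (-(κ.θ₁ + κ.ρ₂) - q 0 * p 0) + κ.ρ₂)
      + q 2 * p 1 * (-(κ.θ₁ + κ.ρ₂) - q 0 * p 0) - q 1 * p 1 * p 0 := by
    simp only [Darboux.γ, Darboux.K, Darboux.g, Darboux.ofQP]
    field_simp
    ring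
  have hδ : (Darboux.ofQP t q p).δ κ = -(q 2 * p 1 * (-(κ.θ₁ + κ.ρ₂) - q 0 * p 0) * q 0)
      + q 1 * p 1 * (κ.θ₁ + κ.θ₂ + κ.θ₃ + κ.ρ₁ + κ.ρ₃ + (κ.θ₂ + κ.ρ₂)
        - (-(κ.θ₁ + κ.ρ₂) - q 0 * p 0)) - t * p 1 * p 0
      - (κ.θ₂ + κ.ρ₂) * (κ.θ₁ + κ.θ₂ + κ.θ₃ + κ.ρ₁ + κ.ρ₃ + (κ.θ₂ + κ.ρ₂)
      - q 2 * p 2 - (-(κ.θ₁ + κ.ρ₂) - q 0 * p 0)) := by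
    simp only [Darboux.δ, Darboux.K, Darboux.g, Darboux.ofQP]
    field_simp
  rw [hα, hβ, hγ, hδ]

theorem evalAt_singularLocus_ne_zero {t : ℂ} (ht : t ≠ 0) (q p : Fin 3 → ℂ) :
    evalAt q p (singularLocus κ t) ≠ 0 ↔ (Darboux.ofQP t q p).IsRegular κ := by
  rw [evalAt_singularLocus ht, Darboux.IsRegular, mul_ne_zero_iff, mul_ne_zero_iff, and_assoc]

/-- The set of regular values is not empty. -/
theorem exists_isRegular (κ : Exponents) : ∃ d : Darboux, d.IsRegular κ := by
  -- Along this line α, -β and -N are monic polynomials in s of degrees 2, 2 and 4, whatever the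
  -- exponents, so some s avoids all their zeros.
  let d : ℂ → Darboux := fun s => ⟨0, s, 0, s, 0, s⟩
  let k := κ.θ₁ + κ.θ₂ + κ.θ₃ + κ.ρ₁ + κ.ρ₃ + (κ.θ₂ + κ.ρ₂) + (κ.θ₁ + κ.ρ₂)
  let e := κ.θ₂ + κ.ρ₂
  let a := -(κ.θ₁ + κ.ρ₂) * κ.ρ₂
  let P : Polynomial ℂ := Polynomial.X ^ 2 + Polynomial.C a
  let Q : Polynomial ℂ := Polynomial.X ^ 2 + Polynomial.C e * Polynomial.X
  let R : Polynomial ℂ := Polynomial.X ^ 4 + Polynomial.C (-(k + κ.ρ₂)) * Polynomial.X ^ 3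
    + Polynomial.C (a + k * e - e * (k + κ.ρ₂)) * Polynomial.X ^ 2 + Polynomial.C (a * (k * e))
  have hP : P.Monic := by simp only [P]; monicity!
  have hQ : Q.Monic := by simp only [Q]; monicity!
  have hR : R.Monic := by simp only [R]; monicity!
  have hPQR : P * Q * R ≠ 0 := ((hP.mul hQ).mul hR).ne_zero
  obtain ⟨s, hs⟩ : ∃ s, (P * Q * R).eval s ≠ 0 := by
    by_contra! h
    exact hPQR (Polynomial.funext (by simpa using h))
  rw [Polynomial.eval_mul, Polynomial.eval_mul, mul_ne_zero_iff, mul_ne_zero_iff] at hs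
  obtain ⟨⟨hs1, hs2⟩, hs3⟩ := hs
  refine ⟨d s, ?_, ?_, ?_⟩
  · convert hs1 using 1
    simp [P, a, d, Darboux.α, Darboux.g]
    ring
  · refine neg_ne_zero.1 ?_
    convert hs2 using 1
    simp [Q, e, d, Darboux.β, Darboux.g]
    ring
  · refine neg_ne_zero.1 ?_
    convert hs3 using 1
    simp [R, a, e, k, d, Darboux.N, Darboux.α, Darboux.β, Darboux.γ, Darboux.δ, Darboux.K,
      Darboux.g]
    ring

theorem singularLocus_ne_zero {t : ℂ} (ht : t ≠ 0) : singularLocus κ t ≠ 0 := by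
  obtain ⟨d, hd⟩ := exists_isRegular κ
  intro h
  rw [← Darboux.ofQP_q_p ht d, ← evalAt_singularLocus_ne_zero ht, h] at hd
  exact hd (map_zero _)

theorem coordinates_injective (hκ : κ.IsAdmissible) {t : ℂ} (ht : t ≠ 0) {x y : Vars}
    (hx : x.IsNormalForm κ) (hx' : x.IsRegular) (hy : y.IsNormalForm κ) (hy' : y.IsRegular)
    (hq : x.q t = y.q t) (hp : x.p κ t = y.p κ t) : x = y := by
  rw [← (Vars.toVars_darboux hκ hx hx').2, ← (Vars.toVars_darboux hκ hy hy').2,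
    ← Darboux.ofQP_q_p ht (x.darboux κ), ← Darboux.ofQP_q_p ht (y.darboux κ), ← Vars.q_eq,
    ← Vars.q_eq, ← Vars.p_eq, ← Vars.p_eq, hq, hp]

theorem coordinates_range (hκ : κ.IsAdmissible) {t : ℂ} (ht : t ≠ 0) (q p : Fin 3 → ℂ) :
    (∃ x : Vars, x.IsNormalForm κ ∧ x.IsRegular ∧ x.q t = q ∧ x.p κ t = p) ↔
      evalAt q p (singularLocus κ t) ≠ 0 := by
  rw [evalAt_singularLocus_ne_zero ht]
  constructor
  · rintro ⟨x, h, hx, rfl, rfl⟩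
    rw [Vars.q_eq κ, Vars.p_eq, Darboux.ofQP_q_p ht]
    exact (Vars.toVars_darboux hκ h hx).1
  · intro h
    obtain ⟨h1, h2, h3⟩ := h.toVars hκ
    refine ⟨_, h1, h2, ?_, ?_⟩
    · rw [Vars.q_eq κ, h3, Darboux.q_ofQP ht]
    · rw [Vars.p_eq, h3, Darboux.p_ofQP ht]

end Painleve42

/-! ### The Hamiltonian in canonical coordinates -/

namespace Painleve42

open Matrix

theorem trace_fromBlocks (A B C D : Matrix (Fin 3) (Fin 3) ℂ) :
    (fromBlocks A B C D).trace = A.trace + D.trace := by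
  simp [Matrix.trace]

theorem trace_blockEquiv (M : Matrix (Fin 3 ⊕ Fin 3) (Fin 3 ⊕ Fin 3) ℂ) :
    (blockEquiv M).trace = M.trace := by
  simp only [blockEquiv, Matrix.coe_reindexAlgEquiv, Matrix.trace, Matrix.diag,
    Matrix.reindex_apply, Matrix.submatrix_apply]
  exact Equiv.sum_comp _ fun i => M i i

/-- With A = FR and A' = F'R', cyclicity gives tr AA' = tr (RF')(R'F), and RF' = θ + C(B' - B).
Hence only B' - B enters, and b₆, b₇ disappear into μ₃, μ₅. -/
theorem trace_blockProduct_mul_blockProduct (θ θ' : ℂ) (B C B' C' : Matrix (Fin 3) (Fin 3) ℂ) :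
    (blockProduct θ B C * blockProduct θ' B' C').trace =
      ((θ • 1 + C * (B' - B)) * (θ' • 1 - C' * (B' - B))).trace := by
  rw [blockProduct_eq, blockProduct_eq, ← map_mul, trace_blockEquiv]
  have h (θ : ℂ) (B C : Matrix (Fin 3) (Fin 3) ℂ) :
      fromBlocks (θ • 1 - C * B) C (B * (θ • 1 - C * B)) (B * C) =
      fromRows 1 B * fromCols (θ • 1 - C * B) C := by
    rw [fromRows_mul_fromCols, Matrix.one_mul, Matrix.one_mul]
  rw [h, h, Matrix.mul_assoc, Matrix.trace_mul_comm, Matrix.mul_assoc, Matrix.mul_assoc,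
    fromCols_mul_fromRows, ← Matrix.mul_assoc, fromCols_mul_fromRows]
  congr 2 <;> simp only [Matrix.mul_one, Matrix.mul_sub] <;> abel

theorem trace_blockProduct_mul_blockEquiv (θ : ℂ) (B C E F : Matrix (Fin 3) (Fin 3) ℂ) :
    (blockProduct θ B C * blockEquiv (fromBlocks E F 0 0)).trace =
      ((θ • 1 - C * B) * (E + F * B)).trace := by
  rw [blockProduct_eq, ← map_mul, trace_blockEquiv, fromBlocks_multiply, trace_fromBlocks]
  simp only [Matrix.mul_zero, add_zero]
  rw [Matrix.mul_add, Matrix.trace_add, Matrix.mul_assoc B, Matrix.trace_mul_comm B,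
    Matrix.mul_assoc]

variable {κ : Exponents} {d : Darboux} {s l : ℂ} (b₆ b₇ : ℂ)

/-- The equations that fix s, l, b₆, b₇ are not used: the identity holds for all nonzero s, l and
all b₆, b₇, which cancel. Only the two constraints built into `coreOf` and the Fuchs relation make
the trace polynomial in the six coordinates. -/
theorem trace_residues_zero_mul_one (hκ : κ.IsAdmissible) (hs : s ≠ 0) (hl : l ≠ 0) (x : Vars)
    (hx : x = (d.coreOf κ s l b₆ b₇).toVars κ) :
    (x.residues κ 0 * x.residues κ 1).trace =
      d.q₁ ^ 3 * d.p₁ ^ 2 * d.l₂ + d.q₁ ^ 3 * d.p₁ ^ 2 - d.q₁ ^ 2 * d.p₁ ^ 2 * d.l₄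
        - 2 * d.q₁ ^ 2 * d.p₁ ^ 2 + (κ.θ₁ - κ.θ₂ + κ.ρ₂) * d.q₁ ^ 2 * d.p₁ * d.l₂
        + (κ.θ₁ - κ.θ₂ + κ.ρ₂) * d.q₁ ^ 2 * d.p₁ + 2 * d.q₁ * d.p₁ ^ 2
        + 4 * d.q₁ * d.p₁ * d.l₂ * d.m₂ + 2 * d.q₁ * d.p₁ * d.l₂ * d.m₄
        - 2 * d.q₁ * d.p₁ * d.m₂ * d.l₄
        + (-1 / 2 * κ.θ₁ + 1 / 2 * κ.θ₂ - κ.ρ₂) * d.q₁ * d.p₁ * d.l₄ - 2 * d.q₁ * d.p₁ * d.m₄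
        + (-2 * κ.θ₁ - 2 * κ.ρ₂ - 2 * κ.ρ₃) * d.q₁ * d.p₁
        + (-κ.θ₁ * κ.θ₂ - κ.θ₂ * κ.ρ₂) * d.q₁ * d.l₂ + (-κ.θ₁ * κ.θ₂ - κ.θ₂ * κ.ρ₂) * d.q₁
        - 2 * d.p₁ * d.l₂ * d.m₂ + 2 * d.p₁ * d.m₂ - 2 * d.p₁ * d.l₄ * d.m₄ + 4 * d.p₁ * d.m₄
        + (κ.θ₁ + κ.θ₂ + 2 * κ.ρ₂ + 2 * κ.ρ₃) * d.p₁ + d.l₂ ^ 2 * d.m₂ ^ 2 * d.l₄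
        - 4 * d.l₂ ^ 2 * d.m₂ ^ 2 - 4 * d.l₂ ^ 2 * d.m₂ * d.m₄ + d.l₂ * d.m₂ ^ 2 * d.l₄
        + 2 * d.l₂ * d.m₂ * d.l₄ ^ 2 * d.m₄ - 4 * d.l₂ * d.m₂ * d.l₄ * d.m₄
        + (-1 / 2 * κ.θ₁ - 3 / 2 * κ.θ₂ - κ.ρ₂ - 2 * κ.ρ₃) * d.l₂ * d.m₂ * d.l₄
        + 4 * d.l₂ * d.m₂ * d.m₄ + (2 * κ.θ₁ + 2 * κ.θ₂ + 4 * κ.ρ₂ + 4 * κ.ρ₃) * d.l₂ * d.m₂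
        - 3 * d.l₂ * d.l₄ * d.m₄ ^ 2 + 4 * d.l₂ * d.m₄ ^ 2
        + (2 * κ.θ₁ + 2 * κ.θ₂ + 2 * κ.ρ₂ + 4 * κ.ρ₃) * d.l₂ * d.m₄
        + (-1 / 2 * κ.θ₁ + 1 / 2 * κ.θ₂ - κ.ρ₂) * d.m₂ * d.l₄ + d.l₄ ^ 3 * d.m₄ ^ 2
        - 2 * d.l₄ ^ 2 * d.m₄ ^ 2
        + (-1 / 2 * κ.θ₁ - 3 / 2 * κ.θ₂ - κ.ρ₂ - 2 * κ.ρ₃) * d.l₄ ^ 2 * d.m₄ + d.l₄ * d.m₄ ^ 2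
        + (2 * κ.θ₂ + 2 * κ.ρ₂ + 2 * κ.ρ₃) * d.l₄ * d.m₄
        + (1 / 2 * κ.θ₁ * κ.θ₂ + 1 / 2 * κ.θ₁ * κ.ρ₃ + 1 / 2 * κ.θ₂ ^ 2 + κ.θ₂ * κ.ρ₂
          + 3 / 2 * κ.θ₂ * κ.ρ₃ + κ.ρ₂ * κ.ρ₃ + κ.ρ₃ ^ 2) * d.l₄
        - 2 * κ.ρ₂ * d.m₄
        + (-1 / 4 * κ.θ₁ ^ 2 + 5 / 2 * κ.θ₁ * κ.θ₂ - 1 / 4 * κ.θ₂ ^ 2 - 2 * κ.ρ₂ * κ.ρ₃) := by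
  have f := hκ.fuchs
  have hρ : κ.ρ₁ = -(3 * κ.θ₁ + 3 * κ.θ₂ + 2 * κ.θ₃ + 2 * κ.ρ₂ + 2 * κ.ρ₃) / 2 := by
    linear_combination f / 2
  have h0 : x.residues κ 0 = blockProduct κ.θ₁ x.B₁ x.C₁ := rfl
  have h1 : x.residues κ 1 = blockProduct κ.θ₂ x.B₂ x.C₂ := rfl
  rw [h0, h1, trace_blockProduct_mul_blockProduct]
  subst hx
  simp [Vars.B₁, Vars.B₂, Vars.C₁, Vars.C₂, Darboux.coreOf, Core.toVars, Vars.fillInfinity,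
    Matrix.trace_fin_three, Matrix.one_fin_three, Core.a₃b₁, Core.a₁, Core.a₂, Core.a₄, Core.a₉,
    Darboux.g, hρ]
  field_simp
  ring

theorem trace_residues_zero_mul_two (hκ : κ.IsAdmissible) (hs : s ≠ 0) (hl : l ≠ 0) (x : Vars)
    (hx : x = (d.coreOf κ s l b₆ b₇).toVars κ) :
    (x.residues κ 0 * x.residues κ 2).trace =
      -d.q₁ ^ 3 * d.p₁ ^ 2 + d.q₁ ^ 2 * d.p₁ ^ 2 + (-κ.θ₁ + κ.θ₂ - κ.ρ₂) * d.q₁ ^ 2 * d.p₁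
        - 2 * d.q₁ * d.p₁ * d.l₂ * d.m₂ + 2 * d.q₁ * d.p₁ * d.m₂ * d.l₄ + 2 * d.q₁ * d.p₁ * d.m₄
        + (-κ.θ₂ - κ.θ₃) * d.q₁ * d.p₁ + (κ.θ₁ * κ.θ₂ + κ.θ₂ * κ.ρ₂) * d.q₁ - 2 * d.p₁ * d.m₂
        - 2 * d.p₁ * d.m₄ + 2 * d.l₂ ^ 2 * d.m₂ ^ 2 - d.l₂ * d.m₂ ^ 2 * d.l₄
        + 2 * d.l₂ * d.m₂ * d.l₄ * d.m₄ - 4 * d.l₂ * d.m₂ * d.m₄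
        + (κ.θ₁ + κ.θ₂ + 2 * κ.θ₃) * d.l₂ * d.m₂ - 2 * d.l₂ * d.m₄ ^ 2
        + (1 / 2 * κ.θ₁ - 1 / 2 * κ.θ₂ + κ.ρ₂) * d.m₂ * d.l₄ + d.l₄ ^ 2 * d.m₄ ^ 2
        - d.l₄ * d.m₄ ^ 2 + (κ.θ₁ + κ.θ₃) * d.l₄ * d.m₄ + 2 * κ.ρ₂ * d.m₄
        + (-1 / 4 * κ.θ₁ ^ 2 + 3 / 2 * κ.θ₁ * κ.θ₃ + 1 / 4 * κ.θ₂ ^ 2 + 1 / 2 * κ.θ₂ * κ.θ₃) := by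
  have f := hκ.fuchs
  have hρ : κ.ρ₁ = -(3 * κ.θ₁ + 3 * κ.θ₂ + 2 * κ.θ₃ + 2 * κ.ρ₂ + 2 * κ.ρ₃) / 2 := by
    linear_combination f / 2
  have h0 : x.residues κ 0 = blockProduct κ.θ₁ x.B₁ x.C₁ := rfl
  rw [h0, residues_two_eq, trace_blockProduct_mul_blockEquiv]
  subst hx
  simp [Vars.B₁, Vars.C₁, Darboux.coreOf, Core.toVars, Vars.fillInfinity,
    Matrix.trace_fin_three, Matrix.one_fin_three, Core.a₃b₁, Core.a₁, Core.a₂, Core.a₄, Core.a₉,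
    Darboux.g, hρ]
  field_simp
  ring

/-- A comparison of polynomials, given the two traces. The last summand collects their constant
terms, weighted by t and t - 1. -/
theorem schlesingerHamiltonian_eq (hκ : κ.IsAdmissible) {t : ℂ} (ht : t ≠ 0) (ht' : t ≠ 1)
    {x : Vars} (h : x.IsNormalForm κ) (hx : x.IsRegular) :
    t * (t - 1) * (x.schlesingerHamiltonian κ t
        + x.q t 1 * x.p κ t 1 / t + x.q t 2 * x.p κ t 2 / t)
      = evalAt (x.q t) (x.p κ t) (hamiltonian κ t)
        + (t * (-1 / 4 * κ.θ₁ ^ 2 + 5 / 2 * κ.θ₁ * κ.θ₂ - 1 / 4 * κ.θ₂ ^ 2 - 2 * κ.ρ₂ * κ.ρ₃)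
          + (t - 1) * (-1 / 4 * κ.θ₁ ^ 2 + 3 / 2 * κ.θ₁ * κ.θ₃ + 1 / 4 * κ.θ₂ ^ 2
            + 1 / 2 * κ.θ₂ * κ.θ₃)) := by
  have hr := (isNormalForm_iff κ x).1 h
  obtain ⟨hb1, hb6, hc3⟩ := hx
  have hl : x.core.l₃ ≠ 0 := neg_ne_zero.2 hc3
  have he := hr.core_relations.eq_coreOf (show x.core.m₁ ≠ 0 from hb1) hl
  have hx : x = ((x.darboux κ).coreOf κ x.core.m₁ x.core.l₃ x.core.b₆ x.core.b₇).toVars κ :=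
    (hr.toVars_core hb1).symm.trans (congrArg (Core.toVars κ) he)
  have ht1 : t - 1 ≠ 0 := sub_ne_zero.2 ht'
  rw [Vars.schlesingerHamiltonian, trace_residues_zero_mul_one _ _ hκ hb1 hl x hx,
    trace_residues_zero_mul_two _ _ hκ hb1 hl x hx, Vars.q_eq κ, Vars.p_eq]
  generalize x.darboux κ = d
  simp only [evalAt, hamiltonian, HVI, map_mul, map_sub, map_add, map_neg, map_pow, eval_X, eval_C,
    map_one, Sum.elim_inl, Sum.elim_inr, Darboux.q, Darboux.p, Matrix.cons_val]
  field_simp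
  ring

end Painleve42

namespace Painleve42

open Matrix Filter Topology

/-! ### Entrywise differentiation of matrix functions -/

section Calculus

variable {E : Type*} [NormedAddCommGroup E] [NormedSpace ℂ E]
variable {m n o : Type*}

/-- The entries of the matrix function `M` are differentiable at `z`. -/
def EntriesDiff (M : E → Matrix m n ℂ) (z : E) : Prop :=
  ∀ i j, DifferentiableAt ℂ (fun w => M w i j) z

/-- The matrix of the derivatives of the entries of `M` in direction `v`. -/
noncomputable def entryDeriv (M : E → Matrix m n ℂ) (z v : E) : Matrix m n ℂ :=
  Matrix.of fun i j => fderiv ℂ (fun w => M w i j) z v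

variable {z v : E}

theorem EntriesDiff.congr {M N : E → Matrix m n ℂ} (h : EntriesDiff M z) (hMN : N =ᶠ[𝓝 z] M) :
    EntriesDiff N z := fun i j =>
  (h i j).congr_of_eventuallyEq (hMN.mono fun _ hw => congrFun (congrFun hw i) j)

theorem entryDeriv_congr {M N : E → Matrix m n ℂ} (hMN : M =ᶠ[𝓝 z] N) :
    entryDeriv M z v = entryDeriv N z v := by
  ext i j
  have h : (fun w => M w i j) =ᶠ[𝓝 z] fun w => N w i j :=
    hMN.mono fun _ hw => congrFun (congrFun hw i) j
  exact congrArg (fun L : E →L[ℂ] ℂ => L v) h.fderiv_eq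

theorem entriesDiff_const (M : Matrix m n ℂ) : EntriesDiff (fun _ : E => M) z :=
  fun _ _ => differentiableAt_const _

theorem entryDeriv_const (M : Matrix m n ℂ) : entryDeriv (fun _ : E => M) z v = 0 := by
  ext i j
  simp [entryDeriv]

theorem EntriesDiff.add {M N : E → Matrix m n ℂ} (hM : EntriesDiff M z) (hN : EntriesDiff N z) :
    EntriesDiff (fun w => M w + N w) z := fun i j => (hM i j).add (hN i j)

theorem entryDeriv_add {M N : E → Matrix m n ℂ} (hM : EntriesDiff M z) (hN : EntriesDiff N z) :
    entryDeriv (fun w => M w + N w) z v = entryDeriv M z v + entryDeriv N z v := by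
  ext i j
  simp only [entryDeriv, Matrix.of_apply, Matrix.add_apply]
  rw [fderiv_fun_add (hM i j) (hN i j)]
  rfl

theorem entryDeriv_neg {M : E → Matrix m n ℂ} :
    entryDeriv (fun w => -M w) z v = -entryDeriv M z v := by
  ext i j
  simp only [entryDeriv, Matrix.of_apply, Matrix.neg_apply]
  rw [fderiv_fun_neg]
  rfl

theorem EntriesDiff.sub {M N : E → Matrix m n ℂ} (hM : EntriesDiff M z) (hN : EntriesDiff N z) :
    EntriesDiff (fun w => M w - N w) z := fun i j => (hM i j).sub (hN i j)

theorem entryDeriv_sub {M N : E → Matrix m n ℂ} (hM : EntriesDiff M z) (hN : EntriesDiff N z) :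
    entryDeriv (fun w => M w - N w) z v = entryDeriv M z v - entryDeriv N z v := by
  ext i j
  simp only [entryDeriv, Matrix.of_apply, Matrix.sub_apply]
  rw [fderiv_fun_sub (hM i j) (hN i j)]
  rfl

theorem entryDeriv_const_smul (c : ℂ) {M : E → Matrix m n ℂ} (hM : EntriesDiff M z) :
    entryDeriv (fun w => c • M w) z v = c • entryDeriv M z v := by
  ext i j
  simp only [entryDeriv, Matrix.of_apply, Matrix.smul_apply]
  rw [fderiv_fun_const_smul (hM i j)]
  rfl

theorem EntriesDiff.submatrix {m' n' : Type*} {M : E → Matrix m n ℂ} (hM : EntriesDiff M z)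
    (e : m' → m) (f : n' → n) : EntriesDiff (fun w => (M w).submatrix e f) z :=
  fun i j => hM (e i) (f j)

theorem entryDeriv_submatrix {m' n' : Type*} (M : E → Matrix m n ℂ) (e : m' → m) (f : n' → n) :
    entryDeriv (fun w => (M w).submatrix e f) z v = (entryDeriv M z v).submatrix e f := rfl

variable [Fintype n]

theorem EntriesDiff.mul {M : E → Matrix m n ℂ} {N : E → Matrix n o ℂ} (hM : EntriesDiff M z)
    (hN : EntriesDiff N z) : EntriesDiff (fun w => M w * N w) z := fun i j => by
  simp only [Matrix.mul_apply]
  exact DifferentiableAt.fun_sum fun k _ => (hM i k).mul (hN k j)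

theorem entryDeriv_mul {M : E → Matrix m n ℂ} {N : E → Matrix n o ℂ} (hM : EntriesDiff M z)
    (hN : EntriesDiff N z) : entryDeriv (fun w => M w * N w) z v =
      entryDeriv M z v * N z + M z * entryDeriv N z v := by
  ext i j
  simp only [entryDeriv, Matrix.of_apply, Matrix.add_apply, Matrix.mul_apply]
  rw [fderiv_fun_sum fun k _ => (hM i k).fun_mul (hN k j), ← Finset.sum_add_distrib]
  rw [_root_.sum_apply]
  refine Finset.sum_congr rfl fun k _ => ?_
  rw [fderiv_fun_mul (hM i k) (hN k j)]
  simp only [_root_.add_apply, _root_.smul_apply, smul_eq_mul]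
  ring

variable [Fintype m]

theorem EntriesDiff.trace {M : E → Matrix m m ℂ} (hM : EntriesDiff M z) :
    DifferentiableAt ℂ (fun w => (M w).trace) z :=
  DifferentiableAt.fun_sum fun i _ => hM i i

theorem fderiv_trace {M : E → Matrix m m ℂ} (hM : EntriesDiff M z) :
    fderiv ℂ (fun w => (M w).trace) z v = (entryDeriv M z v).trace := by
  simp only [Matrix.trace, Matrix.diag]
  rw [fderiv_fun_sum fun i _ => hM i i, _root_.sum_apply]
  rfl

variable [DecidableEq m]

theorem EntriesDiff.det {M : E → Matrix m m ℂ} (hM : EntriesDiff M z) :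
    DifferentiableAt ℂ (fun w => (M w).det) z := by
  simp only [Matrix.det_apply]
  refine DifferentiableAt.fun_sum fun σ _ => DifferentiableAt.const_smul ?_ _
  exact (HasFDerivAt.finsetProd fun i _ => (hM (σ i) i).hasFDerivAt).differentiableAt

theorem EntriesDiff.inv {M : E → Matrix m m ℂ} (hM : EntriesDiff M z) (h : IsUnit (M z).det) :
    EntriesDiff (fun w => (M w)⁻¹) z := fun i j => by
  simp only [Matrix.inv_def, Ring.inverse_eq_inv', Matrix.smul_apply, Matrix.adjugate_apply]
  refine (hM.det.inv h.ne_zero).mul (EntriesDiff.det fun k l => ?_)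
  by_cases hk : k = j
  · subst hk
    simp
  · simpa [Matrix.updateRow_ne hk] using hM k l

theorem EntriesDiff.eventually_isUnit_det {M : E → Matrix m m ℂ} (hM : EntriesDiff M z)
    (h : IsUnit (M z).det) : ∀ᶠ w in 𝓝 z, IsUnit (M w).det := by
  simp only [isUnit_iff_ne_zero] at h ⊢
  exact hM.det.continuousAt.eventually_ne h

end Calculus

/-! ### The Kirillov–Kostant form -/

section KirillovKostant

variable {m n : Type*} [Fintype m] [Fintype n]

/-- The Kirillov–Kostant form at a matrix `A` with `A² = θ A`. -/
noncomputable def kks (θ : ℂ) (A A₁ A₂ : Matrix m m ℂ) : ℂ :=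
  (A * (A₂ * A₁ - A₁ * A₂)).trace / θ ^ 2

theorem kks_add_left (θ : ℂ) (A A₁ A₁' A₂ : Matrix m m ℂ) :
    kks θ A (A₁ + A₁') A₂ = kks θ A A₁ A₂ + kks θ A A₁' A₂ := by
  rw [kks, kks, kks, ← add_div, ← Matrix.trace_add]
  congr 2
  noncomm_ring

theorem kks_neg_swap (θ : ℂ) (A A₁ A₂ : Matrix m m ℂ) : kks θ A A₁ A₂ = -kks θ A A₂ A₁ := by
  rw [kks, kks, ← neg_div, ← Matrix.trace_neg]
  congr 2
  noncomm_ring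

theorem kks_add_right (θ : ℂ) (A A₁ A₂ A₂' : Matrix m m ℂ) :
    kks θ A A₁ (A₂ + A₂') = kks θ A A₁ A₂ + kks θ A A₁ A₂' := by
  rw [kks_neg_swap, kks_add_left, neg_add, ← kks_neg_swap, ← kks_neg_swap]

theorem kks_conj [DecidableEq m] (θ : ℂ) (A A₁ A₂ P : Matrix m m ℂ) (hP : IsUnit P.det) :
    kks θ (P⁻¹ * A * P) (P⁻¹ * A₁ * P) (P⁻¹ * A₂ * P) = kks θ A A₁ A₂ := by
  have h : P⁻¹ * A * P * (P⁻¹ * A₂ * P * (P⁻¹ * A₁ * P) - P⁻¹ * A₁ * P * (P⁻¹ * A₂ * P)) =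
      P⁻¹ * (A * (A₂ * A₁ - A₁ * A₂)) * P := by
    have h1 (X : Matrix m m ℂ) : P * (P⁻¹ * X) = X := by
      rw [← Matrix.mul_assoc, Matrix.mul_nonsing_inv _ hP, Matrix.one_mul]
    simp only [Matrix.mul_sub, Matrix.sub_mul, Matrix.mul_assoc, h1]
  rw [kks, h, Matrix.trace_mul_comm, ← Matrix.mul_assoc, Matrix.mul_nonsing_inv _ hP,
    Matrix.one_mul, kks]

/-- Multiplying the tangency relation AA₂ + A₂A = θA₂ by A gives AA₂A = 0. This kills two of the
four terms of the trace, and tangency turns the other two into θ² tr(YA₂). Both the gauge terms and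
the Schlesinger flow are commutators, so this formula governs them. -/
theorem kks_commutator {θ : ℂ} (hθ : θ ≠ 0) {A A₂ Y : Matrix m m ℂ} (hA : A * A = θ • A)
    (hA₂ : A * A₂ + A₂ * A = θ • A₂) : kks θ A (Y * A - A * Y) A₂ = (Y * A₂).trace := by
  have h0 : A * A₂ * A = 0 := by
    have h := congrArg (A * ·) hA₂
    simp only [Matrix.mul_add, Matrix.mul_smul, ← Matrix.mul_assoc, hA, Matrix.smul_mul] at h
    exact add_eq_left.1 h
  have h1 : (A * (A₂ * (Y * A - A * Y) - (Y * A - A * Y) * A₂)).trace =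
      (A * A₂ * Y * A).trace - (A * A₂ * A * Y).trace - (A * Y * (A * A₂)).trace
        + (A * A * Y * A₂).trace := by
    rw [← Matrix.trace_sub, ← Matrix.trace_sub, ← Matrix.trace_add]
    congr 1
    noncomm_ring
  have h2 : (A * Y * (A * A₂)).trace = 0 := by
    rw [Matrix.trace_mul_comm, ← Matrix.mul_assoc, h0, Matrix.zero_mul, Matrix.trace_zero]
  have h3 : (A * A₂ * Y * A).trace = θ * (Y * (A * A₂)).trace := by
    rw [Matrix.trace_mul_comm, ← Matrix.mul_assoc, ← Matrix.mul_assoc, hA, Matrix.smul_mul,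
      Matrix.smul_mul, Matrix.trace_smul, smul_eq_mul, Matrix.trace_mul_comm (A * A₂)]
  have h4 : (A * A * Y * A₂).trace = θ * (Y * (A₂ * A)).trace := by
    rw [hA, Matrix.smul_mul, Matrix.smul_mul, Matrix.trace_smul, smul_eq_mul, Matrix.mul_assoc,
      Matrix.trace_mul_comm A, Matrix.mul_assoc]
  rw [kks, h1, h2, h3, h4, h0, Matrix.zero_mul, Matrix.trace_zero, div_eq_iff (pow_ne_zero 2 hθ)]
  have h5 : (Y * (A * A₂)).trace + (Y * (A₂ * A)).trace = θ * (Y * A₂).trace := by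
    rw [← Matrix.trace_add, ← Matrix.mul_add, hA₂, Matrix.mul_smul, Matrix.trace_smul, smul_eq_mul]
  linear_combination θ * h5

/-- The second summand is symmetric in the two directions by cyclicity of the trace, so it
disappears on antisymmetrization in `kks_factor`. -/
theorem trace_factor_mul [DecidableEq n] {θ : ℂ} {B B₁ B₂ : Matrix m n ℂ} {C C₁ C₂ : Matrix n m ℂ}
    (h : C * B = θ • 1) (h₁ : C₁ * B + C * B₁ = 0) (h₂ : C₂ * B + C * B₂ = 0) :
    (B * C * ((B₂ * C + B * C₂) * (B₁ * C + B * C₁))).trace =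
      θ ^ 2 * (C₂ * B₁).trace + θ * (C * B₂ * (C * B₁)).trace := by
  have h₁' : C₁ * B = -(C * B₁) := eq_neg_of_add_eq_zero_left h₁
  have e1 : C * (B₂ * C + B * C₂) = C * B₂ * C + θ • C₂ := by
    rw [Matrix.mul_add, ← Matrix.mul_assoc, ← Matrix.mul_assoc, h, Matrix.smul_mul, Matrix.one_mul]
  have e2 : (B₁ * C + B * C₁) * B = θ • B₁ - B * (C * B₁) := by
    rw [Matrix.add_mul, Matrix.mul_assoc, Matrix.mul_assoc, h, h₁', Matrix.mul_smul, Matrix.mul_one,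
      Matrix.mul_neg, sub_eq_add_neg]
  rw [Matrix.mul_assoc, Matrix.trace_mul_comm, ← Matrix.mul_assoc, e1, Matrix.mul_assoc, e2]
  have h₂' : C₂ * B = -(C * B₂) := eq_neg_of_add_eq_zero_left h₂
  have e3 : (C * B₂ * C + θ • C₂) * (θ • B₁ - B * (C * B₁)) =
      θ ^ 2 • (C₂ * B₁) + θ • (C * B₂ * (C * B₁)) - C * B₂ * (C * B) * (C * B₁)
        - θ • (C₂ * B * (C * B₁)) := by
    simp only [Matrix.add_mul, Matrix.mul_sub, Matrix.mul_smul, Matrix.smul_mul, Matrix.mul_assoc,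
      smul_add, smul_smul, pow_two]
    abel
  rw [e3, h, h₂', Matrix.mul_smul, Matrix.mul_one, Matrix.smul_mul, Matrix.neg_mul, smul_neg,
    add_sub_cancel_right, sub_neg_eq_add, Matrix.trace_add, Matrix.trace_smul, Matrix.trace_smul,
    smul_eq_mul, smul_eq_mul]

/-- The left side involves only A = BC and its derivatives: the form tr(dB ∧ dC) on CB = θ does not
see the choice of factors. Hence the given factors B_i, C_i can be traded for those of the normal
form. -/
theorem kks_factor [DecidableEq n] {θ : ℂ} (hθ : θ ≠ 0) {B B₁ B₂ : Matrix m n ℂ}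
    {C C₁ C₂ : Matrix n m ℂ} (h : C * B = θ • 1) (h₁ : C₁ * B + C * B₁ = 0)
    (h₂ : C₂ * B + C * B₂ = 0) :
    kks θ (B * C) (B₁ * C + B * C₁) (B₂ * C + B * C₂) =
      (B₁ * C₂).trace - (B₂ * C₁).trace := by
  rw [kks, Matrix.mul_sub, Matrix.trace_sub, trace_factor_mul h h₁ h₂, trace_factor_mul h h₂ h₁,
    div_eq_iff (pow_ne_zero 2 hθ), Matrix.trace_mul_comm (C * B₂), Matrix.trace_mul_comm C₂,
    Matrix.trace_mul_comm C₁]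
  ring

end KirillovKostant

end Painleve42

/-! ### Factors of the residue matrices and their derivatives -/

namespace Painleve42

open Matrix Filter Topology

/-- The nonzero eigenvalues of the residue matrices at `x = t, 1, 0`. -/
def Exponents.θ (κ : Exponents) : Fin 3 → ℂ := ![κ.θ₁, κ.θ₂, κ.θ₃]

theorem Exponents.IsAdmissible.θ_ne {κ : Exponents} (hκ : κ.IsAdmissible) (i : Fin 3) :
    κ.θ i ≠ 0 := by
  fin_cases i
  exacts [hκ.θ₁_ne, hκ.θ₂_ne, hκ.θ₃_ne]

/-- The first factor of a `blockProduct`. -/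
def frameRows (B : Matrix (Fin 3) (Fin 3) ℂ) : Matrix (Fin 6) (Fin 3) ℂ :=
  (fromRows (1 : Matrix (Fin 3) (Fin 3) ℂ) B).submatrix (finSumFinEquiv (m := 3) (n := 3)).symm id

/-- The second factor of a `blockProduct`. -/
def frameCols (θ : ℂ) (B C : Matrix (Fin 3) (Fin 3) ℂ) : Matrix (Fin 3) (Fin 6) ℂ :=
  (fromCols (θ • (1 : Matrix (Fin 3) (Fin 3) ℂ) - C * B) C).submatrix id
    (finSumFinEquiv (m := 3) (n := 3)).symm

theorem blockProduct_eq_frame (θ : ℂ) (B C : Matrix (Fin 3) (Fin 3) ℂ) :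
    blockProduct θ B C = frameRows B * frameCols θ B C :=
  Matrix.submatrix_mul _ _ _ id _ Function.bijective_id

theorem submatrix_fromCols_mul_fromRows (X Y Z W : Matrix (Fin 3) (Fin 3) ℂ) :
    (fromCols X Y).submatrix id (finSumFinEquiv (m := 3) (n := 3)).symm *
      (fromRows Z W).submatrix (finSumFinEquiv (m := 3) (n := 3)).symm id = X * Z + Y * W := by
  rw [Matrix.submatrix_mul_equiv, fromCols_mul_fromRows, Matrix.submatrix_id_id]

theorem frameCols_mul_frameRows (θ : ℂ) (B C : Matrix (Fin 3) (Fin 3) ℂ) :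
    frameCols θ B C * frameRows B = θ • 1 := by
  rw [frameCols, frameRows, submatrix_fromCols_mul_fromRows, Matrix.mul_one, sub_add_cancel]

theorem blockProduct_mul_self (θ : ℂ) (B C : Matrix (Fin 3) (Fin 3) ℂ) :
    blockProduct θ B C * blockProduct θ B C = θ • blockProduct θ B C := by
  rw [blockProduct_eq_frame, Matrix.mul_assoc, ← Matrix.mul_assoc (frameCols θ B C),
    frameCols_mul_frameRows, Matrix.smul_mul, Matrix.one_mul, Matrix.mul_smul]

theorem residues_mul_self (κ : Exponents) (x : Vars) (i : Fin 3) :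
    x.residues κ i * x.residues κ i = κ.θ i • x.residues κ i := by
  fin_cases i
  · exact blockProduct_mul_self _ _ _
  · exact blockProduct_mul_self _ _ _
  · show x.residues κ 2 * x.residues κ 2 = κ.θ₃ • x.residues κ 2
    rw [residues_two_eq, ← map_mul, ← map_smul, fromBlocks_multiply, fromBlocks_smul]
    congr 2
    · ext i j
      fin_cases i <;> fin_cases j <;> simp
    · ext i j
      fin_cases i <;> fin_cases j <;> simp
    · simp
    · simp

section Derivatives

variable {E : Type*} [NormedAddCommGroup E] [NormedSpace ℂ E] {z v : E}

/-- The derivative of a `blockProduct`. -/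
def blockDeriv (θ : ℂ) (B C dB dC : Matrix (Fin 3) (Fin 3) ℂ) : Mat6 :=
  (fromRows (0 : Matrix (Fin 3) (Fin 3) ℂ) dB).submatrix
      (finSumFinEquiv (m := 3) (n := 3)).symm id * frameCols θ B C +
    frameRows B * (fromCols (-(dC * B + C * dB)) dC).submatrix id
      (finSumFinEquiv (m := 3) (n := 3)).symm

theorem entriesDiff_fromRows {M N : E → Matrix (Fin 3) (Fin 3) ℂ} (hM : EntriesDiff M z)
    (hN : EntriesDiff N z) : EntriesDiff (fun w => fromRows (M w) (N w)) z := by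
  rintro (i | i) j
  exacts [hM i j, hN i j]

theorem entryDeriv_fromRows (M N : E → Matrix (Fin 3) (Fin 3) ℂ) :
    entryDeriv (fun w => fromRows (M w) (N w)) z v =
      fromRows (entryDeriv M z v) (entryDeriv N z v) := by
  ext i j
  rcases i with i | i <;> rfl

theorem entriesDiff_fromCols {M N : E → Matrix (Fin 3) (Fin 3) ℂ} (hM : EntriesDiff M z)
    (hN : EntriesDiff N z) : EntriesDiff (fun w => fromCols (M w) (N w)) z := by
  rintro i (j | j)
  exacts [hM i j, hN i j]

theorem entryDeriv_fromCols (M N : E → Matrix (Fin 3) (Fin 3) ℂ) :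
    entryDeriv (fun w => fromCols (M w) (N w)) z v =
      fromCols (entryDeriv M z v) (entryDeriv N z v) := by
  ext i j
  rcases j with j | j <;> rfl

variable {B C : E → Matrix (Fin 3) (Fin 3) ℂ}

theorem EntriesDiff.blockProduct (θ : ℂ) (hB : EntriesDiff B z) (hC : EntriesDiff C z) :
    EntriesDiff (fun w => blockProduct θ (B w) (C w)) z :=
  EntriesDiff.submatrix ((entriesDiff_fromRows (entriesDiff_const 1) hB).mul
    (entriesDiff_fromCols ((entriesDiff_const _).sub (hC.mul hB)) hC)) _ _

theorem entryDeriv_blockProduct (θ : ℂ) (hB : EntriesDiff B z) (hC : EntriesDiff C z) :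
    entryDeriv (fun w => blockProduct θ (B w) (C w)) z v =
      blockDeriv θ (B z) (C z) (entryDeriv B z v) (entryDeriv C z v) := by
  have h1 : EntriesDiff (fun w => θ • (1 : Matrix (Fin 3) (Fin 3) ℂ) - C w * B w) z :=
    (entriesDiff_const _).sub (hC.mul hB)
  have h2 : entryDeriv (fun w => θ • (1 : Matrix (Fin 3) (Fin 3) ℂ) - C w * B w) z v =
      -(entryDeriv C z v * B z + C z * entryDeriv B z v) := by
    rw [entryDeriv_sub (entriesDiff_const _) (hC.mul hB), entryDeriv_const, entryDeriv_mul hC hB,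
      zero_sub]
  simp only [Painleve42.blockProduct]
  rw [entryDeriv_submatrix, entryDeriv_mul (entriesDiff_fromRows (entriesDiff_const 1) hB)
    (entriesDiff_fromCols h1 hC), entryDeriv_fromRows, entryDeriv_fromCols, h2, entryDeriv_const]
  rw [blockDeriv, frameRows, frameCols, ← Matrix.submatrix_mul _ _ _ id _ Function.bijective_id,
    ← Matrix.submatrix_mul _ _ _ id _ Function.bijective_id]
  rfl

/-- The upper half of the first factor is the constant identity, so only the lower half dB and the
facing block dC of the second factor contribute to the trace. -/
theorem kks_blockProduct {θ : ℂ} (hθ : θ ≠ 0) (B C dB dC δB δC : Matrix (Fin 3) (Fin 3) ℂ) :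
    kks θ (blockProduct θ B C) (blockDeriv θ B C dB dC) (blockDeriv θ B C δB δC) =
      (dB * δC).trace - (δB * dC).trace := by
  have h (dB dC : Matrix (Fin 3) (Fin 3) ℂ) :
      (fromCols (-(dC * B + C * dB)) dC).submatrix id (finSumFinEquiv (m := 3) (n := 3)).symm *
        frameRows B + frameCols θ B C * (fromRows (0 : Matrix (Fin 3) (Fin 3) ℂ) dB).submatrix
          (finSumFinEquiv (m := 3) (n := 3)).symm id = 0 := by
    rw [frameRows, frameCols, submatrix_fromCols_mul_fromRows, submatrix_fromCols_mul_fromRows,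
      Matrix.mul_one, Matrix.mul_zero, zero_add]
    abel
  have ht (dB dC δB : Matrix (Fin 3) (Fin 3) ℂ) :
      ((fromRows (0 : Matrix (Fin 3) (Fin 3) ℂ) dB).submatrix
          (finSumFinEquiv (m := 3) (n := 3)).symm id *
        (fromCols (-(dC * B + C * δB)) dC).submatrix id
          (finSumFinEquiv (m := 3) (n := 3)).symm).trace = (dB * dC).trace := by
    rw [Matrix.trace_mul_comm, submatrix_fromCols_mul_fromRows, Matrix.mul_zero, zero_add,
      Matrix.trace_mul_comm]
  rw [blockProduct_eq_frame, blockDeriv, blockDeriv,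
    kks_factor hθ (frameCols_mul_frameRows θ B C) (h dB dC) (h δB δC), ht, ht]

/-- If a `blockProduct` is differentiable, then so are its factors. -/
theorem entriesDiff_of_blockProduct {θ : ℂ} (hθ : θ ≠ 0)
    (h : EntriesDiff (fun w => blockProduct θ (B w) (C w)) z) :
    EntriesDiff B z ∧ EntriesDiff C z := by
  let e := finSumFinEquiv (m := 3) (n := 3)
  have hsub (w : E) : (blockProduct θ (B w) (C w)).submatrix e e =
      fromBlocks (θ • (1 : Matrix (Fin 3) (Fin 3) ℂ) - C w * B w) (C w)
        (B w * (θ • (1 : Matrix (Fin 3) (Fin 3) ℂ) - C w * B w)) (B w * C w) := by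
    rw [blockProduct, fromRows_mul_fromCols, Matrix.one_mul, Matrix.one_mul,
      Matrix.submatrix_submatrix]
    simp [e]
  have hd := h.submatrix e e
  simp only [hsub] at hd
  have hC : EntriesDiff C z := fun i j => hd (Sum.inl i) (Sum.inr j)
  have h1 : EntriesDiff (fun w => θ • (1 : Matrix (Fin 3) (Fin 3) ℂ) - C w * B w) z :=
    fun i j => hd (Sum.inl i) (Sum.inl j)
  have h2 : EntriesDiff (fun w => B w * (θ • (1 : Matrix (Fin 3) (Fin 3) ℂ) - C w * B w)) z :=
    fun i j => hd (Sum.inr i) (Sum.inl j)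
  have h3 : EntriesDiff (fun w => B w * C w) z := fun i j => hd (Sum.inr i) (Sum.inr j)
  -- `B w` is recovered by freezing one factor at the base point: θ - C(w)B(w) + C(w)B(z) equals θ
  -- at w = z, so it is invertible nearby, and its product with `B w` from the left consists of
  -- known blocks of the `blockProduct`.
  have hT : EntriesDiff (fun w => θ • (1 : Matrix (Fin 3) (Fin 3) ℂ) - C w * B w + C w * B z) z :=
    h1.add (hC.mul (entriesDiff_const _))
  have hS : EntriesDiff (fun w => B w * (θ • (1 : Matrix (Fin 3) (Fin 3) ℂ) - C w * B w)
      + B w * C w * B z) z := h2.add (h3.mul (entriesDiff_const _))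
  have hdet : IsUnit (θ • (1 : Matrix (Fin 3) (Fin 3) ℂ) - C z * B z + C z * B z).det := by
    rw [sub_add_cancel, Matrix.det_smul, Matrix.det_one, mul_one]
    exact (isUnit_iff_ne_zero.2 hθ).pow _
  refine ⟨(hS.mul (hT.inv hdet)).congr ?_, hC⟩
  filter_upwards [hT.eventually_isUnit_det hdet] with w hw
  rw [Matrix.mul_assoc (B w), ← Matrix.mul_add, Matrix.mul_assoc, Matrix.mul_nonsing_inv _ hw,
    Matrix.mul_one]

end Derivatives

end Painleve42

/-! ### The symplectic form on families of normal forms -/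

namespace Painleve42

open Matrix Filter Topology

theorem residues_two_entries (κ : Exponents) (x : Vars) :
    x.residues κ 2 =
      !![κ.θ₃, 0, x.a₁₂, x.a₁₃, x.a₁₄, x.a₁₅; 0, κ.θ₃, x.a₁₆, x.a₁₇, x.a₁₈, x.a₁₉;
        0, 0, 0, 0, 0, 0; 0, 0, 0, 0, 0, 0; 0, 0, 0, 0, 0, 0; 0, 0, 0, 0, 0, 0] := by
  ext i j
  fin_cases i <;> fin_cases j <;> simp [Vars.residues]

section Families

variable {E : Type*} [NormedAddCommGroup E] [NormedSpace ℂ E] {z v : E}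
variable {E' : Type*} [NormedAddCommGroup E'] [NormedSpace ℂ E'] {z' v' : E'}

/-- Near `z`, the `x w` are regular normal forms, and they depend differentiably on `w`. -/
structure RegularFamily (κ : Exponents) (x : E → Vars) (z : E) : Prop where
  isNormalForm : ∀ᶠ w in 𝓝 z, (x w).IsNormalForm κ ∧ (x w).IsRegular
  diff : ∀ i, EntriesDiff (fun w => (x w).residues κ i) z

variable {κ : Exponents} {x : E → Vars} {y : E' → Vars}

theorem RegularFamily.factors (hκ : κ.IsAdmissible) (h : RegularFamily κ x z) :
    EntriesDiff (fun w => (x w).B₁) z ∧ EntriesDiff (fun w => (x w).C₁) z ∧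
    EntriesDiff (fun w => (x w).B₂) z ∧ EntriesDiff (fun w => (x w).C₂) z := by
  have h1 := entriesDiff_of_blockProduct hκ.θ₁_ne (h.diff 0)
  have h2 := entriesDiff_of_blockProduct hκ.θ₂_ne (h.diff 1)
  exact ⟨h1.1, h1.2, h2.1, h2.2⟩

theorem RegularFamily.b_diff (hκ : κ.IsAdmissible) (h : RegularFamily κ x z) (j : Fin 7) :
    DifferentiableAt ℂ (fun w => (x w).b j) z := by
  obtain ⟨h1, -, h2, -⟩ := h.factors hκ
  fin_cases j
  exacts [h1 0 1, h1 1 0, h1 1 2, h1 2 0, h1 2 2, h2 1 2, h2 2 2]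

theorem RegularFamily.c_diff (hκ : κ.IsAdmissible) (h : RegularFamily κ x z) (j : Fin 7) :
    DifferentiableAt ℂ (fun w => (x w).c j) z := by
  obtain ⟨-, h1, -, h2⟩ := h.factors hκ
  fin_cases j
  exacts [h1 1 0, h1 0 1, h1 2 1, h1 0 2, h1 2 2, h2 2 1, h2 2 2]

/-- The trace pairs the entry (i, j) of B with (j, i) of C. The normal form is arranged so that
every a_j in one factor faces a constant in the other, and b_j faces c_j. -/
theorem trace_entryDeriv_B₁_mul_C₁ :
    (entryDeriv (fun w => (x w).B₁) z v * entryDeriv (fun w => (y w).C₁) z' v').trace =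
      fderiv ℂ (fun w => (x w).b 0) z v * fderiv ℂ (fun w => (y w).c 0) z' v' +
      fderiv ℂ (fun w => (x w).b 1) z v * fderiv ℂ (fun w => (y w).c 1) z' v' +
      fderiv ℂ (fun w => (x w).b 2) z v * fderiv ℂ (fun w => (y w).c 2) z' v' +
      fderiv ℂ (fun w => (x w).b 3) z v * fderiv ℂ (fun w => (y w).c 3) z' v' +
      fderiv ℂ (fun w => (x w).b 4) z v * fderiv ℂ (fun w => (y w).c 4) z' v' := by
  simp [Matrix.trace_fin_three, Matrix.mul_apply, Fin.sum_univ_succ, entryDeriv, Vars.B₁, Vars.C₁,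
    Vars.b, Vars.c]
  ring

theorem trace_entryDeriv_B₂_mul_C₂ :
    (entryDeriv (fun w => (x w).B₂) z v * entryDeriv (fun w => (y w).C₂) z' v').trace =
      fderiv ℂ (fun w => (x w).b 5) z v * fderiv ℂ (fun w => (y w).c 5) z' v' +
      fderiv ℂ (fun w => (x w).b 6) z v * fderiv ℂ (fun w => (y w).c 6) z' v' := by
  simp [Matrix.trace_fin_three, Matrix.mul_apply, Fin.sum_univ_succ, entryDeriv, Vars.B₂, Vars.C₂,
    Vars.b, Vars.c]

theorem entryDeriv_residues_two :
    ∃ c : Fin 2 → Fin 4 → ℂ, entryDeriv (fun w => (x w).residues κ 2) z v =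
      !![0, 0, c 0 0, c 0 1, c 0 2, c 0 3; 0, 0, c 1 0, c 1 1, c 1 2, c 1 3;
        0, 0, 0, 0, 0, 0; 0, 0, 0, 0, 0, 0; 0, 0, 0, 0, 0, 0; 0, 0, 0, 0, 0, 0] := by
  refine ⟨fun i j => entryDeriv (fun w => (x w).residues κ 2) z v (i.castAdd 4) (j.natAdd 2), ?_⟩
  simp only [residues_two_entries, entryDeriv]
  ext i j
  fin_cases i <;> fin_cases j <;> simp

/-- The variable part of Ã₃ maps the span of the last four basis vectors to that of the first two,
so two such matrices multiply to zero, and Ã₃ does not contribute to the form. -/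
theorem entryDeriv_residues_two_mul :
    entryDeriv (fun w => (x w).residues κ 2) z v *
      entryDeriv (fun w => (y w).residues κ 2) z' v' = 0 := by
  obtain ⟨c, hc⟩ := entryDeriv_residues_two (κ := κ) (x := x) (z := z) (v := v)
  obtain ⟨d, hd⟩ := entryDeriv_residues_two (κ := κ) (x := y) (z := z') (v := v')
  rw [hc, hd]
  ext i j
  fin_cases i <;> fin_cases j <;> simp [Matrix.mul_apply, Fin.sum_univ_succ]

/-- The Kirillov–Kostant form of the residue matrices on two families through the same normal
form. -/
theorem sum_kks_residues (hκ : κ.IsAdmissible) (hx : RegularFamily κ x z)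
    (hy : RegularFamily κ y z') (hxy : x z = y z') :
    ∑ i, kks (κ.θ i) ((x z).residues κ i) (entryDeriv (fun w => (x w).residues κ i) z v)
        (entryDeriv (fun w => (y w).residues κ i) z' v') =
      ∑ j, (fderiv ℂ (fun w => (x w).b j) z v * fderiv ℂ (fun w => (y w).c j) z' v'
        - fderiv ℂ (fun w => (y w).b j) z' v' * fderiv ℂ (fun w => (x w).c j) z v) := by
  obtain ⟨hB1, hC1, hB2, hC2⟩ := hx.factors hκ
  obtain ⟨hB1', hC1', hB2', hC2'⟩ := hy.factors hκ
  have h1 : kks (κ.θ 0) ((x z).residues κ 0) (entryDeriv (fun w => (x w).residues κ 0) z v)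
        (entryDeriv (fun w => (y w).residues κ 0) z' v') =
      (entryDeriv (fun w => (x w).B₁) z v * entryDeriv (fun w => (y w).C₁) z' v').trace -
      (entryDeriv (fun w => (y w).B₁) z' v' * entryDeriv (fun w => (x w).C₁) z v).trace := by
    rw [← kks_blockProduct hκ.θ₁_ne (x z).B₁ (x z).C₁]
    have e1 := entryDeriv_blockProduct (v := v) κ.θ₁ hB1 hC1
    have e2 := entryDeriv_blockProduct (v := v') κ.θ₁ hB1' hC1'
    rw [← hxy] at e2
    rw [← e1, ← e2]
    rfl
  have h2 : kks (κ.θ 1) ((x z).residues κ 1) (entryDeriv (fun w => (x w).residues κ 1) z v)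
        (entryDeriv (fun w => (y w).residues κ 1) z' v') =
      (entryDeriv (fun w => (x w).B₂) z v * entryDeriv (fun w => (y w).C₂) z' v').trace -
      (entryDeriv (fun w => (y w).B₂) z' v' * entryDeriv (fun w => (x w).C₂) z v).trace := by
    rw [← kks_blockProduct hκ.θ₂_ne (x z).B₂ (x z).C₂]
    have e1 := entryDeriv_blockProduct (v := v) κ.θ₂ hB2 hC2
    have e2 := entryDeriv_blockProduct (v := v') κ.θ₂ hB2' hC2'
    rw [← hxy] at e2
    rw [← e1, ← e2]
    rfl
  rw [Fin.sum_univ_three, h1, h2, kks, entryDeriv_residues_two_mul, entryDeriv_residues_two_mul,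
    sub_zero, Matrix.mul_zero, Matrix.trace_zero, zero_div, trace_entryDeriv_B₁_mul_C₁,
    trace_entryDeriv_B₁_mul_C₁, trace_entryDeriv_B₂_mul_C₂, trace_entryDeriv_B₂_mul_C₂,
    Fin.sum_univ_seven]
  ring

theorem RegularFamily.lam_diff (hκ : κ.IsAdmissible) (h : RegularFamily κ x z) (j : Fin 5) :
    DifferentiableAt ℂ (fun w => (x w).lam j) z := by
  have hc := h.c_diff hκ
  fin_cases j
  exacts [(hc 0).const_sub 1, (hc 1).neg, (hc 2).neg, (hc 3).neg, (hc 4).neg]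

theorem RegularFamily.mu_diff (hκ : κ.IsAdmissible) (h : RegularFamily κ x z) (j : Fin 5) :
    DifferentiableAt ℂ (fun w => (x w).mu j) z := by
  have hb := h.b_diff hκ
  fin_cases j
  exacts [hb 0, hb 1, (hb 2).sub (hb 5), hb 3, ((hb 4).sub (hb 6)).sub_const 1]

/-- The derivatives of `λ, μ` in terms of those of `b, c`. -/
theorem RegularFamily.fderiv_lam_mu (hκ : κ.IsAdmissible) (h : RegularFamily κ x z) :
    fderiv ℂ (fun w => (x w).lam 0) z v = -fderiv ℂ (fun w => (x w).c 0) z v ∧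
    fderiv ℂ (fun w => (x w).lam 1) z v = -fderiv ℂ (fun w => (x w).c 1) z v ∧
    fderiv ℂ (fun w => (x w).lam 2) z v = -fderiv ℂ (fun w => (x w).c 2) z v ∧
    fderiv ℂ (fun w => (x w).lam 3) z v = -fderiv ℂ (fun w => (x w).c 3) z v ∧
    fderiv ℂ (fun w => (x w).lam 4) z v = -fderiv ℂ (fun w => (x w).c 4) z v ∧
    fderiv ℂ (fun w => (x w).c 5) z v = -fderiv ℂ (fun w => (x w).c 2) z v ∧
    fderiv ℂ (fun w => (x w).c 6) z v = -fderiv ℂ (fun w => (x w).c 4) z v ∧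
    fderiv ℂ (fun w => (x w).mu 0) z v = fderiv ℂ (fun w => (x w).b 0) z v ∧
    fderiv ℂ (fun w => (x w).mu 1) z v = fderiv ℂ (fun w => (x w).b 1) z v ∧
    fderiv ℂ (fun w => (x w).mu 2) z v =
      fderiv ℂ (fun w => (x w).b 2) z v - fderiv ℂ (fun w => (x w).b 5) z v ∧
    fderiv ℂ (fun w => (x w).mu 3) z v = fderiv ℂ (fun w => (x w).b 3) z v ∧
    fderiv ℂ (fun w => (x w).mu 4) z v =
      fderiv ℂ (fun w => (x w).b 4) z v - fderiv ℂ (fun w => (x w).b 6) z v := by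
  have hb := h.b_diff hκ
  have hc := h.c_diff hκ
  have hr : ∀ᶠ w in 𝓝 z, (x w).Relations κ :=
    h.isNormalForm.mono fun w hw => (isNormalForm_iff _ _).1 hw.1
  have h0 (j : Fin 7) : fderiv ℂ (fun w => -(x w).c j) z v = -fderiv ℂ (fun w => (x w).c j) z v :=
    by rw [fderiv_fun_neg]; rfl
  refine ⟨?_, h0 1, h0 2, h0 3, h0 4, ?_, ?_, rfl, rfl, ?_, rfl, ?_⟩
  · have := fderiv_const_sub (𝕜 := ℂ) (f := fun w => (x w).c 0) (x := z) 1
    exact congrArg (fun L : E →L[ℂ] ℂ => L v) this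
  · have h1 : (fun w => (x w).c 5) =ᶠ[𝓝 z] fun w => -(x w).c 2 := hr.mono fun w hw => hw.c₆_eq
    rw [h1.fderiv_eq, fderiv_fun_neg]
    rfl
  · have h1 : (fun w => (x w).c 6) =ᶠ[𝓝 z] fun w => -(x w).c 4 := hr.mono fun w hw => hw.c₇_eq
    rw [h1.fderiv_eq, fderiv_fun_neg]
    rfl
  · exact congrArg (fun L : E →L[ℂ] ℂ => L v) (fderiv_fun_sub (hb 2) (hb 5))
  · have h1 := fderiv_sub_const (𝕜 := ℂ) (f := fun w => (x w).b 4 - (x w).b 6) (x := z) 1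
    have h2 := fderiv_fun_sub (hb 4) (hb 6)
    exact congrArg (fun L : E →L[ℂ] ℂ => L v) (h1.trans h2)

/-- Since c₆ = -c₃ and c₇ = -c₅, the pairs merge: db₃ ∧ dc₃ + db₆ ∧ dc₆ = d(b₃ - b₆) ∧ dc₃ = dλ₃ ∧
dμ₃, and likewise for λ₅, μ₅. Two families are allowed so that the identity serves both for two
directions in one family (statement 4) and for a deformation paired with a variation (statement 6).
-/
theorem sum_b_c_eq_sum_lam_mu (hκ : κ.IsAdmissible) (hx : RegularFamily κ x z)
    (hy : RegularFamily κ y z') :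
    ∑ j, (fderiv ℂ (fun w => (x w).b j) z v * fderiv ℂ (fun w => (y w).c j) z' v'
        - fderiv ℂ (fun w => (y w).b j) z' v' * fderiv ℂ (fun w => (x w).c j) z v) =
      ∑ j, (fderiv ℂ (fun w => (x w).lam j) z v * fderiv ℂ (fun w => (y w).mu j) z' v'
        - fderiv ℂ (fun w => (y w).lam j) z' v' * fderiv ℂ (fun w => (x w).mu j) z v) := by
  obtain ⟨l0, l1, l2, l3, l4, c5, c6, m0, m1, m2, m3, m4⟩ := hx.fderiv_lam_mu hκ (v := v)
  obtain ⟨l0', l1', l2', l3', l4', c5', c6', m0', m1', m2', m3', m4'⟩ :=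
    hy.fderiv_lam_mu hκ (v := v')
  rw [Fin.sum_univ_seven, Fin.sum_univ_five, l0, l1, l2, l3, l4, c5, c6, m0, m1, m2, m3, m4,
    l0', l1', l2', l3', l4', c5', c6', m0', m1', m2', m3', m4']
  ring

end Families

end Painleve42

/-! ### Elimination of two pairs of coordinates -/

namespace Painleve42

open Matrix Filter Topology

section Families

variable {E : Type*} [NormedAddCommGroup E] [NormedSpace ℂ E] {z v : E}
variable {E' : Type*} [NormedAddCommGroup E'] [NormedSpace ℂ E'] {z' v' : E'}
variable {κ : Exponents} {x : E → Vars} {y : E' → Vars}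

theorem fderiv_mul_apply {f g : E → ℂ} (hf : DifferentiableAt ℂ f z)
    (hg : DifferentiableAt ℂ g z) :
    fderiv ℂ (fun w => f w * g w) z v = fderiv ℂ f z v * g z + f z * fderiv ℂ g z v := by
  rw [fderiv_fun_mul hf hg]
  simp only [_root_.add_apply, _root_.smul_apply, smul_eq_mul]
  ring

theorem fderiv_add_apply {f g : E → ℂ} (hf : DifferentiableAt ℂ f z)
    (hg : DifferentiableAt ℂ g z) :
    fderiv ℂ (fun w => f w + g w) z v = fderiv ℂ f z v + fderiv ℂ g z v := by
  rw [fderiv_fun_add hf hg]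
  rfl

theorem fderiv_sub_apply {f g : E → ℂ} (hf : DifferentiableAt ℂ f z)
    (hg : DifferentiableAt ℂ g z) :
    fderiv ℂ (fun w => f w - g w) z v = fderiv ℂ f z v - fderiv ℂ g z v := by
  rw [fderiv_fun_sub hf hg]
  rfl

theorem fderiv_apply_congr {f g : E → ℂ} (h : f =ᶠ[𝓝 z] g) : fderiv ℂ f z v = fderiv ℂ g z v := by
  rw [h.fderiv_eq]

theorem RegularFamily.ne_zero (h : RegularFamily κ x z) :
    (x z).mu 0 ≠ 0 ∧ (x z).lam 2 ≠ 0 := by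
  obtain ⟨-, h1, -, h3⟩ := h.isNormalForm.self_of_nhds
  exact ⟨h1, neg_ne_zero.2 h3⟩

theorem RegularFamily.q₁_diff (hκ : κ.IsAdmissible) (h : RegularFamily κ x z) :
    DifferentiableAt ℂ (fun w => ((x w).darboux κ).q₁) z := by
  show DifferentiableAt ℂ (fun w => ((x w).mu 0 + (x w).lam 4) / (x w).lam 2) z
  simp only [div_eq_mul_inv]
  exact ((h.mu_diff hκ 0).fun_add (h.lam_diff hκ 4)).fun_mul
    ((h.lam_diff hκ 2).fun_inv h.ne_zero.2)

/-- The constraint `core_e₁` turns the definition of p₁ into a product without denominators, the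
form in which it is differentiated. -/
theorem RegularFamily.p₁_eq (h : RegularFamily κ x z) :
    (fun w => ((x w).darboux κ).p₁) =ᶠ[𝓝 z] fun w => (x w).lam 2 * (x w).mu 4 := by
  filter_upwards [h.isNormalForm] with w hw
  have h1 : (x w).lam 0 * (x w).mu 0 + (x w).mu 0 * (x w).mu 4 - κ.θ₂ - κ.ρ₂ = 0 :=
    ((isNormalForm_iff _ _).1 hw.1).core_e₁
  have h2 : (x w).mu 0 ≠ 0 := hw.2.1
  show -((x w).lam 2 * ((x w).lam 0 - (κ.θ₂ + κ.ρ₂) / (x w).mu 0)) = _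
  field_simp
  linear_combination -(x w).lam 2 * h1

theorem RegularFamily.p₁_diff (hκ : κ.IsAdmissible) (h : RegularFamily κ x z) :
    DifferentiableAt ℂ (fun w => ((x w).darboux κ).p₁) z :=
  ((h.lam_diff hκ 2).mul (h.mu_diff hκ 4)).congr_of_eventuallyEq h.p₁_eq

/-- The derivatives of the relations between `λ, μ`, and of the definitions of `q₁, p₁`. -/
theorem RegularFamily.fderiv_constraints (hκ : κ.IsAdmissible) (h : RegularFamily κ x z) (v : E) :
    let l (j : Fin 5) := (x z).lam j
    let m (j : Fin 5) := (x z).mu j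
    let dl (j : Fin 5) := fderiv ℂ (fun w => (x w).lam j) z v
    let dm (j : Fin 5) := fderiv ℂ (fun w => (x w).mu j) z v
    let dq := fderiv ℂ (fun w => ((x w).darboux κ).q₁) z v
    let dp := fderiv ℂ (fun w => ((x w).darboux κ).p₁) z v
    dl 0 * m 0 + l 0 * dm 0 + (dm 0 * m 4 + m 0 * dm 4) = 0 ∧
    dl 0 * m 0 + l 0 * dm 0 - (dl 2 * m 2 + l 2 * dm 2) - (dl 4 * m 4 + l 4 * dm 4) = 0 ∧
    dq * l 2 + (m 0 + l 4) / l 2 * dl 2 = dm 0 + dl 4 ∧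
    dp = dl 2 * m 4 + l 2 * dm 4 := by
  have hl := h.lam_diff hκ
  have hm := h.mu_diff hκ
  have hr : ∀ᶠ w in 𝓝 z, (x w).Relations κ :=
    h.isNormalForm.mono fun w hw => (isNormalForm_iff _ _).1 hw.1
  refine ⟨?_, ?_, ?_, ?_⟩
  · rw [← fderiv_mul_apply (hl 0) (hm 0), ← fderiv_mul_apply (hm 0) (hm 4),
      ← fderiv_add_apply ((hl 0).fun_mul (hm 0)) ((hm 0).fun_mul (hm 4))]
    rw [fderiv_apply_congr (g := fun _ => κ.θ₂ + κ.ρ₂)]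
    · simp
    · filter_upwards [hr] with w hw
      have : (x w).lam 0 * (x w).mu 0 + (x w).mu 0 * (x w).mu 4 - κ.θ₂ - κ.ρ₂ = 0 := hw.core_e₁
      linear_combination this
  · rw [← fderiv_mul_apply (hl 0) (hm 0), ← fderiv_mul_apply (hl 2) (hm 2),
      ← fderiv_mul_apply (hl 4) (hm 4),
      ← fderiv_sub_apply ((hl 0).fun_mul (hm 0)) ((hl 2).fun_mul (hm 2)),
      ← fderiv_sub_apply (((hl 0).fun_mul (hm 0)).fun_sub ((hl 2).fun_mul (hm 2)))
        ((hl 4).fun_mul (hm 4))]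
    rw [fderiv_apply_congr (g := fun _ => κ.θ₁ + κ.θ₂ + 2 * κ.ρ₂)]
    · simp
    · filter_upwards [hr] with w hw
      have : (x w).lam 0 * (x w).mu 0 - (x w).lam 2 * (x w).mu 2 - (x w).lam 4 * (x w).mu 4
        - κ.θ₁ - κ.θ₂ - 2 * κ.ρ₂ = 0 := hw.core_e₂
      linear_combination this
  · have h1 := fderiv_mul_apply (v := v) (h.q₁_diff hκ) (hl 2)
    rw [← fderiv_add_apply (hm 0) (hl 4)]
    refine h1.symm.trans (fderiv_apply_congr ?_)
    filter_upwards [h.isNormalForm] with w hw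
    exact div_mul_cancel₀ _ (neg_ne_zero.2 hw.2.2.2)
  · rw [← fderiv_mul_apply (hl 2) (hm 4)]
    exact fderiv_apply_congr h.p₁_eq

/-- The canonicity of the elimination of two pairs of variables, as an identity between tangent
vectors. -/
theorem elimination_identity {l m dl dm el em : Fin 5 → ℂ} {dq dp eq ep : ℂ} (hm : m 0 ≠ 0)
    (hl : l 2 ≠ 0) (a1 : dl 0 * m 0 + l 0 * dm 0 + (dm 0 * m 4 + m 0 * dm 4) = 0)
    (a2 : dl 0 * m 0 + l 0 * dm 0 - (dl 2 * m 2 + l 2 * dm 2) - (dl 4 * m 4 + l 4 * dm 4) = 0)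
    (a3 : dq * l 2 + (m 0 + l 4) / l 2 * dl 2 = dm 0 + dl 4) (a4 : dp = dl 2 * m 4 + l 2 * dm 4)
    (b1 : el 0 * m 0 + l 0 * em 0 + (em 0 * m 4 + m 0 * em 4) = 0)
    (b2 : el 0 * m 0 + l 0 * em 0 - (el 2 * m 2 + l 2 * em 2) - (el 4 * m 4 + l 4 * em 4) = 0)
    (b3 : eq * l 2 + (m 0 + l 4) / l 2 * el 2 = em 0 + el 4)
    (b4 : ep = el 2 * m 4 + l 2 * em 4) :
    (dl 0 * em 0 - el 0 * dm 0) + (dl 2 * em 2 - el 2 * dm 2) + (dl 4 * em 4 - el 4 * dm 4) =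
      dq * ep - eq * dp := by
  obtain ⟨q, hq⟩ : ∃ q, (m 0 + l 4) / l 2 = q := ⟨_, rfl⟩
  have hq' : m 0 + l 4 = q * l 2 := by rw [← hq, div_mul_cancel₀ _ hl]
  rw [hq] at a3 b3
  -- The wedge of d(λ₁μ₁ + μ₁μ₅) = 0 with dμ₁: dλ₁ ∧ dμ₁ = dμ₁ ∧ dμ₅.
  have h0 : dl 0 * em 0 - el 0 * dm 0 = dm 0 * em 4 - em 0 * dm 4 := by
    apply mul_left_cancel₀ hm
    linear_combination em 0 * a1 - dm 0 * b1
  rw [h0, a4, b4]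
  -- The sum is now d(q₁λ₃) ∧ dμ₅ + dλ₃ ∧ dμ₃. The difference of the two constraints says that λ₃(μ₃
  -- + q₁μ₅) is constant, so dλ₃ ∧ dμ₃ = -dλ₃ ∧ d(q₁μ₅), and dq₁ ∧ d(λ₃μ₅) remains.
  apply mul_left_cancel₀ hl
  linear_combination dl 2 * (b1 - b2) - el 2 * (a1 - a2) - (el 2 * m 4 + l 2 * em 4) * a3
    + (dl 2 * m 4 + l 2 * dm 4) * b3 + (el 2 * dm 4 - dl 2 * em 4) * hq'

theorem sum_lam_mu_eq_darboux (hκ : κ.IsAdmissible) (hx : RegularFamily κ x z)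
    (hy : RegularFamily κ y z') (hxy : x z = y z') :
    ∑ j, (fderiv ℂ (fun w => (x w).lam j) z v * fderiv ℂ (fun w => (y w).mu j) z' v'
        - fderiv ℂ (fun w => (y w).lam j) z' v' * fderiv ℂ (fun w => (x w).mu j) z v) =
      (fderiv ℂ (fun w => ((x w).darboux κ).q₁) z v *
          fderiv ℂ (fun w => ((y w).darboux κ).p₁) z' v' -
        fderiv ℂ (fun w => ((y w).darboux κ).q₁) z' v' *
          fderiv ℂ (fun w => ((x w).darboux κ).p₁) z v) +
      (fderiv ℂ (fun w => (x w).lam 1) z v * fderiv ℂ (fun w => (y w).mu 1) z' v'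
        - fderiv ℂ (fun w => (y w).lam 1) z' v' * fderiv ℂ (fun w => (x w).mu 1) z v) +
      (fderiv ℂ (fun w => (x w).lam 3) z v * fderiv ℂ (fun w => (y w).mu 3) z' v'
        - fderiv ℂ (fun w => (y w).lam 3) z' v' * fderiv ℂ (fun w => (x w).mu 3) z v) := by
  obtain ⟨a1, a2, a3, a4⟩ := hx.fderiv_constraints hκ v
  obtain ⟨b1, b2, b3, b4⟩ := hy.fderiv_constraints hκ v'
  obtain ⟨hm, hl⟩ := hx.ne_zero
  rw [← hxy] at b1 b2 b3 b4
  have h := elimination_identity (l := (x z).lam) (m := (x z).mu)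
    (dl := fun j => fderiv ℂ (fun w => (x w).lam j) z v)
    (dm := fun j => fderiv ℂ (fun w => (x w).mu j) z v)
    (el := fun j => fderiv ℂ (fun w => (y w).lam j) z' v')
    (em := fun j => fderiv ℂ (fun w => (y w).mu j) z' v') hm hl a1 a2 a3 a4 b1 b2 b3 b4
  rw [Fin.sum_univ_five]
  linear_combination h

end Families

end Painleve42

/-! ### Invariance of the form under the gauge transformation -/

namespace Painleve42

open Matrix Filter Topology

/-- The entries of `D` outside the lower left block (rows `3, …, 6`, columns `1, 2`) vanish. -/
def IsLowerLeft (D : Mat6) : Prop := ∀ i j : Fin 6, i < 2 ∨ 2 ≤ j → D i j = 0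

/-- The entries of `M` in the upper right block (rows `1, 2`, columns `3, …, 6`) vanish. -/
def IsBlockLower (M : Mat6) : Prop := ∀ i j : Fin 6, i < 2 → 2 ≤ j → M i j = 0

theorem IsBlockLower.trace_mul {M D : Mat6} (hM : IsBlockLower M) (hD : IsLowerLeft D) :
    (M * D).trace = 0 := by
  refine Finset.sum_eq_zero fun i _ => ?_
  rw [Matrix.diag_apply, Matrix.mul_apply]
  refine Finset.sum_eq_zero fun j _ => ?_
  by_cases hj : j < 2
  · rw [hD j i (Or.inl hj), mul_zero]
  by_cases hi : 2 ≤ i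
  · rw [hD j i (Or.inr hi), mul_zero]
  · rw [hM i j (not_le.1 hi) (not_lt.1 hj), zero_mul]

/-- A gauge transformation that preserves the shape of `Ã_∞` is block lower triangular. -/
theorem isBlockLower_of_commutator {κ : Exponents} (hκ : κ.IsAdmissible) {x : Vars} {Ω : Mat6}
    (h : IsLowerLeft (x.residueInfinity κ * Ω - Ω * x.residueInfinity κ)) : IsBlockLower Ω := by
  have h2 := sub_ne_zero.2 hκ.ρ₁₂_ne
  have h3 := sub_ne_zero.2 hκ.ρ₁₃_ne
  have key {a b c : ℂ} (hab : a - b ≠ 0) (hc : a * c - c * b = 0) : c = 0 :=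
    (mul_eq_zero.1 (show (a - b) * c = 0 by linear_combination hc)).resolve_left hab
  intro i j hi hj
  have h := h i j (Or.inl hi)
  rw [Matrix.sub_apply, Matrix.mul_apply, Matrix.mul_apply, Fin.sum_univ_six,
    Fin.sum_univ_six] at h
  fin_cases i <;> fin_cases j <;>
    try (first | exact absurd hi (by decide) | exact absurd hj (by decide))
  all_goals
    simp [Vars.residueInfinity] at h
    first | exact key h2 h | exact key h3 h

/-- The sum of the Kirillov–Kostant forms is invariant under infinitesimal gauge transformations
that preserve the normalization of the sum of the matrices. -/
theorem sum_kks_gauge {θ : Fin 3 → ℂ} (hθ : ∀ i, θ i ≠ 0) {A D₁ D₂ : Fin 3 → Mat6} {Ω₁ Ω₂ : Mat6}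
    (hA : ∀ i, A i * A i = θ i • A i) (h₁ : ∀ i, A i * D₁ i + D₁ i * A i = θ i • D₁ i)
    (h₂ : ∀ i, A i * D₂ i + D₂ i * A i = θ i • D₂ i)
    (hΩ : ∑ i, (D₂ i + (Ω₂ * A i - A i * Ω₂)) = 0) (hD : (Ω₂ * ∑ i, D₁ i).trace = 0) :
    ∑ i, kks (θ i) (A i) (D₁ i + (Ω₁ * A i - A i * Ω₁)) (D₂ i + (Ω₂ * A i - A i * Ω₂)) =
      ∑ i, kks (θ i) (A i) (D₁ i) (D₂ i) := by
  have h (i : Fin 3) :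
      kks (θ i) (A i) (D₁ i + (Ω₁ * A i - A i * Ω₁)) (D₂ i + (Ω₂ * A i - A i * Ω₂)) =
        kks (θ i) (A i) (D₁ i) (D₂ i) - (Ω₂ * D₁ i).trace
          + (Ω₁ * (D₂ i + (Ω₂ * A i - A i * Ω₂))).trace := by
    -- The whole second argument is tangent, so [Ω₁, A_i] can be paired with it in one piece; the
    -- sum over i of these second arguments vanishes, which disposes of all terms with Ω₁ together.
    have ht : A i * (D₂ i + (Ω₂ * A i - A i * Ω₂)) + (D₂ i + (Ω₂ * A i - A i * Ω₂)) * A i =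
        θ i • (D₂ i + (Ω₂ * A i - A i * Ω₂)) := by
      have e : A i * (D₂ i + (Ω₂ * A i - A i * Ω₂)) + (D₂ i + (Ω₂ * A i - A i * Ω₂)) * A i =
          (A i * D₂ i + D₂ i * A i) + (Ω₂ * (A i * A i) - (A i * A i) * Ω₂) := by noncomm_ring
      rw [e, h₂, hA, Matrix.mul_smul, Matrix.smul_mul, ← smul_sub, ← smul_add]
    rw [kks_add_left, kks_commutator (hθ i) (hA i) ht, kks_add_right,
      kks_neg_swap _ _ (D₁ i) (Ω₂ * A i - A i * Ω₂), kks_commutator (hθ i) (hA i) (h₁ i),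
      ← sub_eq_add_neg]
  rw [Finset.sum_congr rfl fun i _ => h i, Finset.sum_add_distrib, Finset.sum_sub_distrib,
    ← Matrix.trace_sum, ← Matrix.trace_sum, ← Finset.mul_sum, ← Finset.mul_sum, hΩ, hD,
    Matrix.mul_zero, Matrix.trace_zero, sub_zero, add_zero]

section Families

variable {E : Type*} [NormedAddCommGroup E] [NormedSpace ℂ E] {z v : E}
variable {κ : Exponents} {x : E → Vars} {A : E → Fin 3 → Mat6} {P : E → Mat6}

theorem RegularFamily.sum_entryDeriv (h : RegularFamily κ x z) (v : E) :
    ∑ i, entryDeriv (fun w => (x w).residues κ i) z v =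
      -entryDeriv (fun w => (x w).residueInfinity κ) z v := by
  have h1 : (fun w => (x w).residues κ 0 + (x w).residues κ 1 + (x w).residues κ 2) =ᶠ[𝓝 z]
      fun w => -(x w).residueInfinity κ := by
    filter_upwards [h.isNormalForm] with w hw
    rw [← hw.1, neg_neg, Fin.sum_univ_three]
  rw [Fin.sum_univ_three, ← entryDeriv_add (h.diff 0) (h.diff 1),
    ← entryDeriv_add ((h.diff 0).add (h.diff 1)) (h.diff 2), entryDeriv_congr h1, entryDeriv_neg]

theorem isLowerLeft_entryDeriv (κ : Exponents) (x : E → Vars) (z v : E) :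
    IsLowerLeft (entryDeriv (fun w => (x w).residueInfinity κ) z v) := by
  intro i j hij
  have h : ∃ c : ℂ, ∀ w, (x w).residueInfinity κ i j = c := by
    fin_cases i <;> fin_cases j <;>
    first
    | exact absurd hij (by decide)
    | exact ⟨_, fun _ => rfl⟩
  obtain ⟨c, hc⟩ := h
  simp [entryDeriv, hc]

/-- The derivative of Ã_i² = θ_iÃ_i. -/
theorem RegularFamily.tangent (h : RegularFamily κ x z) (v : E) (i : Fin 3) :
    (x z).residues κ i * entryDeriv (fun w => (x w).residues κ i) z v +
      entryDeriv (fun w => (x w).residues κ i) z v * (x z).residues κ i =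
      κ.θ i • entryDeriv (fun w => (x w).residues κ i) z v := by
  rw [← entryDeriv_const_smul _ (h.diff i), add_comm, ← entryDeriv_mul (h.diff i) (h.diff i)]
  simp only [residues_mul_self]

theorem regularFamily_of_isNormalization (hA : ∀ i, EntriesDiff (fun w => A w i) z)
    (hP : EntriesDiff P z) (h : ∀ᶠ w in 𝓝 z, IsNormalization κ (A w) (P w) (x w)) :
    RegularFamily κ x z := by
  refine ⟨h.mono fun w hw => hw.2.2, fun i => ?_⟩
  refine (((hP.inv h.self_of_nhds.1).mul (hA i)).mul hP).congr ?_
  exact h.mono fun w hw => (hw.2.1 i).symm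

/-- Differentiating PÃ_i = A_iP rather than Ã_i = P⁻¹A_iP avoids the derivative of the inverse. -/
theorem entryDeriv_residues_of_isNormalization (hA : ∀ i, EntriesDiff (fun w => A w i) z)
    (hP : EntriesDiff P z) (h : ∀ᶠ w in 𝓝 z, IsNormalization κ (A w) (P w) (x w)) (v : E)
    (i : Fin 3) :
    (P z)⁻¹ * entryDeriv (fun w => A w i) z v * P z =
      entryDeriv (fun w => (x w).residues κ i) z v +
        ((P z)⁻¹ * entryDeriv P z v * (x z).residues κ i -
          (x z).residues κ i * ((P z)⁻¹ * entryDeriv P z v)) := by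
  have hx := regularFamily_of_isNormalization hA hP h
  have h1 : (fun w => P w * (x w).residues κ i) =ᶠ[𝓝 z] fun w => A w i * P w := by
    filter_upwards [h] with w hw
    rw [← hw.2.1 i, ← Matrix.mul_assoc, ← Matrix.mul_assoc, Matrix.mul_nonsing_inv _ hw.1,
      Matrix.one_mul]
  have h2 := entryDeriv_congr (v := v) h1
  rw [entryDeriv_mul hP (hx.diff i), entryDeriv_mul (hA i) hP] at h2
  obtain ⟨hdet, hi, -⟩ := h.self_of_nhds
  have h3 := congrArg ((P z)⁻¹ * ·) h2
  simp only [Matrix.mul_add] at h3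
  have e1 : (P z)⁻¹ * (P z * entryDeriv (fun w => (x w).residues κ i) z v) =
      entryDeriv (fun w => (x w).residues κ i) z v := by
    rw [← Matrix.mul_assoc, Matrix.nonsing_inv_mul _ hdet, Matrix.one_mul]
  have e2 : (P z)⁻¹ * (A z i * entryDeriv P z v) =
      (x z).residues κ i * ((P z)⁻¹ * entryDeriv P z v) := by
    rw [← hi i, Matrix.mul_assoc _ (P z), ← Matrix.mul_assoc (P z), Matrix.mul_nonsing_inv _ hdet,
      Matrix.one_mul, Matrix.mul_assoc]
  rw [e1, e2, ← Matrix.mul_assoc, ← Matrix.mul_assoc] at h3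
  rw [← add_sub_assoc, eq_sub_iff_add_eq, ← h3, add_comm]

/-- The logarithmic derivative of the gauge transformation is block lower triangular. -/
theorem isBlockLower_gauge (hκ : κ.IsAdmissible) (hA : ∀ i, EntriesDiff (fun w => A w i) z)
    (hP : EntriesDiff P z) (h : ∀ᶠ w in 𝓝 z, IsNormalization κ (A w) (P w) (x w)) (v : E)
    (hsum : ∑ i, entryDeriv (fun w => A w i) z v = 0) :
    IsBlockLower ((P z)⁻¹ * entryDeriv P z v) := by
  have hx := regularFamily_of_isNormalization hA hP h
  have h1 : ∑ i, (P z)⁻¹ * entryDeriv (fun w => A w i) z v * P z = 0 := by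
    rw [← Finset.sum_mul, ← Finset.mul_sum, hsum, Matrix.mul_zero, Matrix.zero_mul]
  have hS : ∑ i, (x z).residues κ i = -(x z).residueInfinity κ := by
    rw [← hx.isNormalForm.self_of_nhds.1, neg_neg]
  rw [Finset.sum_congr rfl fun i _ => entryDeriv_residues_of_isNormalization hA hP h v i,
    Finset.sum_add_distrib, hx.sum_entryDeriv, Finset.sum_sub_distrib, ← Finset.mul_sum,
    ← Finset.sum_mul, hS, Matrix.mul_neg, Matrix.neg_mul] at h1
  refine isBlockLower_of_commutator hκ (x := x z) ?_
  have h2 := isLowerLeft_entryDeriv κ x z v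
  convert h2 using 1
  rw [← sub_eq_zero, ← h1]
  abel

/-- The Kirillov–Kostant form in normal form. -/
theorem sum_kks_normalForm (hκ : κ.IsAdmissible) (hA : ∀ i, EntriesDiff (fun w => A w i) z)
    (hP : EntriesDiff P z) (h : ∀ᶠ w in 𝓝 z, IsNormalization κ (A w) (P w) (x w))
    (hsum : ∀ v, ∑ i, entryDeriv (fun w => A w i) z v = 0) (v v' : E) :
    ∑ i, kks (κ.θ i) (A z i) (entryDeriv (fun w => A w i) z v) (entryDeriv (fun w => A w i) z v') =
      ∑ i, kks (κ.θ i) ((x z).residues κ i) (entryDeriv (fun w => (x w).residues κ i) z v)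
        (entryDeriv (fun w => (x w).residues κ i) z v') := by
  have hx := regularFamily_of_isNormalization hA hP h
  have hd := entryDeriv_residues_of_isNormalization hA hP h
  rw [← sum_kks_gauge (Ω₁ := (P z)⁻¹ * entryDeriv P z v) (Ω₂ := (P z)⁻¹ * entryDeriv P z v')
    hκ.θ_ne (residues_mul_self κ (x z)) (hx.tangent v) (hx.tangent v')]
  · refine Finset.sum_congr rfl fun i _ => ?_
    rw [← hd, ← hd, ← h.self_of_nhds.2.1 i, kks_conj _ _ _ _ _ h.self_of_nhds.1]
  · rw [Finset.sum_congr rfl fun i _ => (hd v' i).symm, ← Finset.sum_mul, ← Finset.mul_sum, hsum,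
      Matrix.mul_zero, Matrix.zero_mul]
  · rw [hx.sum_entryDeriv, Matrix.mul_neg, Matrix.trace_neg,
      (isBlockLower_gauge hκ hA hP h v' (hsum v')).trace_mul (isLowerLeft_entryDeriv κ x z v),
      neg_zero]

end Families

end Painleve42

/-! ### Rank factorizations and the form ∑ tr(dBᵢ ∧ dCᵢ) -/

namespace Painleve42

open Matrix Filter Topology

theorem residueEigenvalues_apply (κ : Exponents) (i : Fin 3) (j : Fin 6) :
    κ.residueEigenvalues i j = if (j : ℕ) < rk i then κ.θ i else 0 := by
  fin_cases i <;> fin_cases j <;> rfl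

/-- A rank factorization `A = B C` of a diagonalizable matrix with eigenvalues `θ` (`r` times) and
`0`, where `r` is the inner dimension, satisfies `C B = θ`. -/
theorem mul_eq_smul_one_of_diagonalizable {r : ℕ} (hr : r ≤ 6) {θ : ℂ} (hθ : θ ≠ 0)
    {B : Matrix (Fin 6) (Fin r) ℂ} {C : Matrix (Fin r) (Fin 6) ℂ}
    (h : IsDiagonalizableTo (B * C) fun j => if (j : ℕ) < r then θ else 0) : C * B = θ • 1 := by
  obtain ⟨S, hS, hBC⟩ := h
  set D : Mat6 := diagonal fun j => if (j : ℕ) < r then θ else 0 with hD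
  let F : Matrix (Fin 6) (Fin r) ℂ := (1 : Mat6).submatrix id (Fin.castLE hr)
  have hF : Fᵀ * F = 1 := by
    show ((1 : Mat6).submatrix id _)ᵀ * (1 : Mat6).submatrix id _ = 1
    rw [Matrix.transpose_submatrix, Matrix.transpose_one,
      ← Matrix.submatrix_mul _ _ _ id _ Function.bijective_id, Matrix.mul_one,
      Matrix.submatrix_one _ (Fin.castLE_injective hr)]
  have hDF : D * F = θ • F := by
    ext i j
    by_cases hij : i = Fin.castLE hr j
    · subst hij
      simp [F, hD]
    · simp [F, hD, hij]
  have hDD : D * D = θ • D := by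
    rw [hD, diagonal_mul_diagonal, ← diagonal_smul]
    congr 1
    ext j
    by_cases hj : (j : ℕ) < r <;> simp [hj]
  have hSD : S⁻¹ * (B * C) * S = D := by
    rw [hBC, Matrix.mul_assoc, Matrix.nonsing_inv_mul_cancel_right _ _ hS, ← Matrix.mul_assoc,
      Matrix.nonsing_inv_mul _ hS, Matrix.one_mul]
  have h2 : B * C * (B * C) = θ • (B * C) := by
    have : S * D * S⁻¹ * (S * D * S⁻¹) = S * (D * D) * S⁻¹ := by
      rw [← Matrix.mul_assoc, ← Matrix.mul_assoc, Matrix.nonsing_inv_mul_cancel_right _ _ hS,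
        Matrix.mul_assoc S]
    rw [hBC, this, hDD, Matrix.mul_smul, Matrix.smul_mul]
  -- X and Y are r × r with XY = θ, hence both invertible. Sandwiched between them, CB - θ becomes a
  -- compression of A² - θA = 0 for A = BC.
  let X := Fᵀ * S⁻¹ * B
  let Y := C * S * F
  have hXY : X * Y = θ • 1 := by
    have : X * Y = Fᵀ * (S⁻¹ * (B * C) * S) * F := by
      simp only [X, Y, Matrix.mul_assoc]
    rw [this, hSD, Matrix.mul_assoc, hDF, Matrix.mul_smul, hF]
  have hYX : Y * X = θ • 1 := by
    have h1 : (θ⁻¹ • X) * Y = 1 := by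
      rw [Matrix.smul_mul, hXY, smul_smul, inv_mul_cancel₀ hθ, one_smul]
    have h3 := mul_eq_one_comm.1 h1
    rw [Matrix.mul_smul] at h3
    rw [← h3, smul_smul, mul_inv_cancel₀ hθ, one_smul]
  have h3 : X * (C * B - θ • 1) * Y = 0 := by
    have : X * (C * B - θ • 1) * Y = Fᵀ * S⁻¹ * (B * C * (B * C) - θ • (B * C)) * S * F := by
      simp only [X, Y, Matrix.mul_sub, Matrix.sub_mul, Matrix.mul_smul, Matrix.smul_mul,
        Matrix.mul_one, Matrix.mul_assoc]
    rw [this, h2, sub_self, Matrix.mul_zero, Matrix.zero_mul, Matrix.zero_mul]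
  have h4 : (θ * θ) • (C * B - θ • 1) = 0 := by
    have : Y * (X * (C * B - θ • 1) * Y) * X = (θ * θ) • (C * B - θ • 1) := by
      have e : Y * (X * (C * B - θ • 1) * Y) * X = Y * X * (C * B - θ • 1) * (Y * X) := by
        simp only [Matrix.mul_assoc]
      rw [e, hYX, Matrix.smul_mul, Matrix.one_mul, Matrix.mul_smul, Matrix.mul_one, smul_smul]
    rw [← this, h3, Matrix.mul_zero, Matrix.zero_mul]
  exact sub_eq_zero.1 ((smul_eq_zero.1 h4).resolve_left (mul_ne_zero hθ hθ))

variable {κ : Exponents} {W : Set (ℂ × ℂ)}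
  {B : (i : Fin 3) → ℂ × ℂ → Matrix (Fin 6) (Fin (rk i)) ℂ}
  {C : (i : Fin 3) → ℂ × ℂ → Matrix (Fin (rk i)) (Fin 6) ℂ} {z : ℂ × ℂ}

theorem rk_le (i : Fin 3) : rk i ≤ 6 := by
  fin_cases i <;> decide

theorem wedge_sum_eq {r : ℕ} (B : ℂ × ℂ → Matrix (Fin 6) (Fin r) ℂ)
    (C : ℂ × ℂ → Matrix (Fin r) (Fin 6) ℂ) (z : ℂ × ℂ) :
    ∑ k, ∑ l, wedge (fun w => B w k l) (fun w => C w l k) z =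
      (entryDeriv B z (1, 0) * entryDeriv C z (0, 1)).trace -
        (entryDeriv B z (0, 1) * entryDeriv C z (1, 0)).trace := by
  simp only [Matrix.trace, Matrix.diag_apply, Matrix.mul_apply, ← Finset.sum_sub_distrib]
  rfl

/-- Diagonalizability forces C_iB_i = θ_i along the whole family, and the derivative of this
identity is what `kks_factor` asks for. -/
theorem symplecticForm_eq_sum_kks (hκ : κ.IsAdmissible) (hB : ∀ i, EntriesDiff (B i) z)
    (hC : ∀ i, EntriesDiff (C i) z)
    (h : ∀ᶠ w in 𝓝 z, (fun i => B i w * C i w) ∈ fuchsianSystems κ) :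
    symplecticForm B C z =
      ∑ i, kks (κ.θ i) (B i z * C i z) (entryDeriv (fun w => B i w * C i w) z (1, 0))
        (entryDeriv (fun w => B i w * C i w) z (0, 1)) := by
  refine Finset.sum_congr rfl fun i _ => ?_
  have hCB : ∀ᶠ w in 𝓝 z, C i w * B i w = κ.θ i • 1 := by
    filter_upwards [h] with w hw
    refine mul_eq_smul_one_of_diagonalizable (rk_le i) (hκ.θ_ne i) ?_
    have h1 := hw.1 i
    rwa [funext (residueEigenvalues_apply κ i)] at h1
  have hd (v : ℂ × ℂ) : entryDeriv (C i) z v * B i z + C i z * entryDeriv (B i) z v = 0 := by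
    rw [← entryDeriv_mul (hC i) (hB i), entryDeriv_congr hCB, entryDeriv_const]
  rw [wedge_sum_eq, entryDeriv_mul (hB i) (hC i), entryDeriv_mul (hB i) (hC i),
    kks_factor (hκ.θ_ne i) hCB.self_of_nhds (hd _) (hd _)]

theorem sum_entryDeriv_fuchsianSystems {E : Type*} [NormedAddCommGroup E] [NormedSpace ℂ E] {z : E}
    {A : E → Fin 3 → Mat6} (hA : ∀ i, EntriesDiff (fun w => A w i) z)
    (h : ∀ᶠ w in 𝓝 z, A w ∈ fuchsianSystems κ) (v : E) :
    ∑ i, entryDeriv (fun w => A w i) z v = 0 := by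
  have h1 : (fun w => A w 0 + A w 1 + A w 2) =ᶠ[𝓝 z]
      fun _ => -diagonal κ.infinityEigenvalues := by
    filter_upwards [h] with w hw
    rw [← hw.2, neg_neg, Fin.sum_univ_three]
  rw [Fin.sum_univ_three, ← entryDeriv_add (hA 0) (hA 1),
    ← entryDeriv_add ((hA 0).add (hA 1)) (hA 2), entryDeriv_congr h1, entryDeriv_const]

/-- For j = 2, 3 the coordinates q_j and p_j are rescaled by inverse factors (t and 1/t, or -t and
-1/t) at fixed t; the pair q₁, p₁ is the elimination. -/
theorem wedge_q_p {t : ℂ} (ht : t ≠ 0) (hκ : κ.IsAdmissible) {x : ℂ × ℂ → Vars}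
    (hx : RegularFamily κ x z) :
    ∑ j, wedge (fun w => (x w).q t j) (fun w => (x w).p κ t j) z =
      ∑ j, wedge (fun w => (x w).lam j) (fun w => (x w).mu j) z := by
  have hl := hx.lam_diff hκ
  have hm := hx.mu_diff hκ
  have e1 (v) : fderiv ℂ (fun w => (x w).q t 1) z v = t * fderiv ℂ (fun w => (x w).lam 3) z v := by
    show fderiv ℂ (fun w => t * (x w).lam 3) z v = _
    rw [fderiv_const_mul (hl 3)]
    rfl
  have e2 (v) : fderiv ℂ (fun w => (x w).q t 2) z v =
      -(t * fderiv ℂ (fun w => (x w).lam 1) z v) := by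
    show fderiv ℂ (fun w => -(t * (x w).lam 1)) z v = _
    rw [fderiv_fun_neg, fderiv_const_mul (hl 1)]
    rfl
  have e3 (v) : fderiv ℂ (fun w => (x w).p κ t 1) z v =
      t⁻¹ * fderiv ℂ (fun w => (x w).mu 3) z v := by
    show fderiv ℂ (fun w => (x w).mu 3 / t) z v = _
    simp only [div_eq_inv_mul]
    rw [fderiv_const_mul (hm 3)]
    rfl
  have e4 (v) : fderiv ℂ (fun w => (x w).p κ t 2) z v =
      -(t⁻¹ * fderiv ℂ (fun w => (x w).mu 1) z v) := by
    show fderiv ℂ (fun w => -((x w).mu 1 / t)) z v = _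
    simp only [div_eq_inv_mul]
    rw [fderiv_fun_neg, fderiv_const_mul (hm 1)]
    rfl
  have h := sum_lam_mu_eq_darboux hκ hx hx rfl (v := (1, 0)) (v' := (0, 1))
  have e5 : ∑ j, wedge (fun w => (x w).lam j) (fun w => (x w).mu j) z = _ := h
  rw [e5, Fin.sum_univ_three]
  have e6 : wedge (fun w => (x w).q t 0) (fun w => (x w).p κ t 0) z =
      wedge (fun w => ((x w).darboux κ).q₁) (fun w => ((x w).darboux κ).p₁) z := rfl
  rw [e6]
  simp only [wedge, e1, e2, e3, e4]
  field_simp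
  ring

/-- The coordinates are canonical, at each stage of the elimination. -/
theorem symplecticForm_eq (hκ : κ.IsAdmissible) {t : ℂ} (ht : t ≠ 0) {P : ℂ × ℂ → Mat6}
    {x : ℂ × ℂ → Vars} (hB : ∀ i, EntriesDiff (B i) z) (hC : ∀ i, EntriesDiff (C i) z)
    (hP : EntriesDiff P z) (hM : ∀ᶠ w in 𝓝 z, (fun i => B i w * C i w) ∈ fuchsianSystems κ)
    (h : ∀ᶠ w in 𝓝 z, IsNormalization κ (fun i => B i w * C i w) (P w) (x w)) :
    (∀ j, DifferentiableAt ℂ (fun w => (x w).b j) z ∧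
        DifferentiableAt ℂ (fun w => (x w).c j) z) ∧
      symplecticForm B C z = ∑ j, wedge (fun w => (x w).b j) (fun w => (x w).c j) z ∧
      symplecticForm B C z = ∑ j, wedge (fun w => (x w).lam j) (fun w => (x w).mu j) z ∧
      symplecticForm B C z = ∑ j, wedge (fun w => (x w).q t j) (fun w => (x w).p κ t j) z := by
  have hA (i : Fin 3) : EntriesDiff (fun w => B i w * C i w) z := (hB i).mul (hC i)
  have hx := regularFamily_of_isNormalization (A := fun w i => B i w * C i w) hA hP h
  have h1 : symplecticForm B C z = ∑ j, wedge (fun w => (x w).b j) (fun w => (x w).c j) z := by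
    rw [symplecticForm_eq_sum_kks hκ hB hC hM]
    refine (sum_kks_normalForm (A := fun w i => B i w * C i w) hκ hA hP h
      (sum_entryDeriv_fuchsianSystems (A := fun w i => B i w * C i w) hA hM) _ _).trans ?_
    exact sum_kks_residues hκ hx hx rfl
  have h2 : ∑ j, wedge (fun w => (x w).b j) (fun w => (x w).c j) z =
      ∑ j, wedge (fun w => (x w).lam j) (fun w => (x w).mu j) z :=
    sum_b_c_eq_sum_lam_mu hκ hx hx
  refine ⟨fun j => ⟨hx.b_diff hκ j, hx.c_diff hκ j⟩, h1, h1.trans h2, ?_⟩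
  rw [wedge_q_p ht hκ hx, h1, h2]

end Painleve42

/-! ### Derivatives of polynomials; differentiability of the inverse coordinate map -/

namespace Painleve42

open Matrix Filter Topology

theorem hasDerivAt_eval {σ : Type*} [Fintype σ] [DecidableEq σ] (F : MvPolynomial σ ℂ)
    {u : ℂ → σ → ℂ} {u' : σ → ℂ} {s : ℂ} (hu : ∀ i, HasDerivAt (fun s => u s i) (u' i) s) :
    HasDerivAt (fun s => eval (u s) F) (∑ i, eval (u s) (pderiv i F) * u' i) s := by
  induction F using MvPolynomial.induction_on with
  | C a => simpa using hasDerivAt_const s a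
  | add F G hF hG =>
    simp only [map_add, add_mul, Finset.sum_add_distrib]
    exact hF.fun_add hG
  | mul_X F i hF =>
    have h := hF.fun_mul (hu i)
    simp only [map_mul, eval_X]
    refine h.congr_deriv (Eq.symm ?_)
    simp only [Derivation.leibniz, pderiv_X, smul_eq_mul, map_add, map_mul, eval_X, add_mul,
      Finset.sum_add_distrib, Finset.sum_mul]
    rw [add_comm]
    congr 1
    · exact Finset.sum_congr rfl fun j _ => by ring
    · rw [Finset.sum_eq_single i]
      · simp
      · intro j _ hj
        simp [hj]
      · simp

theorem poisson_X_inl (F : PhasePoly) (j : Fin 3) :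
    poisson F (X (Sum.inl j)) = pderiv (Sum.inr j) F := by
  rw [poisson, Finset.sum_eq_single j]
  · simp
  · intro k _ hk
    simp [hk.symm]
  · simp

theorem poisson_X_inr (F : PhasePoly) (j : Fin 3) :
    poisson F (X (Sum.inr j)) = -pderiv (Sum.inl j) F := by
  rw [poisson, Finset.sum_eq_single j]
  · simp
  · intro k _ hk
    simp [hk.symm]
  · simp

section Regularity

variable {E : Type*} [NormedAddCommGroup E] [NormedSpace ℂ E] {z : E} {κ : Exponents}

theorem differentiableAt_div {f g : E → ℂ} (hf : DifferentiableAt ℂ f z)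
    (hg : DifferentiableAt ℂ g z) (h0 : g z ≠ 0) : DifferentiableAt ℂ (fun w => f w / g w) z := by
  simp only [div_eq_mul_inv]
  exact hf.fun_mul (hg.fun_inv h0)

/-- The components of `y` are differentiable at `z`. -/
structure CoreDiff (y : E → Core) (z : E) : Prop where
  l₁ : DifferentiableAt ℂ (fun w => (y w).l₁) z
  l₂ : DifferentiableAt ℂ (fun w => (y w).l₂) z
  l₃ : DifferentiableAt ℂ (fun w => (y w).l₃) z
  l₄ : DifferentiableAt ℂ (fun w => (y w).l₄) z
  l₅ : DifferentiableAt ℂ (fun w => (y w).l₅) z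
  m₁ : DifferentiableAt ℂ (fun w => (y w).m₁) z
  m₂ : DifferentiableAt ℂ (fun w => (y w).m₂) z
  m₃ : DifferentiableAt ℂ (fun w => (y w).m₃) z
  m₄ : DifferentiableAt ℂ (fun w => (y w).m₄) z
  m₅ : DifferentiableAt ℂ (fun w => (y w).m₅) z
  b₆ : DifferentiableAt ℂ (fun w => (y w).b₆) z
  b₇ : DifferentiableAt ℂ (fun w => (y w).b₇) z

theorem CoreDiff.dependent {y : E → Core} (h : CoreDiff y z) :
    DifferentiableAt ℂ (fun w => (y w).a₁) z ∧ DifferentiableAt ℂ (fun w => (y w).a₂ κ) z ∧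
    DifferentiableAt ℂ (fun w => (y w).a₃b₁ κ) z ∧ DifferentiableAt ℂ (fun w => (y w).a₄ κ) z ∧
    DifferentiableAt ℂ (fun w => (y w).a₉ κ) z := by
  obtain ⟨h1, h2, h3, h4, h5, h6, h7, h8, h9, h10, h11, h12⟩ := h
  have ha1 : DifferentiableAt ℂ (fun w => (y w).a₁) z := by
    simp only [Core.a₁]
    fun_prop
  have ha2 : DifferentiableAt ℂ (fun w => (y w).a₂ κ) z := by
    simp only [Core.a₂]
    fun_prop
  refine ⟨ha1, ha2, ?_, ?_, ?_⟩
  · simp only [Core.a₃b₁]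
    fun_prop
  · simp only [Core.a₄]
    fun_prop
  · simp only [Core.a₉]
    fun_prop

theorem CoreDiff.factors {y : E → Core} (h : CoreDiff y z) (hm : (y z).m₁ ≠ 0) :
    EntriesDiff (fun w => ((y w).toVars κ).B₁) z ∧ EntriesDiff (fun w => ((y w).toVars κ).C₁) z ∧
    EntriesDiff (fun w => ((y w).toVars κ).B₂) z ∧
    EntriesDiff (fun w => ((y w).toVars κ).C₂) z := by
  obtain ⟨ha1, ha2, ha3, ha4, ha9⟩ := h.dependent (κ := κ)
  obtain ⟨h1, h2, h3, h4, h5, h6, h7, h8, h9, h10, h11, h12⟩ := h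
  have hc (c : ℂ) : DifferentiableAt ℂ (fun _ : E => c) z := differentiableAt_const c
  refine ⟨?_, ?_, ?_, ?_⟩ <;> intro i j <;> fin_cases i <;> fin_cases j
  -- The entries of B̃₁, C̃₁, B̃₂, C̃₂ in this order, each row by row.
  exacts [hc 0, h6, hc 0, h7, ha1, h8.fun_add h11, h9, ha2, (h10.fun_add h12).fun_add (hc 1),
    ha3.fun_mul (h6.fun_inv hm), h2.fun_neg, h4.fun_neg, (hc 1).fun_sub h1, hc 0, hc 1, ha4,
    h3.fun_neg, h5.fun_neg, h5.fun_neg.fun_sub h6, h3.fun_neg, hc 1, h9.fun_neg,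
    ((hc _).fun_add (h7.fun_mul h2)).fun_add (h8.fun_mul h3), h11, ha9,
    (h9.fun_mul h2).fun_add ((h10.fun_add (hc 1)).fun_mul h3), h12, hc 1, hc 0, hc 1, hc 0, hc 1,
    hc 0, ha4.fun_neg, h3, h5]

theorem CoreDiff.residues {y : E → Core} (h : CoreDiff y z) (hm : (y z).m₁ ≠ 0) (i : Fin 3) :
    EntriesDiff (fun w => ((y w).toVars κ).residues κ i) z := by
  obtain ⟨hB1, hC1, hB2, hC2⟩ := h.factors hm (κ := κ)
  obtain ⟨ha1, ha2, ha3, ha4, ha9⟩ := h.dependent (κ := κ)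
  obtain ⟨h1, h2, h3, h4, h5, h6, h7, h8, h9, h10, h11, h12⟩ := h
  have hc (c : ℂ) : DifferentiableAt ℂ (fun _ : E => c) z := differentiableAt_const c
  fin_cases i
  · exact EntriesDiff.blockProduct _ hB1 hC1
  · exact EntriesDiff.blockProduct _ hB2 hC2
  · simp only [Fin.reduceFinMk, residues_two_entries]
    have h12' : DifferentiableAt ℂ (fun w => 1 + (y w).b₇ - (y w).l₂ * ((y w).m₃ + (y w).b₆)
        - (y w).l₄ * ((y w).m₅ + (y w).b₇ + 1)) z := by fun_prop
    have h16' : DifferentiableAt ℂ (fun w => (y w).b₆ + ((y w).m₅ + (y w).b₇ + 1)) z := by fun_prop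
    have h13' : DifferentiableAt ℂ (fun w => -1 - (y w).a₃b₁ κ / (y w).m₁) z := by
      simp only [div_eq_mul_inv]
      exact (hc _).fun_sub (ha3.fun_mul (h6.fun_inv hm))
    intro i j
    fin_cases i <;> fin_cases j
    exacts [hc _, hc _, h12', h13', h2, (hc _).fun_add h4, hc _, hc _, h16', h1.fun_sub (hc 1),
      hc _, hc _, hc _, hc _, hc _, hc _, hc _, hc _, hc _, hc _, hc _, hc _, hc _, hc _, hc _,
      hc _, hc _, hc _, hc _, hc _, hc _, hc _, hc _, hc _, hc _, hc _]

/-- The components of `d` are differentiable at `z`. -/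
structure DarbouxDiff (d : E → Darboux) (z : E) : Prop where
  q₁ : DifferentiableAt ℂ (fun w => (d w).q₁) z
  p₁ : DifferentiableAt ℂ (fun w => (d w).p₁) z
  l₂ : DifferentiableAt ℂ (fun w => (d w).l₂) z
  m₂ : DifferentiableAt ℂ (fun w => (d w).m₂) z
  l₄ : DifferentiableAt ℂ (fun w => (d w).l₄) z
  m₄ : DifferentiableAt ℂ (fun w => (d w).m₄) z

theorem DarbouxDiff.α_β_N {d : E → Darboux} (h : DarbouxDiff d z) :
    DifferentiableAt ℂ (fun w => (d w).α κ) z ∧ DifferentiableAt ℂ (fun w => (d w).β κ) z ∧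
    DifferentiableAt ℂ (fun w => (d w).N κ) z := by
  obtain ⟨h1, h2, h3, h4, h5, h6⟩ := h
  have hg : DifferentiableAt ℂ (fun w => (d w).g κ) z := by
    simp only [Darboux.g]
    fun_prop
  have hK : DifferentiableAt ℂ (fun w => (d w).K κ) z := by
    simp only [Darboux.K]
    fun_prop
  have hα : DifferentiableAt ℂ (fun w => (d w).α κ) z := by
    simp only [Darboux.α]
    fun_prop
  have hβ : DifferentiableAt ℂ (fun w => (d w).β κ) z := by
    simp only [Darboux.β]
    fun_prop
  refine ⟨hα, hβ, ?_⟩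
  simp only [Darboux.N, Darboux.γ, Darboux.δ]
  fun_prop

theorem DarbouxDiff.coreOf {d : E → Darboux} (h : DarbouxDiff d z) {s l b₆ b₇ : E → ℂ}
    (hs : DifferentiableAt ℂ s z) (hl : DifferentiableAt ℂ l z) (hb₆ : DifferentiableAt ℂ b₆ z)
    (hb₇ : DifferentiableAt ℂ b₇ z) (hs0 : s z ≠ 0) (hl0 : l z ≠ 0) :
    CoreDiff (fun w => (d w).coreOf κ (s w) (l w) (b₆ w) (b₇ w)) z := by
  obtain ⟨h1, h2, h3, h4, h5, h6⟩ := h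
  have hc (c : ℂ) : DifferentiableAt ℂ (fun _ : E => c) z := differentiableAt_const c
  have hpl : DifferentiableAt ℂ (fun w => (d w).p₁ / l w) z := by
    simp only [div_eq_mul_inv]
    exact h2.fun_mul (hl.fun_inv hl0)
  have hg : DifferentiableAt ℂ (fun w => (d w).g κ / l w) z := by
    simp only [div_eq_mul_inv, Darboux.g]
    exact ((hc _).fun_sub (h1.fun_mul h2)).fun_mul (hl.fun_inv hl0)
  have hρ : DifferentiableAt ℂ (fun w => (κ.θ₂ + κ.ρ₂) / s w) z := by
    simp only [div_eq_mul_inv]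
    exact (hc _).fun_mul (hs.fun_inv hs0)
  exact ⟨hρ.fun_sub hpl, h3, hl, h5, (h1.fun_mul hl).fun_sub hs, hs, h4, hg, h6, hpl, hb₆, hb₇⟩

theorem CoreDiff.b₇Const {y : E → Core} (h : CoreDiff y z) :
    DifferentiableAt ℂ (fun w => (y w).b₇Const κ) z := by
  obtain ⟨ha1, ha2, ha3, ha4, ha9⟩ := h.dependent (κ := κ)
  obtain ⟨h1, h2, h3, h4, h5, h6, h7, h8, h9, h10, h11, h12⟩ := h
  simp only [Core.b₇Const]
  fun_prop

/-- The inverse coordinate map is rational, and its denominators are α, β, s, l and ρ₃ - ρ₂, none of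
which vanishes at a regular point. This provides variations of a normal form in every direction of
the (q, p)-space. -/
theorem DarbouxDiff.core (hκ : κ.IsAdmissible) {d : E → Darboux} (h : DarbouxDiff d z)
    (hd : (d z).IsRegular κ) : CoreDiff (fun w => (d w).core κ) z := by
  obtain ⟨hα, hβ, hN⟩ := h.α_β_N (κ := κ)
  have hc (c : ℂ) : DifferentiableAt ℂ (fun _ : E => c) z := differentiableAt_const c
  have hρ : κ.ρ₃ - κ.ρ₂ ≠ 0 := sub_ne_zero.2 hκ.ρ₂₃_ne.symm
  have hs : DifferentiableAt ℂ (fun w => (d w).N κ / ((d w).α κ * (κ.ρ₃ - κ.ρ₂))) z := by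
    simp only [div_eq_mul_inv]
    exact hN.fun_mul ((hα.fun_mul (hc _)).fun_inv (mul_ne_zero hd.1 hρ))
  have hl : DifferentiableAt ℂ (fun w => -((d w).N κ / ((d w).β κ * (κ.ρ₃ - κ.ρ₂)))) z := by
    simp only [div_eq_mul_inv]
    exact (hN.fun_mul ((hβ.fun_mul (hc _)).fun_inv (mul_ne_zero hd.2.1 hρ))).fun_neg
  have hs0 := Darboux.core_m₁_ne hκ hd.1 hd.2.2
  have hl0 := Darboux.core_l₃_ne hκ hd.2.1 hd.2.2
  refine h.coreOf hs hl ?_ ?_ hs0 hl0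
  · exact differentiableAt_div hα (hl.fun_mul (hc _)) (mul_ne_zero hl0 hρ)
  · simp only [div_eq_mul_inv _ (κ.ρ₃ - κ.ρ₂)]
    exact ((h.coreOf hs hl (hc 0) (hc 0) hs0 hl0).b₇Const.fun_neg).fun_mul (hc _)

end Regularity

end Painleve42

/-! ### The Schlesinger system in canonical coordinates -/

namespace Painleve42

open Matrix Filter Topology

/-- The matrices `U i` with `dA i / dt = [U i, A i]` for the Schlesinger system. -/
noncomputable def schlesingerPotential (t : ℂ) (A : Fin 3 → Mat6) : Fin 3 → Mat6 :=
  ![(t - 1)⁻¹ • A 1 + t⁻¹ • A 2, (t - 1)⁻¹ • A 0, t⁻¹ • A 0]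

theorem schlesingerField_eq (t : ℂ) (A : Fin 3 → Mat6) (i : Fin 3) :
    schlesingerField t A i =
      schlesingerPotential t A i * A i - A i * schlesingerPotential t A i := by
  fin_cases i
  · show -((t - 1)⁻¹ • ⁅A 0, A 1⁆ + t⁻¹ • ⁅A 0, A 2⁆) =
      ((t - 1)⁻¹ • A 1 + t⁻¹ • A 2) * A 0 - A 0 * ((t - 1)⁻¹ • A 1 + t⁻¹ • A 2)
    simp only [Ring.lie_def, Matrix.add_mul, Matrix.mul_add, Matrix.smul_mul, Matrix.mul_smul,
      smul_sub]
    abel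
  · show (t - 1)⁻¹ • ⁅A 0, A 1⁆ = ((t - 1)⁻¹ • A 0) * A 1 - A 1 * ((t - 1)⁻¹ • A 0)
    simp only [Ring.lie_def, Matrix.smul_mul, Matrix.mul_smul, smul_sub]
  · show t⁻¹ • ⁅A 0, A 2⁆ = (t⁻¹ • A 0) * A 2 - A 2 * (t⁻¹ • A 0)
    simp only [Ring.lie_def, Matrix.smul_mul, Matrix.mul_smul, smul_sub]

theorem schlesingerPotential_conj (t : ℂ) (A : Fin 3 → Mat6) (P : Mat6) (i : Fin 3) :
    P⁻¹ * schlesingerPotential t A i * P = schlesingerPotential t (fun i => P⁻¹ * A i * P) i := by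
  fin_cases i
  · show P⁻¹ * ((t - 1)⁻¹ • A 1 + t⁻¹ • A 2) * P =
      (t - 1)⁻¹ • (P⁻¹ * A 1 * P) + t⁻¹ • (P⁻¹ * A 2 * P)
    simp only [Matrix.add_mul, Matrix.mul_add, Matrix.smul_mul, Matrix.mul_smul]
  · show P⁻¹ * ((t - 1)⁻¹ • A 0) * P = (t - 1)⁻¹ • (P⁻¹ * A 0 * P)
    simp only [Matrix.smul_mul, Matrix.mul_smul]
  · show P⁻¹ * (t⁻¹ • A 0) * P = t⁻¹ • (P⁻¹ * A 0 * P)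
    simp only [Matrix.smul_mul, Matrix.mul_smul]

theorem schlesingerField_conj (t : ℂ) (A : Fin 3 → Mat6) {P : Mat6} (hP : IsUnit P.det)
    (i : Fin 3) :
    P⁻¹ * schlesingerField t A i * P = schlesingerField t (fun i => P⁻¹ * A i * P) i := by
  have h (X Y : Mat6) : P⁻¹ * (X * Y) * P = P⁻¹ * X * P * (P⁻¹ * Y * P) := by
    rw [← Matrix.mul_assoc (P⁻¹ * X * P), ← Matrix.mul_assoc (P⁻¹ * X * P),
      Matrix.mul_nonsing_inv_cancel_right _ _ hP, ← Matrix.mul_assoc]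
  rw [schlesingerField_eq, schlesingerField_eq, ← schlesingerPotential_conj, Matrix.mul_sub,
    Matrix.sub_mul, h, h]

section Families

variable {E : Type*} [NormedAddCommGroup E] [NormedSpace ℂ E] {z v : E}
variable {κ : Exponents} {y : E → Vars}

/-- `schlesingerPotential` is the gradient, for the trace pairing, of tr A₁A₂/(t-1) + tr A₁A₃/t. It
is also the matrix generating the flow, and this coincidence makes the Schlesinger system
Hamiltonian. -/
theorem fderiv_schlesingerHamiltonian (hy : RegularFamily κ y z) (t : ℂ) :
    fderiv ℂ (fun w => (y w).schlesingerHamiltonian κ t) z v =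
      ∑ i, (schlesingerPotential t ((y z).residues κ) i *
        entryDeriv (fun w => (y w).residues κ i) z v).trace := by
  have hd (i : Fin 3) : DifferentiableAt ℂ
      (fun w => ((y w).residues κ 0 * (y w).residues κ i).trace) z :=
    ((hy.diff 0).mul (hy.diff i)).trace
  have he (i : Fin 3) : fderiv ℂ (fun w => ((y w).residues κ 0 * (y w).residues κ i).trace) z v =
      ((y z).residues κ i * entryDeriv (fun w => (y w).residues κ 0) z v).trace +
      ((y z).residues κ 0 * entryDeriv (fun w => (y w).residues κ i) z v).trace := by
    rw [fderiv_trace ((hy.diff 0).mul (hy.diff i)), entryDeriv_mul (hy.diff 0) (hy.diff i),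
      Matrix.trace_add, Matrix.trace_mul_comm]
  have h1 : fderiv ℂ (fun w => (y w).schlesingerHamiltonian κ t) z v =
      (t - 1)⁻¹ * fderiv ℂ (fun w => ((y w).residues κ 0 * (y w).residues κ 1).trace) z v +
      t⁻¹ * fderiv ℂ (fun w => ((y w).residues κ 0 * (y w).residues κ 2).trace) z v := by
    simp only [Vars.schlesingerHamiltonian, div_eq_inv_mul]
    rw [fderiv_add_apply ((hd 1).const_mul _) ((hd 2).const_mul _), fderiv_const_mul (hd 1),
      fderiv_const_mul (hd 2)]
    rfl
  rw [h1, he, he, Fin.sum_univ_three]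
  simp only [schlesingerPotential, Matrix.cons_val, Matrix.add_mul, Matrix.smul_mul,
    Matrix.trace_add, Matrix.trace_smul, smul_eq_mul]
  ring

end Families

variable {κ : Exponents} {A : ℂ → Fin 3 → Mat6} {P : ℂ → Mat6} {x : ℂ → Vars} {t : ℂ}

/-- The deformation equation as an equation between differentials. -/
theorem sum_kks_schlesinger (hκ : κ.IsAdmissible) (hM : ∀ᶠ s in 𝓝 t, A s ∈ fuchsianSystems κ)
    (hA : ∀ i k l, HasDerivAt (fun s => A s i k l) (schlesingerField t (A t) i k l) t)
    (hP : EntriesDiff P t) (h : ∀ᶠ s in 𝓝 t, IsNormalization κ (A s) (P s) (x s))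
    {E : Type*} [NormedAddCommGroup E] [NormedSpace ℂ E] {z v : E} {y : E → Vars}
    (hy : RegularFamily κ y z) (hxy : x t = y z) :
    ∑ i, kks (κ.θ i) ((x t).residues κ i) (entryDeriv (fun s => (x s).residues κ i) t 1)
        (entryDeriv (fun w => (y w).residues κ i) z v) =
      fderiv ℂ (fun w => (y w).schlesingerHamiltonian κ t) z v := by
  have hA' (i : Fin 3) : EntriesDiff (fun s => A s i) t := fun k l => (hA i k l).differentiableAt
  have hd (i : Fin 3) : entryDeriv (fun s => A s i) t 1 = schlesingerField t (A t) i := by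
    ext k l
    exact (hA i k l).deriv
  have hN := h.self_of_nhds
  -- The flow and the motion of the gauge combine into one commutator with U_i - P⁻¹dP/dt.
  have hc (i : Fin 3) : entryDeriv (fun s => (x s).residues κ i) t 1 =
      (schlesingerPotential t ((x t).residues κ) i - (P t)⁻¹ * entryDeriv P t 1) *
        (x t).residues κ i - (x t).residues κ i *
        (schlesingerPotential t ((x t).residues κ) i - (P t)⁻¹ * entryDeriv P t 1) := by
    have h1 := entryDeriv_residues_of_isNormalization hA' hP h 1 i
    rw [hd, schlesingerField_conj _ _ hN.1, funext hN.2.1, schlesingerField_eq] at h1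
    rw [← sub_eq_iff_eq_add] at h1
    rw [← h1]
    noncomm_ring
  have hk (i : Fin 3) : kks (κ.θ i) ((x t).residues κ i)
        (entryDeriv (fun s => (x s).residues κ i) t 1)
        (entryDeriv (fun w => (y w).residues κ i) z v) =
      (schlesingerPotential t ((x t).residues κ) i *
          entryDeriv (fun w => (y w).residues κ i) z v).trace -
        ((P t)⁻¹ * entryDeriv P t 1 * entryDeriv (fun w => (y w).residues κ i) z v).trace := by
    rw [hc, kks_commutator (hκ.θ_ne i) (residues_mul_self κ _ i), Matrix.sub_mul, Matrix.trace_sub]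
    rw [hxy]
    exact hy.tangent v i
  have hΩ : IsBlockLower ((P t)⁻¹ * entryDeriv P t 1) :=
    isBlockLower_gauge hκ hA' hP h 1 (sum_entryDeriv_fuchsianSystems hA' hM 1)
  -- The gauge part does not contribute: the variations sum to -dÃ_∞, which lies in the lower left
  -- block, while P⁻¹dP/dt is block lower triangular.
  have h0 : ∑ i, ((P t)⁻¹ * entryDeriv P t 1 *
      entryDeriv (fun w => (y w).residues κ i) z v).trace = 0 := by
    rw [← Matrix.trace_sum, ← Finset.mul_sum, hy.sum_entryDeriv, Matrix.mul_neg, Matrix.trace_neg,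
      hΩ.trace_mul (isLowerLeft_entryDeriv κ y z v), neg_zero]
  rw [Finset.sum_congr rfl fun i _ => hk i, Finset.sum_sub_distrib, h0, sub_zero,
    fderiv_schlesingerHamiltonian hy, hxy]

/-- The regular normal forms near a given one, along a line in the `(q, p)`-space. -/
theorem exists_regularFamily (hκ : κ.IsAdmissible) (ht : t ≠ 0) {x₀ : Vars}
    (h : x₀.IsNormalForm κ) (hx : x₀.IsRegular) (dq dp : Fin 3 → ℂ) :
    ∃ y : ℂ → Vars, RegularFamily κ y 0 ∧ y 0 = x₀ ∧
      ∀ᶠ s in 𝓝 (0 : ℂ), (y s).q t = x₀.q t + s • dq ∧ (y s).p κ t = x₀.p κ t + s • dp := by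
  let d (s : ℂ) : Darboux := Darboux.ofQP t (x₀.q t + s • dq) (x₀.p κ t + s • dp)
  have hd0 : d 0 = x₀.darboux κ := by
    simp only [d, zero_smul, add_zero]
    exact Darboux.ofQP_q_p ht (x₀.darboux κ)
  have hd (s : ℂ) : DarbouxDiff d s := by
    constructor <;>
      simp only [d, Darboux.ofQP, Pi.add_apply, Pi.smul_apply, smul_eq_mul] <;> fun_prop
  obtain ⟨hreg, hx0⟩ := Vars.toVars_darboux hκ h hx
  rw [← hd0] at hreg
  have hev : ∀ᶠ s in 𝓝 (0 : ℂ), (d s).IsRegular κ := by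
    obtain ⟨hα, hβ, hN⟩ := (hd 0).α_β_N (κ := κ)
    exact (hα.continuousAt.eventually_ne hreg.1).and
      ((hβ.continuousAt.eventually_ne hreg.2.1).and (hN.continuousAt.eventually_ne hreg.2.2))
  refine ⟨fun s => (d s).toVars κ, ⟨?_, fun i => ?_⟩, ?_, ?_⟩
  · exact hev.mono fun s hs => ⟨(hs.toVars hκ).1, (hs.toVars hκ).2.1⟩
  · exact ((hd 0).core hκ hreg).residues (Darboux.core_m₁_ne hκ hreg.1 hreg.2.2) i
  · show (d 0).toVars κ = x₀
    rw [hd0, hx0]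
  · filter_upwards [hev] with s hs
    rw [Vars.q_eq κ, Vars.p_eq, (hs.toVars hκ).2.2]
    exact ⟨Darboux.q_ofQP ht _ _, Darboux.p_ofQP ht _ _⟩


/-- The deformation equation in the coordinates `(q, p)`. -/
theorem deformation_differential (hκ : κ.IsAdmissible) (ht : t ≠ 0) (ht' : t ≠ 1)
    (hM : ∀ᶠ s in 𝓝 t, A s ∈ fuchsianSystems κ)
    (hA : ∀ i k l, HasDerivAt (fun s => A s i k l) (schlesingerField t (A t) i k l) t)
    (hP : EntriesDiff P t) (h : ∀ᶠ s in 𝓝 t, IsNormalization κ (A s) (P s) (x s))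
    (dq dp : Fin 3 → ℂ) :
    let l (j : Fin 5) := (x t).lam j
    let m (j : Fin 5) := (x t).mu j
    let dl (j : Fin 5) := fderiv ℂ (fun s => (x s).lam j) t 1
    let dm (j : Fin 5) := fderiv ℂ (fun s => (x s).mu j) t 1
    ∑ j, (evalAt ((x t).q t) ((x t).p κ t) (pderiv (Sum.inl j) (hamiltonian κ t)) * dq j
        + evalAt ((x t).q t) ((x t).p κ t) (pderiv (Sum.inr j) (hamiltonian κ t)) * dp j) =
      t * (t - 1) * (
        (fderiv ℂ (fun s => ((x s).darboux κ).q₁) t 1 * dp 0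
          - dq 0 * fderiv ℂ (fun s => ((x s).darboux κ).p₁) t 1)
        + ((l 3 + t * dl 3) * dp 1 - dq 1 * (dm 3 / t - m 3 / t ^ 2))
        + (-(l 1 + t * dl 1) * dp 2 - dq 2 * -(dm 1 / t - m 1 / t ^ 2))) := by
  intro l m dl dm
  have hA' (i : Fin 3) : EntriesDiff (fun s => A s i) t := fun k l => (hA i k l).differentiableAt
  have hx := regularFamily_of_isNormalization hA' hP h
  obtain ⟨hx1, hx2⟩ := hx.isNormalForm.self_of_nhds
  -- An arbitrary variation (dq, dp) is realized by a curve y of normal forms through x(t); t stays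
  -- frozen along y.
  obtain ⟨y, hy, hxy, hqp⟩ := exists_regularFamily hκ ht hx1 hx2 dq dp
  -- The form on the pair (deformation, variation), computed once in coordinates and once as the
  -- differential of the Schlesinger Hamiltonian.
  have e1 := (sum_kks_residues hκ hx hy hxy.symm (v := 1) (v' := 1)).symm.trans
    (sum_kks_schlesinger hκ hM hA hP h hy hxy.symm)
  rw [sum_b_c_eq_sum_lam_mu hκ hx hy, sum_lam_mu_eq_darboux hκ hx hy hxy.symm] at e1
  have hl := hy.lam_diff hκ
  have hm := hy.mu_diff hκ
  have hq (j : Fin 3) : (fun s => (y s).q t j) =ᶠ[𝓝 0] fun s => (x t).q t j + s * dq j :=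
    hqp.mono fun s hs => congrFun hs.1 j
  have hp (j : Fin 3) : (fun s => (y s).p κ t j) =ᶠ[𝓝 0] fun s => (x t).p κ t j + s * dp j :=
    hqp.mono fun s hs => congrFun hs.2 j
  have haff (a b : ℂ) : HasDerivAt (fun s : ℂ => a + s * b) b 0 := by
    simpa using ((hasDerivAt_id (0 : ℂ)).mul_const b).const_add a
  have hfd {f : ℂ → ℂ} {f' : ℂ} (hf : HasDerivAt f f' 0) : fderiv ℂ f 0 1 = f' := hf.deriv
  have dq0 : fderiv ℂ (fun s => ((y s).darboux κ).q₁) 0 1 = dq 0 :=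
    hfd ((haff _ _).congr_of_eventuallyEq (hq 0))
  have dp0 : fderiv ℂ (fun s => ((y s).darboux κ).p₁) 0 1 = dp 0 :=
    hfd ((haff _ _).congr_of_eventuallyEq (hp 0))
  have dq1 : t * fderiv ℂ (fun s => (y s).lam 3) 0 1 = dq 1 := by
    rw [← hfd ((haff _ _).congr_of_eventuallyEq (hq 1))]
    show _ = fderiv ℂ (fun s => t * (y s).lam 3) 0 1
    rw [fderiv_const_mul (hl 3)]
    rfl
  have dq2 : -(t * fderiv ℂ (fun s => (y s).lam 1) 0 1) = dq 2 := by
    rw [← hfd ((haff _ _).congr_of_eventuallyEq (hq 2))]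
    show _ = fderiv ℂ (fun s => -(t * (y s).lam 1)) 0 1
    rw [fderiv_fun_neg, fderiv_const_mul (hl 1)]
    rfl
  have dp1 : t⁻¹ * fderiv ℂ (fun s => (y s).mu 3) 0 1 = dp 1 := by
    rw [← hfd ((haff _ _).congr_of_eventuallyEq (hp 1))]
    show _ = fderiv ℂ (fun s => (y s).mu 3 / t) 0 1
    simp only [div_eq_inv_mul]
    rw [fderiv_const_mul (hm 3)]
    rfl
  have dp2 : -(t⁻¹ * fderiv ℂ (fun s => (y s).mu 1) 0 1) = dp 2 := by
    rw [← hfd ((haff _ _).congr_of_eventuallyEq (hp 2))]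
    show _ = fderiv ℂ (fun s => -((y s).mu 1 / t)) 0 1
    simp only [div_eq_inv_mul]
    rw [fderiv_fun_neg, fderiv_const_mul (hm 1)]
    rfl
  have hHd : DifferentiableAt ℂ (fun s => (y s).schlesingerHamiltonian κ t) 0 := by
    simp only [Vars.schlesingerHamiltonian, div_eq_mul_inv]
    exact (((hy.diff 0).mul (hy.diff 1)).trace.mul_const _).add
      (((hy.diff 0).mul (hy.diff 2)).trace.mul_const _)
  have hu (i : Fin 3 ⊕ Fin 3) : HasDerivAt
      (fun s : ℂ => Sum.elim ((x t).q t + s • dq) ((x t).p κ t + s • dp) i)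
      (Sum.elim dq dp i) 0 := by
    rcases i with j | j
    · exact haff _ _
    · exact haff _ _
  have hev := hasDerivAt_eval (hamiltonian κ t) hu
  obtain ⟨k, hk⟩ : ∃ k : ℂ, ∀ x : Vars, x.IsNormalForm κ → x.IsRegular →
      t * (t - 1) * (x.schlesingerHamiltonian κ t
          + x.q t 1 * x.p κ t 1 / t + x.q t 2 * x.p κ t 2 / t)
        = evalAt (x.q t) (x.p κ t) (hamiltonian κ t) + k :=
    ⟨_, fun x h hx => schlesingerHamiltonian_eq hκ ht ht' h hx⟩
  -- The polynomial Hamiltonian differs from the Schlesinger one by λ₄μ₄ + λ₂μ₂ over t, whose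
  -- differential compensates the derivative of the explicit factors t and 1/t in q₂, q₃, p₂, p₃.
  have hE : (fun s => eval (Sum.elim ((x t).q t + s • dq) ((x t).p κ t + s • dp))
      (hamiltonian κ t)) =ᶠ[𝓝 0] fun s => t * (t - 1) * ((y s).schlesingerHamiltonian κ t
        + ((y s).lam 3 * (y s).mu 3 + (y s).lam 1 * (y s).mu 1) / t) - k := by
    filter_upwards [hqp, hy.isNormalForm] with s hs hsn
    have e := hk _ hsn.1 hsn.2
    have e' : (y s).q t 1 * (y s).p κ t 1 / t + (y s).q t 2 * (y s).p κ t 2 / t =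
        ((y s).lam 3 * (y s).mu 3 + (y s).lam 1 * (y s).mu 1) / t := by
      simp only [Vars.q, Vars.p, Matrix.cons_val]
      field_simp
    rw [add_assoc, e'] at e
    rw [← hs.1, ← hs.2, e, add_sub_cancel_right]
    rfl
  have hl' (j : Fin 5) : HasDerivAt (fun s => (y s).lam j)
      (fderiv ℂ (fun s => (y s).lam j) 0 1) 0 :=
    (hl j).hasDerivAt
  have hm' (j : Fin 5) : HasDerivAt (fun s => (y s).mu j) (fderiv ℂ (fun s => (y s).mu j) 0 1) 0 :=
    (hm j).hasDerivAt
  have hH' : HasDerivAt (fun s => (y s).schlesingerHamiltonian κ t)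
    (fderiv ℂ (fun s => (y s).schlesingerHamiltonian κ t) 0 1) 0 := hHd.hasDerivAt
  have hderiv := ((hH'.fun_add ((((hl' 3).fun_mul (hm' 3)).fun_add
      ((hl' 1).fun_mul (hm' 1))).div_const t)).const_mul (t * (t - 1))).sub_const k
  have e2 := hev.unique (hderiv.congr_of_eventuallyEq hE)
  simp only [zero_smul, add_zero, Fintype.sum_sum_type, Sum.elim_inl, Sum.elim_inr] at e2
  rw [Finset.sum_add_distrib]
  refine e2.trans ?_
  rw [← e1, ← dq1, ← dq2, ← dp1, ← dp2, dq0, dp0, hxy]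
  generalize fderiv ℂ (fun s => (y s).lam 3) 0 1 = l3
  generalize fderiv ℂ (fun s => (y s).lam 1) 0 1 = l1
  generalize fderiv ℂ (fun s => (y s).mu 3) 0 1 = m3
  generalize fderiv ℂ (fun s => (y s).mu 1) 0 1 = m1
  field_simp
  ring

/-- The deformation equation is the Hamiltonian system. -/
theorem solvesHamiltonianSystem (hκ : κ.IsAdmissible) {U : Set ℂ} (hU : IsOpen U) (h0 : (0 : ℂ) ∉ U)
    (h1 : (1 : ℂ) ∉ U) (hM : ∀ t ∈ U, A t ∈ fuchsianSystems κ) (hA : SolvesSchlesinger U A)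
    (hP : ∀ k l, DifferentiableOn ℂ (fun t => P t k l) U)
    (h : ∀ t ∈ U, IsNormalization κ (A t) (P t) (x t)) :
    SolvesHamiltonianSystem κ U (fun t => (x t).q t) (fun t => (x t).p κ t) := by
  intro t htU j
  have ht : t ≠ 0 := fun e => h0 (e ▸ htU)
  have ht' : t ≠ 1 := fun e => h1 (e ▸ htU)
  have hUt : ∀ᶠ s in 𝓝 t, s ∈ U := hU.mem_nhds htU
  have hP' : EntriesDiff P t := fun k l => (hP k l).differentiableAt (hU.mem_nhds htU)
  have hx := regularFamily_of_isNormalization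
    (fun i k l => (hA t htU i k l).differentiableAt) hP' (hUt.mono h)
  have hd := deformation_differential hκ ht ht' (hUt.mono hM) (hA t htU) hP' (hUt.mono h)
  have hl (j) : HasDerivAt (fun s => (x s).lam j) (deriv (fun s => (x s).lam j) t) t :=
    (hx.lam_diff hκ j).hasDerivAt
  have hm (j) : HasDerivAt (fun s => (x s).mu j) (deriv (fun s => (x s).mu j) t) t :=
    (hx.mu_diff hκ j).hasDerivAt
  have hq0 : HasDerivAt (fun s => (x s).q s 0) _ t := (hx.q₁_diff hκ).hasDerivAt
  have hp0 : HasDerivAt (fun s => (x s).p κ s 0) _ t := (hx.p₁_diff hκ).hasDerivAt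
  have hq1 : HasDerivAt (fun s => (x s).q s 1) _ t := (hasDerivAt_id t).fun_mul (hl 3)
  have hq2 : HasDerivAt (fun s => (x s).q s 2) _ t := ((hasDerivAt_id t).fun_mul (hl 1)).fun_neg
  have hp1 : HasDerivAt (fun s => (x s).p κ s 1) _ t := (hm 3).fun_div (hasDerivAt_id t) ht
  have hp2 : HasDerivAt (fun s => (x s).p κ s 2) _ t :=
    ((hm 1).fun_div (hasDerivAt_id t) ht).fun_neg
  simp only [poisson_X_inl, poisson_X_inr]
  -- A variation of p_j alone isolates the derivative of q_j, and a variation of q_j alone that of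
  -- p_j.
  have hq (j : Fin 3) := hd 0 (Pi.single j 1)
  have hp (j : Fin 3) := hd (Pi.single j 1) 0
  simp only [Fin.sum_univ_three] at hq hp
  have hneg (F : PhasePoly) : evalAt ((x t).q t) ((x t).p κ t) (-F) =
    -evalAt ((x t).q t) ((x t).p κ t) F := map_neg _ _
  fin_cases j
  · refine ⟨_, _, hq0, hp0, ?_, ?_⟩
    · have e := hq 0
      simp at e
      refine Eq.trans ?_ e.symm
      simp only
    · have e := hp 0
      simp at e
      rw [hneg]
      refine Eq.trans ?_ (congrArg Neg.neg e).symm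
      field_simp
  · refine ⟨_, _, hq1, hp1, ?_, ?_⟩
    · have e := hq 1
      simp at e
      refine Eq.trans ?_ e.symm
      simp only [id_eq]
      ring
    · have e := hp 1
      simp at e
      rw [hneg]
      refine Eq.trans ?_ (congrArg Neg.neg e).symm
      field_simp
      ring
  · refine ⟨_, _, hq2, hp2, ?_, ?_⟩
    · have e := hq 2
      simp at e
      refine Eq.trans ?_ e.symm
      simp only [id_eq]
      ring
    · have e := hp 2
      simp at e
      rw [hneg]
      refine Eq.trans ?_ (congrArg Neg.neg e).symm
      simp only [id_eq]
      field_simp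

end Painleve42

/-! ### Rational functions of the entries -/

namespace Painleve42

open Matrix

/-- Near `A₀`, the function `f` of a triple of matrices is a rational function of the entries. -/
def RatAt (A₀ : Fin 3 → Mat6) (f : (Fin 3 → Mat6) → ℂ) : Prop :=
  ∃ N D : MvPolynomial (Fin 3 × Fin 6 × Fin 6) ℂ, evalEntries A₀ D ≠ 0 ∧
    ∀ A, evalEntries A D ≠ 0 → f A * evalEntries A D = evalEntries A N

namespace RatAt

variable {A₀ : Fin 3 → Mat6} {f g : (Fin 3 → Mat6) → ℂ}

theorem const (A₀ : Fin 3 → Mat6) (c : ℂ) : RatAt A₀ fun _ => c :=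
  ⟨C c, 1, by simp [evalEntries], fun A _ => by simp [evalEntries]⟩

theorem entry (A₀ : Fin 3 → Mat6) (i : Fin 3) (k l : Fin 6) : RatAt A₀ fun A => A i k l :=
  ⟨X (i, k, l), 1, by simp [evalEntries], fun A _ => by simp [evalEntries]⟩

theorem evalEntries_mul (A : Fin 3 → Mat6) (F G : MvPolynomial (Fin 3 × Fin 6 × Fin 6) ℂ) :
    evalEntries A (F * G) = evalEntries A F * evalEntries A G := map_mul _ _ _

theorem evalEntries_add (A : Fin 3 → Mat6) (F G : MvPolynomial (Fin 3 × Fin 6 × Fin 6) ℂ) :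
    evalEntries A (F + G) = evalEntries A F + evalEntries A G := map_add _ _ _

theorem add (hf : RatAt A₀ f) (hg : RatAt A₀ g) : RatAt A₀ fun A => f A + g A := by
  obtain ⟨N, D, hD, h⟩ := hf
  obtain ⟨N', D', hD', h'⟩ := hg
  refine ⟨N * D' + N' * D, D * D', ?_, fun A hA => ?_⟩
  · rw [evalEntries_mul]
    exact mul_ne_zero hD hD'
  · rw [evalEntries_mul] at hA ⊢
    rw [evalEntries_add, evalEntries_mul, evalEntries_mul, ← h A (left_ne_zero_of_mul hA),
      ← h' A (right_ne_zero_of_mul hA)]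
    ring

theorem mul (hf : RatAt A₀ f) (hg : RatAt A₀ g) : RatAt A₀ fun A => f A * g A := by
  obtain ⟨N, D, hD, h⟩ := hf
  obtain ⟨N', D', hD', h'⟩ := hg
  refine ⟨N * N', D * D', ?_, fun A hA => ?_⟩
  · rw [evalEntries_mul]
    exact mul_ne_zero hD hD'
  · rw [evalEntries_mul] at hA ⊢
    rw [evalEntries_mul, ← h A (left_ne_zero_of_mul hA), ← h' A (right_ne_zero_of_mul hA)]
    ring

theorem inv (hf : RatAt A₀ f) (h0 : f A₀ ≠ 0) : RatAt A₀ fun A => (f A)⁻¹ := by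
  obtain ⟨N, D, hD, h⟩ := hf
  -- The inverse is D/N, expanded by D so that the new denominator also guarantees D ≠ 0, where f =
  -- N/D is known.
  refine ⟨D * D, D * N, ?_, fun A hA => ?_⟩
  · rw [evalEntries_mul, ← h _ hD]
    exact mul_ne_zero hD (mul_ne_zero h0 hD)
  · rw [evalEntries_mul] at hA ⊢
    have hf : f A ≠ 0 := by
      intro h2
      have h3 := h A (left_ne_zero_of_mul hA)
      rw [h2, zero_mul] at h3
      exact right_ne_zero_of_mul hA h3.symm
    rw [evalEntries_mul, ← h A (left_ne_zero_of_mul hA)]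
    field_simp

theorem neg (hf : RatAt A₀ f) : RatAt A₀ fun A => -f A := by
  simpa only [neg_one_mul] using (const A₀ (-1)).mul hf

theorem sub (hf : RatAt A₀ f) (hg : RatAt A₀ g) : RatAt A₀ fun A => f A - g A := by
  simpa only [sub_eq_add_neg] using hf.add hg.neg

theorem div (hf : RatAt A₀ f) (hg : RatAt A₀ g) (h0 : g A₀ ≠ 0) : RatAt A₀ fun A => f A / g A := by
  simpa only [div_eq_mul_inv] using hf.mul (hg.inv h0)

theorem sum {ι : Type*} (s : Finset ι) {f : ι → (Fin 3 → Mat6) → ℂ} (h : ∀ i, RatAt A₀ (f i)) :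
    RatAt A₀ fun A => ∑ i ∈ s, f i A := by
  classical
  induction s using Finset.induction_on with
  | empty => simpa using const A₀ 0
  | insert a s ha ih =>
    simp only [Finset.sum_insert ha]
    exact (h a).add ih

theorem prod {ι : Type*} (s : Finset ι) {f : ι → (Fin 3 → Mat6) → ℂ} (h : ∀ i, RatAt A₀ (f i)) :
    RatAt A₀ fun A => ∏ i ∈ s, f i A := by
  classical
  induction s using Finset.induction_on with
  | empty => simpa using const A₀ 1
  | insert a s ha ih =>
    simp only [Finset.prod_insert ha]
    exact (h a).mul ih

/-- Finitely many rational functions have a common denominator. -/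
theorem exists_common_denominator {ι : Type*} [Fintype ι] {f : ι → (Fin 3 → Mat6) → ℂ}
    (h : ∀ i, RatAt A₀ (f i)) :
    ∃ (D : MvPolynomial (Fin 3 × Fin 6 × Fin 6) ℂ)
      (N : ι → MvPolynomial (Fin 3 × Fin 6 × Fin 6) ℂ), evalEntries A₀ D ≠ 0 ∧
      ∀ A, evalEntries A D ≠ 0 → ∀ i, f i A * evalEntries A D = evalEntries A (N i) := by
  classical
  choose N D hD h using h
  have hprod (A : Fin 3 → Mat6) (s : Finset ι) :
      evalEntries A (∏ i ∈ s, D i) = ∏ i ∈ s, evalEntries A (D i) := map_prod _ _ _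
  refine ⟨∏ i, D i, fun i => N i * ∏ j ∈ Finset.univ.erase i, D j, ?_, fun A hA i => ?_⟩
  · rw [hprod]
    exact Finset.prod_ne_zero_iff.2 fun i _ => hD i
  · rw [hprod] at hA
    rw [evalEntries_mul, hprod, hprod, ← h i A (Finset.prod_ne_zero_iff.1 hA i (Finset.mem_univ i)),
      ← Finset.mul_prod_erase _ _ (Finset.mem_univ i), mul_assoc]

end RatAt

/-- Near `A₀`, the entries of the matrix function `M` are rational functions. -/
def RatMat {m n : Type*} (A₀ : Fin 3 → Mat6) (M : (Fin 3 → Mat6) → Matrix m n ℂ) : Prop :=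
  ∀ i j, RatAt A₀ fun A => M A i j

namespace RatMat

variable {m n o : Type*} {A₀ : Fin 3 → Mat6}

theorem const (A₀ : Fin 3 → Mat6) (M : Matrix m n ℂ) : RatMat A₀ fun _ => M :=
  fun i j => RatAt.const A₀ (M i j)

theorem residue (A₀ : Fin 3 → Mat6) (i : Fin 3) : RatMat A₀ fun A => A i :=
  fun k l => RatAt.entry A₀ i k l

theorem add {M N : (Fin 3 → Mat6) → Matrix m n ℂ} (hM : RatMat A₀ M) (hN : RatMat A₀ N) :
    RatMat A₀ fun A => M A + N A := fun i j => (hM i j).add (hN i j)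

theorem sub {M N : (Fin 3 → Mat6) → Matrix m n ℂ} (hM : RatMat A₀ M) (hN : RatMat A₀ N) :
    RatMat A₀ fun A => M A - N A := fun i j => (hM i j).sub (hN i j)

theorem submatrix {m' n' : Type*} {M : (Fin 3 → Mat6) → Matrix m n ℂ} (hM : RatMat A₀ M)
    (e : m' → m) (f : n' → n) : RatMat A₀ fun A => (M A).submatrix e f := fun i j => hM (e i) (f j)

variable [Fintype n]

theorem mul {M : (Fin 3 → Mat6) → Matrix m n ℂ} {N : (Fin 3 → Mat6) → Matrix n o ℂ}
    (hM : RatMat A₀ M) (hN : RatMat A₀ N) : RatMat A₀ fun A => M A * N A := fun i j => by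
  simp only [Matrix.mul_apply]
  exact RatAt.sum _ fun k => (hM i k).mul (hN k j)

theorem mulVec {M : (Fin 3 → Mat6) → Matrix m n ℂ} {v : (Fin 3 → Mat6) → n → ℂ}
    (hM : RatMat A₀ M) (hv : ∀ j, RatAt A₀ fun A => v A j) (i : m) :
    RatAt A₀ fun A => (M A *ᵥ v A) i := by
  simp only [Matrix.mulVec, dotProduct]
  exact RatAt.sum _ fun k => (hM i k).mul (hv k)

variable [DecidableEq n]

theorem det {M : (Fin 3 → Mat6) → Matrix n n ℂ} (hM : RatMat A₀ M) :
    RatAt A₀ fun A => (M A).det := by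
  simp only [Matrix.det_apply']
  exact RatAt.sum _ fun σ => (RatAt.const _ _).mul (RatAt.prod _ fun i => hM (σ i) i)

theorem adjugate {M : (Fin 3 → Mat6) → Matrix n n ℂ} (hM : RatMat A₀ M) :
    RatMat A₀ fun A => (M A).adjugate := fun i j => by
  simp only [Matrix.adjugate_apply]
  refine det fun k l => ?_
  by_cases hk : k = j
  · subst hk
    simpa using RatAt.const A₀ _
  · simpa [Matrix.updateRow_ne hk] using hM k l

theorem inv {M : (Fin 3 → Mat6) → Matrix n n ℂ} (hM : RatMat A₀ M) (h0 : (M A₀).det ≠ 0) :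
    RatMat A₀ fun A => (M A)⁻¹ := fun i j => by
  simp only [Matrix.inv_def, Ring.inverse_eq_inv', Matrix.smul_apply, smul_eq_mul]
  exact (hM.det.inv h0).mul (hM.adjugate i j)

end RatMat

end Painleve42

/-! ### Two by two blocks and the shapes of Ã₃ and Ã_∞ -/

namespace Painleve42

open Matrix

abbrev Mat2 := Matrix (Fin 2) (Fin 2) ℂ

/-- The indices of the `a`-th pair of basis vectors. -/
def pair : Fin 3 → Fin 2 → Fin 6 := ![![0, 1], ![2, 3], ![4, 5]]

noncomputable def pairEquiv : Fin 3 × Fin 2 ≃ Fin 6 :=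
  Equiv.ofBijective (fun x => pair x.1 x.2) (by decide)

theorem pairEquiv_symm_pair (a : Fin 3) (r : Fin 2) : pairEquiv.symm (pair a r) = (a, r) :=
  pairEquiv.symm_apply_apply (a, r)

theorem sum_pair {M : Type*} [AddCommMonoid M] (f : Fin 6 → M) :
    ∑ j, f j = ∑ a, ∑ r, f (pair a r) := by
  rw [← Fintype.sum_prod_type']
  exact (Equiv.sum_comp pairEquiv f).symm

/-- The `2 × 2` blocks of a `6 × 6` matrix. -/
def blk (M : Mat6) (a b : Fin 3) : Mat2 := M.submatrix (pair a) (pair b)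

theorem ext_blk {M N : Mat6} (h : ∀ a b, blk M a b = blk N a b) : M = N := by
  ext i j
  obtain ⟨⟨a, r⟩, rfl⟩ := pairEquiv.surjective i
  obtain ⟨⟨b, s⟩, rfl⟩ := pairEquiv.surjective j
  exact congrFun (congrFun (h a b) r) s

theorem blk_mul (M N : Mat6) (a b : Fin 3) : blk (M * N) a b = ∑ c, blk M a c * blk N c b := by
  ext r s
  rw [Matrix.sum_apply]
  exact sum_pair fun j => M (pair a r) j * N j (pair b s)

/-- The matrix with given `2 × 2` blocks. -/
noncomputable def ofBlocks (F : Fin 3 → Fin 3 → Mat2) : Mat6 := Matrix.of fun i j =>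
  F (pairEquiv.symm i).1 (pairEquiv.symm j).1 (pairEquiv.symm i).2 (pairEquiv.symm j).2

theorem blk_ofBlocks (F : Fin 3 → Fin 3 → Mat2) (a b : Fin 3) : blk (ofBlocks F) a b = F a b := by
  ext r s
  simp [blk, ofBlocks, pairEquiv_symm_pair]

noncomputable def blockDiag (D : Fin 3 → Mat2) : Mat6 :=
  ofBlocks fun a b => if a = b then D a else 0

theorem blk_mul_blockDiag (M : Mat6) (D : Fin 3 → Mat2) (a b : Fin 3) :
    blk (M * blockDiag D) a b = blk M a b * D b := by
  rw [blk_mul, Finset.sum_eq_single b]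
  · rw [blockDiag, blk_ofBlocks, if_pos rfl]
  · intro c _ hc
    rw [blockDiag, blk_ofBlocks, if_neg hc, Matrix.mul_zero]
  · simp

theorem blk_blockDiag_mul (M : Mat6) (D : Fin 3 → Mat2) (a b : Fin 3) :
    blk (blockDiag D * M) a b = D a * blk M a b := by
  rw [blk_mul, Finset.sum_eq_single a]
  · rw [blockDiag, blk_ofBlocks, if_pos rfl]
  · intro c _ hc
    rw [blockDiag, blk_ofBlocks, if_neg hc.symm, Matrix.zero_mul]
  · simp

theorem pair_inj (a b : Fin 3) (r s : Fin 2) : pair a r = pair b s ↔ a = b ∧ r = s := by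
  revert a b r s
  decide

theorem blk_one (a b : Fin 3) : blk 1 a b = if a = b then 1 else 0 := by
  ext r s
  by_cases h : a = b <;> simp [blk, Matrix.one_apply, pair_inj, h]

theorem blockDiag_mul_blockDiag_inv {D : Fin 3 → Mat2} (h : ∀ a, IsUnit (D a).det) :
    blockDiag D * blockDiag (fun a => (D a)⁻¹) = 1 := by
  refine ext_blk fun a b => ?_
  rw [blk_mul_blockDiag, blk_one, blockDiag, blk_ofBlocks]
  split_ifs with hab
  · subst hab
    exact Matrix.mul_nonsing_inv _ (h a)
  · rw [Matrix.zero_mul]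

theorem isUnit_det_blockDiag {D : Fin 3 → Mat2} (h : ∀ a, IsUnit (D a).det) :
    IsUnit (blockDiag D).det :=
  Matrix.isUnit_det_of_right_inverse (blockDiag_mul_blockDiag_inv h)

theorem blockDiag_inv {D : Fin 3 → Mat2} (h : ∀ a, IsUnit (D a).det) :
    (blockDiag D)⁻¹ = blockDiag fun a => (D a)⁻¹ :=
  Matrix.inv_eq_right_inv (blockDiag_mul_blockDiag_inv h)

theorem blk_conj_blockDiag {D : Fin 3 → Mat2} (h : ∀ a, IsUnit (D a).det) (M : Mat6)
    (a b : Fin 3) :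
    blk ((blockDiag D)⁻¹ * M * blockDiag D) a b = (D a)⁻¹ * blk M a b * D b := by
  rw [blk_mul_blockDiag, blockDiag_inv h, blk_blockDiag_mul]

/-- The shape of `Ã_∞`. -/
structure HasInfinityShape (κ : Exponents) (T : Mat6) : Prop where
  b₀₀ : blk T 0 0 = κ.ρ₁ • 1
  b₀₁ : blk T 0 1 = 0
  b₀₂ : blk T 0 2 = 0
  b₁₁ : blk T 1 1 = κ.ρ₂ • 1
  b₁₂ : blk T 1 2 = 0
  b₂₁ : blk T 2 1 = 0
  b₂₂ : blk T 2 2 = κ.ρ₃ • 1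

/-- The shape of `Ã₃`. -/
structure HasImageShape (κ : Exponents) (M : Mat6) : Prop where
  b₀₀ : blk M 0 0 = κ.θ₃ • 1
  b₁ : ∀ b, blk M 1 b = 0
  b₂ : ∀ b, blk M 2 b = 0

theorem conj_smul_one {D : Mat2} (h : IsUnit D.det) (c : ℂ) : D⁻¹ * c • (1 : Mat2) * D = c • 1 := by
  rw [Matrix.mul_smul, Matrix.mul_one, Matrix.smul_mul, Matrix.nonsing_inv_mul _ h]

variable {κ : Exponents}

/-- The diagonal blocks are scalar, so every block diagonal gauge preserves the shape. These gauge
transformations are the freedom left for normalizing Ã₁ and Ã₂. -/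
theorem HasInfinityShape.conj {T : Mat6} (hT : HasInfinityShape κ T) {D : Fin 3 → Mat2}
    (h : ∀ a, IsUnit (D a).det) : HasInfinityShape κ ((blockDiag D)⁻¹ * T * blockDiag D) := by
  constructor <;> rw [blk_conj_blockDiag h]
  · rw [hT.b₀₀, conj_smul_one (h 0)]
  · rw [hT.b₀₁, Matrix.mul_zero, Matrix.zero_mul]
  · rw [hT.b₀₂, Matrix.mul_zero, Matrix.zero_mul]
  · rw [hT.b₁₁, conj_smul_one (h 1)]
  · rw [hT.b₁₂, Matrix.mul_zero, Matrix.zero_mul]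
  · rw [hT.b₂₁, Matrix.mul_zero, Matrix.zero_mul]
  · rw [hT.b₂₂, conj_smul_one (h 2)]

theorem HasImageShape.conj {M : Mat6} (hM : HasImageShape κ M) {D : Fin 3 → Mat2}
    (h : ∀ a, IsUnit (D a).det) : HasImageShape κ ((blockDiag D)⁻¹ * M * blockDiag D) := by
  refine ⟨?_, fun b => ?_, fun b => ?_⟩ <;> rw [blk_conj_blockDiag h]
  · rw [hM.b₀₀, conj_smul_one (h 0)]
  · rw [hM.b₁, Matrix.mul_zero, Matrix.zero_mul]
  · rw [hM.b₂, Matrix.mul_zero, Matrix.zero_mul]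

/-- The conditions on the factors of `Ã₁, Ã₂` in a regular normal form. -/
structure FactorShape (B₁ C₁ B₂ C₂ : Matrix (Fin 3) (Fin 3) ℂ) : Prop where
  B₁_00 : B₁ 0 0 = 0
  B₁_02 : B₁ 0 2 = 0
  C₁_11 : C₁ 1 1 = 0
  C₁_12 : C₁ 1 2 = 1
  B₂_02 : B₂ 0 2 = 1
  C₂_00 : C₂ 0 0 = 1
  C₂_01 : C₂ 0 1 = 0
  C₂_02 : C₂ 0 2 = 1
  C₂_10 : C₂ 1 0 = 0
  C₂_11 : C₂ 1 1 = 1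
  C₂_12 : C₂ 1 2 = 0
  B₁_01 : B₁ 0 1 ≠ 0
  B₂_12 : B₂ 1 2 ≠ 0
  C₁_21 : C₁ 2 1 ≠ 0

theorem exists_normalForm {A : Fin 3 → Mat6} {B₁ C₁ B₂ C₂ : Matrix (Fin 3) (Fin 3) ℂ}
    (h : FactorShape B₁ C₁ B₂ C₂) (h0 : A 0 = blockProduct κ.θ₁ B₁ C₁)
    (h1 : A 1 = blockProduct κ.θ₂ B₂ C₂) (h2 : HasImageShape κ (A 2))
    (hinf : HasInfinityShape κ (-(∑ i, A i))) :
    ∃ x : Vars, (∀ i, A i = x.residues κ i) ∧ x.IsNormalForm κ ∧ x.IsRegular := by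
  set T := -(∑ i, A i) with hT
  let x : Vars :=
    { b₁ := B₁ 0 1, b₂ := B₁ 1 0, b₃ := B₁ 1 2, b₄ := B₁ 2 0, b₅ := B₁ 2 2, b₆ := B₂ 1 2
      b₇ := B₂ 2 2, c₁ := C₁ 1 0, c₂ := C₁ 0 1, c₃ := C₁ 2 1, c₄ := C₁ 0 2, c₅ := C₁ 2 2
      c₆ := C₂ 2 1, c₇ := C₂ 2 2, a₁ := B₁ 1 1, a₂ := B₁ 2 1, a₃ := C₁ 0 0, a₄ := C₁ 2 0
      a₅ := B₂ 0 0, a₆ := B₂ 0 1, a₇ := B₂ 1 0, a₈ := B₂ 1 1, a₉ := B₂ 2 0, a₁₀ := B₂ 2 1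
      a₁₁ := C₂ 2 0, a₁₂ := A 2 0 2, a₁₃ := A 2 0 3, a₁₄ := A 2 0 4, a₁₅ := A 2 0 5
      a₁₆ := A 2 1 2, a₁₇ := A 2 1 3, a₁₈ := A 2 1 4, a₁₉ := A 2 1 5
      a₂₀ := T 2 0, a₂₁ := T 2 1, a₂₂ := T 3 0, a₂₃ := T 3 1, a₂₄ := T 4 0, a₂₅ := T 4 1
      a₂₆ := T 5 0, a₂₇ := T 5 1 }
  have e1 : x.B₁ = B₁ := by
    ext i j
    fin_cases i <;> fin_cases j
    exacts [h.B₁_00.symm, rfl, h.B₁_02.symm, rfl, rfl, rfl, rfl, rfl, rfl]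
  have e2 : x.C₁ = C₁ := by
    ext i j
    fin_cases i <;> fin_cases j
    exacts [rfl, rfl, rfl, rfl, h.C₁_11.symm, h.C₁_12.symm, rfl, rfl, rfl]
  have e3 : x.B₂ = B₂ := by
    ext i j
    fin_cases i <;> fin_cases j
    exacts [rfl, rfl, h.B₂_02.symm, rfl, rfl, rfl, rfl, rfl, rfl]
  have e4 : x.C₂ = C₂ := by
    ext i j
    fin_cases i <;> fin_cases j
    exacts [h.C₂_00.symm, h.C₂_01.symm, h.C₂_02.symm, h.C₂_10.symm, h.C₂_11.symm, h.C₂_12.symm,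
      rfl, rfl, rfl]
  have e5 : A 2 = x.residues κ 2 := by
    rw [residues_two_entries]
    refine ext_blk fun a b => ?_
    fin_cases a
    · fin_cases b
      · refine h2.b₀₀.trans ?_
        ext r s
        fin_cases r <;> fin_cases s <;> simp [blk, pair]
      all_goals
        ext r s
        fin_cases r <;> fin_cases s <;> rfl
    · refine (h2.b₁ b).trans ?_
      ext r s
      fin_cases b <;> fin_cases r <;> fin_cases s <;> rfl
    · refine (h2.b₂ b).trans ?_
      ext r s
      fin_cases b <;> fin_cases r <;> fin_cases s <;> rfl
  have e6 (i : Fin 3) : A i = x.residues κ i := by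
    fin_cases i
    · show A 0 = blockProduct κ.θ₁ x.B₁ x.C₁
      rw [h0, e1, e2]
    · show A 1 = blockProduct κ.θ₂ x.B₂ x.C₂
      rw [h1, e3, e4]
    · exact e5
  refine ⟨x, e6, ?_, h.B₁_01, h.B₂_12, h.C₁_21⟩
  rw [Vars.IsNormalForm, ← funext e6, ← hT]
  refine ext_blk fun a b => ?_
  fin_cases a <;> fin_cases b
  · refine hinf.b₀₀.trans ?_
    ext r s
    fin_cases r <;> fin_cases s <;> simp [blk, pair, Vars.residueInfinity]
  · refine hinf.b₀₁.trans ?_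
    ext r s
    fin_cases r <;> fin_cases s <;> rfl
  · refine hinf.b₀₂.trans ?_
    ext r s
    fin_cases r <;> fin_cases s <;> rfl
  · ext r s
    fin_cases r <;> fin_cases s <;> rfl
  · refine hinf.b₁₁.trans ?_
    ext r s
    fin_cases r <;> fin_cases s <;> simp [blk, pair, Vars.residueInfinity]
  · refine hinf.b₁₂.trans ?_
    ext r s
    fin_cases r <;> fin_cases s <;> rfl
  · ext r s
    fin_cases r <;> fin_cases s <;> rfl
  · refine hinf.b₂₁.trans ?_
    ext r s
    fin_cases r <;> fin_cases s <;> rfl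
  · refine hinf.b₂₂.trans ?_
    ext r s
    fin_cases r <;> fin_cases s <;> simp [blk, pair, Vars.residueInfinity]

end Painleve42

/-! ### Matrices described by a basis of their image -/

namespace Painleve42

open Matrix

section Frame

def top3 (W : Matrix (Fin 6) (Fin 3) ℂ) : Matrix (Fin 3) (Fin 3) ℂ :=
  W.submatrix (Fin.castAdd 3) id

def bot3 (W : Matrix (Fin 6) (Fin 3) ℂ) : Matrix (Fin 3) (Fin 3) ℂ :=
  W.submatrix (Fin.natAdd 3) id

theorem blockProduct_top_right (θ : ℂ) (B C : Matrix (Fin 3) (Fin 3) ℂ) (i j : Fin 3) :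
    blockProduct θ B C (Fin.castAdd 3 i) (Fin.natAdd 3 j) = C i j := by
  have h1 : (finSumFinEquiv (m := 3) (n := 3)).symm (Fin.castAdd 3 i) = Sum.inl i :=
    finSumFinEquiv_symm_apply_castAdd i
  have h2 : (finSumFinEquiv (m := 3) (n := 3)).symm (Fin.natAdd 3 j) = Sum.inr j :=
    finSumFinEquiv_symm_apply_natAdd j
  rw [blockProduct, Matrix.submatrix_apply, h1, h2, fromRows_mul_fromCols]
  simp

theorem frameRows_top3_bot3 (W : Matrix (Fin 6) (Fin 3) ℂ) :
    (fromRows (top3 W) (bot3 W)).submatrix (finSumFinEquiv (m := 3) (n := 3)).symm id = W := by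
  ext i j
  obtain ⟨i, rfl⟩ := (finSumFinEquiv (m := 3) (n := 3)).surjective i
  rw [Matrix.submatrix_apply, Equiv.symm_apply_apply]
  rcases i with i | i <;> rfl

/-- A matrix of rank `3` in terms of a basis of its image. -/
theorem eq_blockProduct {θ : ℂ} {A Q : Mat6} {F : Matrix (Fin 6) (Fin 3) ℂ}
    {R : Matrix (Fin 3) (Fin 6) ℂ} {Z : Matrix (Fin 6) (Fin 3) ℂ} (hA : A = F * R)
    (hRF : R * F = θ • 1) (hQ : IsUnit Q.det) {W : Matrix (Fin 6) (Fin 3) ℂ}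
    (hW : W = Q⁻¹ * (A * Z)) (hT : IsUnit (top3 W).det) :
    ∃ C, Q⁻¹ * A * Q = blockProduct θ (bot3 W * (top3 W)⁻¹) C ∧
      W = frameRows (bot3 W * (top3 W)⁻¹) * top3 W := by
  let e := finSumFinEquiv (m := 3) (n := 3)
  set T := top3 W
  set B := bot3 W * T⁻¹ with hB
  have hBT : B * T = bot3 W := by
    rw [hB, Matrix.nonsing_inv_mul_cancel_right _ _ hT]
  have hWF : W = frameRows B * T := by
    conv_lhs => rw [← frameRows_top3_bot3 W]
    show (fromRows T (bot3 W)).submatrix _ id = _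
    have : fromRows T (bot3 W) = fromRows (1 : Matrix (Fin 3) (Fin 3) ℂ) B * T := by
      rw [fromRows_mul, Matrix.one_mul, hBT]
    rw [this, frameRows]
    exact Matrix.submatrix_mul _ _ _ id _ Function.bijective_id
  obtain ⟨S, hSd⟩ : ∃ S, S = R * Z := ⟨_, rfl⟩
  have hWS : W = Q⁻¹ * F * S := by
    rw [hW, hA]
    simp only [hSd, Matrix.mul_assoc]
  -- W = Q⁻¹FS and the upper half of W is invertible, so S is; thus the columns of W span the image
  -- of Q⁻¹AQ.
  have hS : IsUnit S.det := by
    have h1 : T = top3 (Q⁻¹ * F) * S := by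
      show top3 W = _
      rw [hWS]
      exact Matrix.submatrix_mul _ _ _ id _ Function.bijective_id
    rw [h1, Matrix.det_mul] at hT
    exact isUnit_of_mul_isUnit_right hT
  let R' := T * S⁻¹ * R * Q
  have hF : F = Q * frameRows B * T * S⁻¹ := by
    rw [Matrix.mul_assoc Q, ← hWF, hWS, ← Matrix.mul_assoc, ← Matrix.mul_assoc,
      Matrix.mul_nonsing_inv _ hQ, Matrix.one_mul, Matrix.mul_nonsing_inv_cancel_right _ _ hS]
  have hQF : Q * frameRows B = F * S * T⁻¹ := by
    rw [hF, Matrix.nonsing_inv_mul_cancel_right _ _ hS, Matrix.mul_nonsing_inv_cancel_right _ _ hT]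
  have hR' : R' * frameRows B = θ • 1 := by
    have : R' * frameRows B = T * S⁻¹ * (R * F) * S * T⁻¹ := by
      rw [show R' * frameRows B = T * S⁻¹ * R * (Q * frameRows B) by
        simp only [R', Matrix.mul_assoc], hQF]
      simp only [Matrix.mul_assoc]
    rw [this, hRF, Matrix.mul_smul, Matrix.mul_one, Matrix.smul_mul, Matrix.smul_mul,
      Matrix.nonsing_inv_mul_cancel_right _ _ hS, Matrix.mul_nonsing_inv _ hT]
  have hconj : Q⁻¹ * A * Q = frameRows B * R' := by
    rw [hA, ← Matrix.mul_assoc]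
    conv_lhs => rw [hF]
    simp only [R', ← Matrix.mul_assoc]
    rw [Matrix.nonsing_inv_mul _ hQ, Matrix.one_mul]
  let C : Matrix (Fin 3) (Fin 3) ℂ := R'.submatrix id (e ∘ Sum.inr)
  let L : Matrix (Fin 3) (Fin 3) ℂ := R'.submatrix id (e ∘ Sum.inl)
  have hLC : (fromCols L C).submatrix id e.symm = R' := by
    ext i j
    obtain ⟨j, rfl⟩ := e.surjective j
    rw [Matrix.submatrix_apply, Equiv.symm_apply_apply]
    rcases j with j | j <;> rfl
  have hL : L = θ • 1 - C * B := by
    rw [← hR', ← hLC, frameRows, submatrix_fromCols_mul_fromRows, Matrix.mul_one,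
      add_sub_cancel_right]
  refine ⟨C, ?_, hWF⟩
  rw [hconj, blockProduct_eq_frame, frameCols, ← hL, hLC]

theorem frameRows_mulVec (B : Matrix (Fin 3) (Fin 3) ℂ) (c : Fin 3 → ℂ) :
    (frameRows B *ᵥ c) 0 = c 0 ∧ (frameRows B *ᵥ c) 1 = c 1 ∧ (frameRows B *ᵥ c) 2 = c 2 ∧
    (frameRows B *ᵥ c) 3 = B 0 0 * c 0 + B 0 1 * c 1 + B 0 2 * c 2 := by
  have h (i : Fin 3) : (frameRows B *ᵥ c) (Fin.castAdd 3 i) = c i := by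
    have h1 : (finSumFinEquiv (m := 3) (n := 3)).symm (Fin.castAdd 3 i) = Sum.inl i :=
      finSumFinEquiv_symm_apply_castAdd i
    have : (frameRows B *ᵥ c) (Fin.castAdd 3 i) = ((1 : Matrix (Fin 3) (Fin 3) ℂ) *ᵥ c) i := by
      simp only [Matrix.mulVec, dotProduct, frameRows, Matrix.submatrix_apply, h1, id,
        fromRows_apply_inl]
    rw [this, Matrix.one_mulVec]
  refine ⟨h 0, h 1, h 2, ?_⟩
  have h1 : (finSumFinEquiv (m := 3) (n := 3)).symm (3 : Fin 6) = Sum.inr 0 :=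
    finSumFinEquiv_symm_apply_natAdd (m := 3) (n := 3) 0
  simp only [Matrix.mulVec, dotProduct, frameRows, Matrix.submatrix_apply, h1, id,
    fromRows_apply_inr, Fin.sum_univ_three]

end Frame

/-- The matrix with columns `a, b`. -/
def cols (a b : Fin 2 → ℂ) : Mat2 := !![a 0, b 0; a 1, b 1]

theorem mul_cols (M : Mat2) (a b : Fin 2 → ℂ) : M * cols a b = cols (M *ᵥ a) (M *ᵥ b) := by
  ext i j
  fin_cases i <;> fin_cases j <;> simp [cols, Matrix.mul_apply, Matrix.mulVec, dotProduct]

theorem cols_mulVec (a b c : Fin 2 → ℂ) : cols a b *ᵥ c = c 0 • a + c 1 • b := by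
  ext i
  fin_cases i <;> simp [cols, Matrix.mulVec, dotProduct] <;> ring

theorem inv_cols_mulVec {a b : Fin 2 → ℂ} (h : IsUnit (cols a b).det) (c : Fin 2 → ℂ) :
    (cols a b)⁻¹ *ᵥ (c 0 • a + c 1 • b) = c := by
  rw [← cols_mulVec, Matrix.mulVec_mulVec, Matrix.nonsing_inv_mul _ h, Matrix.one_mulVec]

end Painleve42

/-! ### The block diagonal gauge -/

namespace Painleve42

open Matrix

/-- The exterior product of two vectors in the plane. -/
def wedge₂ (a b : Fin 2 → ℂ) : ℂ := a 0 * b 1 - a 1 * b 0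

theorem det_cols (a b : Fin 2 → ℂ) : (cols a b).det = wedge₂ a b := by
  rw [cols, Matrix.det_fin_two_of, wedge₂]
  ring

/-- A vector in the intersection of the image of `V` with a subspace of codimension `2`. -/
def imageVec (V : Matrix (Fin 6) (Fin 3) ℂ) (i j : Fin 6) : Fin 6 → ℂ :=
  V *ᵥ (crossProduct (V i) (V j))

theorem imageVec_left (V : Matrix (Fin 6) (Fin 3) ℂ) (i j : Fin 6) : imageVec V i j i = 0 :=
  dot_self_cross (V i) (V j)

theorem imageVec_right (V : Matrix (Fin 6) (Fin 3) ℂ) (i j : Fin 6) : imageVec V i j j = 0 :=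
  dot_cross_self (V i) (V j)

/-- The constituents of the block diagonal gauge matrix, in terms of the `6 × 3` matrices `V₁, V₂`
whose columns span the images of `A₁, A₂`, and of blocks of `A₁, A₂`. -/
structure GaugeData where
  (V₁ V₂ : Matrix (Fin 6) (Fin 3) ℂ)
  (X₁ X₂ Y₂ : Mat2)

namespace GaugeData

variable (g : GaugeData)

/-- The first basis vector. It makes the image of Ã₁ contain a vector beginning with (1, 0, 0, 0),
which means that the entry (0, 0) of B̃₁ vanishes. -/
def ê₁ : Fin 2 → ℂ := imageVec g.V₁ 2 3 ∘ pair 0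

/-- A multiple of u₁ will be the third basis vector, so that the entry (0, 2) of B̃₁ vanishes. -/
def u₁ : Fin 2 → ℂ := imageVec g.V₁ 0 1 ∘ pair 1

/-- The counterpart for A₂. It will have two equal coordinates in the new basis, so that the entry
(0, 2) of B̃₂ is 1. -/
def u₂ : Fin 2 → ℂ := imageVec g.V₂ 0 1 ∘ pair 1

/-- The fourth basis vector. Y₂y = ê₁ puts 1 and 0 at the top of the first column of C̃₂. -/
noncomputable def y : Fin 2 → ℂ := g.Y₂⁻¹ *ᵥ g.ê₁

/-- With N = X₁X₂⁻¹, the identities N·adj N = det N and N + adj N = tr N give Nê₂ = -det N · ê₁ and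
Nê₁ = tr N · ê₁ + ê₂: exactly the zero and the 1 in the second row of C̃₁. -/
noncomputable def ê₂ : Fin 2 → ℂ := -((g.X₁ * g.X₂⁻¹).adjugate *ᵥ g.ê₁)

/-- The scale for which αu₁ + y is a multiple of u₂. -/
noncomputable def α : ℂ := -(wedge₂ g.y g.u₂ / wedge₂ g.u₁ g.u₂)

/-- The diagonal blocks of the gauge matrix. -/
noncomputable def D : Fin 3 → Mat2 :=
  ![cols g.ê₁ g.ê₂, cols (g.α • g.u₁) g.y, g.X₂⁻¹ * cols g.ê₂ g.ê₁]

noncomputable def Q : Mat6 := blockDiag g.D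

end GaugeData

/-- The constituents of the gauge matrix for the system `A`. -/
def gaugeData (Z₁ Z₂ : Matrix (Fin 6) (Fin 3) ℂ) (A : Fin 3 → Mat6) : GaugeData where
  V₁ := A 0 * Z₁
  V₂ := A 1 * Z₂
  X₁ := blk (A 0) 0 2
  X₂ := blk (A 1) 0 2
  Y₂ := blk (A 1) 0 1

/-- The first factor `B` of the residue matrix with image spanned by the columns of `W`. -/
noncomputable def imageFactor (W : Matrix (Fin 6) (Fin 3) ℂ) : Matrix (Fin 3) (Fin 3) ℂ :=
  bot3 W * (top3 W)⁻¹

/-- The conditions under which the block diagonal gauge matrix leads to a regular normal form. -/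
structure GaugeData.IsGeneric (g : GaugeData) (A₀ : Mat6) : Prop where
  X₂ : g.X₂.det ≠ 0
  Y₂ : g.Y₂.det ≠ 0
  u : wedge₂ g.u₁ g.u₂ ≠ 0
  D₀ : (g.D 0).det ≠ 0
  D₁ : (g.D 1).det ≠ 0
  V₁ : (top3 (g.Q⁻¹ * g.V₁)).det ≠ 0
  V₂ : (top3 (g.Q⁻¹ * g.V₂)).det ≠ 0
  b₁ : imageFactor (g.Q⁻¹ * g.V₁) 0 1 ≠ 0
  b₆ : imageFactor (g.Q⁻¹ * g.V₂) 1 2 ≠ 0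
  c₃ : (g.Q⁻¹ * A₀ * g.Q) 2 4 ≠ 0

section Stage

variable {g : GaugeData} {M : Mat6}

theorem GaugeData.IsGeneric.isUnit_det_D (h : g.IsGeneric M) (a : Fin 3) : IsUnit (g.D a).det := by
  have h0 := h.D₀
  have h2 : (g.D 2).det ≠ 0 := by
    have : (g.D 2).det = g.X₂⁻¹.det * -(g.D 0).det := by
      show (g.X₂⁻¹ * cols g.ê₂ g.ê₁).det = g.X₂⁻¹.det * -(cols g.ê₁ g.ê₂).det
      rw [Matrix.det_mul, det_cols, det_cols, wedge₂, wedge₂]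
      ring
    rw [this]
    refine mul_ne_zero ?_ (neg_ne_zero.2 h0)
    exact (Matrix.isUnit_nonsing_inv_det _ (isUnit_iff_ne_zero.2 h.X₂)).ne_zero
  fin_cases a
  exacts [isUnit_iff_ne_zero.2 h0, isUnit_iff_ne_zero.2 h.D₁, isUnit_iff_ne_zero.2 h2]

theorem GaugeData.IsGeneric.isUnit_det_Q (h : g.IsGeneric M) : IsUnit g.Q.det :=
  isUnit_det_blockDiag h.isUnit_det_D

theorem blockDiag_mulVec (D : Fin 3 → Mat2) (v : Fin 6 → ℂ) (a : Fin 3) (r : Fin 2) :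
    (blockDiag D *ᵥ v) (pair a r) = (D a *ᵥ (v ∘ pair a)) r := by
  simp only [Matrix.mulVec, dotProduct]
  rw [sum_pair, Finset.sum_eq_single a]
  · refine Finset.sum_congr rfl fun s _ => ?_
    have h := congrFun (congrFun (blk_ofBlocks (fun a b => if a = b then D a else 0) a a) r) s
    rw [if_pos rfl] at h
    exact congrArg (· * v (pair a s)) h
  · intro b _ hb
    refine Finset.sum_eq_zero fun s _ => ?_
    have h := congrFun (congrFun (blk_ofBlocks (fun a b => if a = b then D a else 0) a b) r) s
    rw [if_neg hb.symm] at h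
    exact mul_eq_zero_of_left h _
  · simp

theorem GaugeData.IsGeneric.inv_Q_mulVec (h : g.IsGeneric M) (v : Fin 6 → ℂ) (a : Fin 3)
    (c : Fin 2 → ℂ) (hc : g.D a *ᵥ c = v ∘ pair a) (r : Fin 2) :
    (g.Q⁻¹ *ᵥ v) (pair a r) = c r := by
  rw [GaugeData.Q, blockDiag_inv h.isUnit_det_D, blockDiag_mulVec, ← hc, Matrix.mulVec_mulVec,
    Matrix.nonsing_inv_mul _ (h.isUnit_det_D a), Matrix.one_mulVec]

/-- In the new basis the image consists of the vectors (c, Bc), so the fourth coordinate depends on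
the first three through the first row of B. Each known image vector then yields a condition on that
row. -/
theorem frame_relation {Q : Mat6} {V : Matrix (Fin 6) (Fin 3) ℂ} {B T : Matrix (Fin 3) (Fin 3) ℂ}
    (h : Q⁻¹ * V = frameRows B * T) (k : Fin 3 → ℂ) :
    (Q⁻¹ *ᵥ (V *ᵥ k)) 3 = B 0 0 * (Q⁻¹ *ᵥ (V *ᵥ k)) 0 + B 0 1 * (Q⁻¹ *ᵥ (V *ᵥ k)) 1
      + B 0 2 * (Q⁻¹ *ᵥ (V *ᵥ k)) 2 := by
  have h1 : Q⁻¹ *ᵥ (V *ᵥ k) = frameRows B *ᵥ (T *ᵥ k) := by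
    rw [Matrix.mulVec_mulVec, h, ← Matrix.mulVec_mulVec]
  obtain ⟨e0, e1, e2, e3⟩ := frameRows_mulVec B (T *ᵥ k)
  rw [h1, e0, e1, e2, e3]

theorem cols_mulVec_unit (a b : Fin 2 → ℂ) : cols a b *ᵥ ![1, 0] = a ∧ cols a b *ᵥ ![0, 1] = b := by
  constructor <;> rw [cols_mulVec] <;> ext i <;> simp

/-- The first factors of the residue matrices have the required shape. -/
theorem GaugeData.IsGeneric.image_shape (h : g.IsGeneric M) {B₁ T₁ B₂ T₂ : Matrix (Fin 3) (Fin 3) ℂ}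
    (h₁ : g.Q⁻¹ * g.V₁ = frameRows B₁ * T₁) (h₂ : g.Q⁻¹ * g.V₂ = frameRows B₂ * T₂) :
    B₁ 0 0 = 0 ∧ B₁ 0 2 = 0 ∧ B₂ 0 2 = 1 := by
  have hD1 : wedge₂ (g.α • g.u₁) g.y ≠ 0 := by
    rw [← det_cols]
    exact h.D₁
  have hα : g.α ≠ 0 := by
    intro h0
    rw [h0] at hD1
    simp [wedge₂] at hD1
  refine ⟨?_, ?_, ?_⟩
  · have e0 := h.inv_Q_mulVec (imageVec g.V₁ 2 3) 0 ![1, 0] (cols_mulVec_unit _ _).1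
    have e1 := h.inv_Q_mulVec (imageVec g.V₁ 2 3) 1 0 (by
      rw [Matrix.mulVec_zero]
      ext r
      fin_cases r
      · exact (imageVec_left g.V₁ 2 3).symm
      · exact (imageVec_right g.V₁ 2 3).symm)
    have e := frame_relation h₁ (crossProduct (g.V₁ 2) (g.V₁ 3))
    have f0 := e0 0
    have f1 := e0 1
    have f2 := e1 0
    have f3 := e1 1
    simp only [pair, Matrix.cons_val, imageVec, Pi.zero_apply] at f0 f1 f2 f3
    rw [f0, f1, f2, f3] at e
    linear_combination -e
  · have e0 := h.inv_Q_mulVec (imageVec g.V₁ 0 1) 0 0 (by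
      rw [Matrix.mulVec_zero]
      ext r
      fin_cases r
      · exact (imageVec_left g.V₁ 0 1).symm
      · exact (imageVec_right g.V₁ 0 1).symm)
    have e1 := h.inv_Q_mulVec (imageVec g.V₁ 0 1) 1 ![g.α⁻¹, 0] (by
      show cols (g.α • g.u₁) g.y *ᵥ _ = g.u₁
      rw [cols_mulVec]
      simp [hα])
    have e := frame_relation h₁ (crossProduct (g.V₁ 0) (g.V₁ 1))
    have f0 := e0 0
    have f1 := e0 1
    have f2 := e1 0
    have f3 := e1 1
    simp only [pair, Matrix.cons_val, imageVec, Pi.zero_apply] at f0 f1 f2 f3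
    rw [f0, f1, f2, f3] at e
    have e' : B₁ 0 2 * g.α⁻¹ = 0 := by linear_combination -e
    exact (mul_eq_zero.1 e').resolve_right (inv_ne_zero hα)
  · have hw : wedge₂ g.u₁ g.y ≠ 0 := by
      intro h0
      apply hD1
      have : wedge₂ (g.α • g.u₁) g.y = g.α * wedge₂ g.u₁ g.y := by
        simp only [wedge₂, Pi.smul_apply, smul_eq_mul]
        ring
      rw [this, h0, mul_zero]
    -- The common coordinate of u₂ with respect to αu₁ and y, by Cramer's rule.
    set c := wedge₂ g.u₁ g.u₂ / wedge₂ g.u₁ g.y with hc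
    have hc0 : c ≠ 0 := div_ne_zero h.u hw
    have hα' : g.α * wedge₂ g.u₁ g.u₂ = -wedge₂ g.y g.u₂ := by
      rw [GaugeData.α, neg_mul, div_mul_cancel₀ _ h.u]
    have hc' : c * wedge₂ g.u₁ g.y = wedge₂ g.u₁ g.u₂ := div_mul_cancel₀ _ hw
    have hu : c • (g.α • g.u₁) + c • g.y = g.u₂ := by
      ext r
      apply mul_left_cancel₀ hw
      simp only [Pi.add_apply, Pi.smul_apply, smul_eq_mul]
      have e : wedge₂ g.u₁ g.y * (c * (g.α * g.u₁ r) + c * g.y r) =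
          -wedge₂ g.y g.u₂ * g.u₁ r + wedge₂ g.u₁ g.u₂ * g.y r := by
        linear_combination (g.α * g.u₁ r + g.y r) * hc' + g.u₁ r * hα'
      rw [e]
      simp only [wedge₂]
      fin_cases r
      · simp
        ring
      · simp
        ring
    have e0 := h.inv_Q_mulVec (imageVec g.V₂ 0 1) 0 0 (by
      rw [Matrix.mulVec_zero]
      ext r
      fin_cases r
      · exact (imageVec_left g.V₂ 0 1).symm
      · exact (imageVec_right g.V₂ 0 1).symm)
    have e1 := h.inv_Q_mulVec (imageVec g.V₂ 0 1) 1 ![c, c] (by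
      show cols (g.α • g.u₁) g.y *ᵥ _ = g.u₂
      rw [cols_mulVec]
      exact hu)
    have e := frame_relation h₂ (crossProduct (g.V₂ 0) (g.V₂ 1))
    have f0 := e0 0
    have f1 := e0 1
    have f2 := e1 0
    have f3 := e1 1
    simp only [pair, Matrix.cons_val, imageVec, Pi.zero_apply] at f0 f1 f2 f3
    rw [f0, f1, f2, f3] at e
    apply mul_right_cancel₀ hc0
    linear_combination -e

/-- The upper right blocks of the residue matrices have the required shape. -/
theorem GaugeData.IsGeneric.block_shape {A : Fin 3 → Mat6} {Z₁ Z₂ : Matrix (Fin 6) (Fin 3) ℂ}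
    (hg : g = gaugeData Z₁ Z₂ A) (h : g.IsGeneric M) :
    blk (g.Q⁻¹ * A 1 * g.Q) 0 1 *ᵥ ![0, 1] = ![1, 0] ∧
    blk (g.Q⁻¹ * A 1 * g.Q) 0 2 = cols ![0, 1] ![1, 0] ∧
    ∃ c c', blk (g.Q⁻¹ * A 0 * g.Q) 0 2 = cols ![c, 0] ![c', 1] := by
  have hD0 : IsUnit (cols g.ê₁ g.ê₂).det := h.isUnit_det_D 0
  have hX : IsUnit g.X₂.det := isUnit_iff_ne_zero.2 h.X₂
  have hY : IsUnit g.Y₂.det := isUnit_iff_ne_zero.2 h.Y₂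
  have f1 : (cols g.ê₁ g.ê₂)⁻¹ *ᵥ g.ê₁ = ![1, 0] := by
    simpa using inv_cols_mulVec hD0 ![1, 0]
  have f2 : (cols g.ê₁ g.ê₂)⁻¹ *ᵥ g.ê₂ = ![0, 1] := by
    simpa using inv_cols_mulVec hD0 ![0, 1]
  have e1 : blk (A 1) 0 1 = g.Y₂ := by rw [hg]; rfl
  have e2 : blk (A 1) 0 2 = g.X₂ := by rw [hg]; rfl
  have e3 : blk (A 0) 0 2 = g.X₁ := by rw [hg]; rfl
  refine ⟨?_, ?_, ?_⟩
  · rw [GaugeData.Q, blk_conj_blockDiag h.isUnit_det_D, e1]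
    show ((cols g.ê₁ g.ê₂)⁻¹ * g.Y₂ * cols (g.α • g.u₁) g.y) *ᵥ ![0, 1] = _
    rw [← Matrix.mulVec_mulVec, (cols_mulVec_unit _ _).2, GaugeData.y, Matrix.mulVec_mulVec,
      Matrix.mul_assoc, Matrix.mul_nonsing_inv _ hY, Matrix.mul_one, f1]
  -- The third diagonal block is X₂⁻¹ times the swapped first one: X₂ cancels and the swap matrix is
  -- left.
  · rw [GaugeData.Q, blk_conj_blockDiag h.isUnit_det_D, e2]
    show (cols g.ê₁ g.ê₂)⁻¹ * g.X₂ * (g.X₂⁻¹ * cols g.ê₂ g.ê₁) = _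
    rw [← Matrix.mul_assoc, Matrix.mul_nonsing_inv_cancel_right _ _ hX, mul_cols, f1, f2]
  · rw [GaugeData.Q, blk_conj_blockDiag h.isUnit_det_D, e3]
    show ∃ c c', (cols g.ê₁ g.ê₂)⁻¹ * g.X₁ * (g.X₂⁻¹ * cols g.ê₂ g.ê₁) = _
    obtain ⟨N, hN⟩ : ∃ N, N = g.X₁ * g.X₂⁻¹ := ⟨_, rfl⟩
    have g1 : N *ᵥ g.ê₂ = -N.det • g.ê₁ := by
      rw [GaugeData.ê₂, ← hN, Matrix.mulVec_neg, Matrix.mulVec_mulVec, Matrix.mul_adjugate,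
        Matrix.smul_mulVec, Matrix.one_mulVec, neg_smul]
    have g2 : N *ᵥ g.ê₁ = N.trace • g.ê₁ + g.ê₂ := by
      rw [GaugeData.ê₂, ← hN]
      ext r
      fin_cases r <;> simp [Matrix.adjugate_fin_two, Matrix.mulVec, dotProduct, Matrix.trace] <;>
        ring
    refine ⟨-N.det, N.trace, ?_⟩
    rw [← Matrix.mul_assoc, Matrix.mul_assoc _ g.X₁, ← hN, Matrix.mul_assoc, mul_cols, g1, g2,
      mul_cols, Matrix.mulVec_add, Matrix.mulVec_smul, Matrix.mulVec_smul, f1, f2]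
    congr 1
    · simp
    · simp

/-- The block diagonal gauge matrix leads to a regular normal form. -/
theorem GaugeData.IsGeneric.exists_normalForm {κ : Exponents} {A : Fin 3 → Mat6}
    {Z₁ Z₂ : Matrix (Fin 6) (Fin 3) ℂ} (hg : g = gaugeData Z₁ Z₂ A) (h : g.IsGeneric (A 0))
    {F₁ F₂ : Matrix (Fin 6) (Fin 3) ℂ} {R₁ R₂ : Matrix (Fin 3) (Fin 6) ℂ} (hA₁ : A 0 = F₁ * R₁)
    (hR₁ : R₁ * F₁ = κ.θ₁ • 1) (hA₂ : A 1 = F₂ * R₂) (hR₂ : R₂ * F₂ = κ.θ₂ • 1)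
    (h2 : HasImageShape κ (A 2)) (hinf : HasInfinityShape κ (-(∑ i, A i))) :
    ∃ x : Vars, (∀ i, g.Q⁻¹ * A i * g.Q = x.residues κ i) ∧ x.IsNormalForm κ ∧ x.IsRegular := by
  have hQ := h.isUnit_det_Q
  obtain ⟨C₁, hC₁, hW₁⟩ := eq_blockProduct (Z := Z₁) hA₁ hR₁ hQ (W := g.Q⁻¹ * g.V₁)
    (by rw [hg]; rfl) (isUnit_iff_ne_zero.2 h.V₁)
  obtain ⟨C₂, hC₂, hW₂⟩ := eq_blockProduct (Z := Z₂) hA₂ hR₂ hQ (W := g.Q⁻¹ * g.V₂)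
    (by rw [hg]; rfl) (isUnit_iff_ne_zero.2 h.V₂)
  obtain ⟨s1, s2, s3⟩ := h.image_shape hW₁ hW₂
  obtain ⟨t1, t2, c, c', t3⟩ := h.block_shape hg
  have hC₁' (i j : Fin 3) : C₁ i j = (g.Q⁻¹ * A 0 * g.Q) (Fin.castAdd 3 i) (Fin.natAdd 3 j) := by
    rw [hC₁, blockProduct_top_right]
  have hC₂' (i j : Fin 3) : C₂ i j = (g.Q⁻¹ * A 1 * g.Q) (Fin.castAdd 3 i) (Fin.natAdd 3 j) := by
    rw [hC₂, blockProduct_top_right]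
  have t1' (r : Fin 2) : blk (g.Q⁻¹ * A 1 * g.Q) 0 1 r 1 = ![(1 : ℂ), 0] r := by
    rw [← t1]
    simp [Matrix.mulVec, dotProduct]
  have t2' (r s : Fin 2) := congrFun (congrFun t2 r) s
  have t3' (r s : Fin 2) := congrFun (congrFun t3 r) s
  have hF : FactorShape (imageFactor (g.Q⁻¹ * g.V₁)) C₁ (imageFactor (g.Q⁻¹ * g.V₂)) C₂ := by
    refine ⟨s1, s2, ?_, ?_, s3, ?_, ?_, ?_, ?_, ?_, ?_, h.b₁, h.b₆, ?_⟩
    · exact (hC₁' 1 1).trans (t3' 1 0)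
    · exact (hC₁' 1 2).trans (t3' 1 1)
    · exact (hC₂' 0 0).trans (t1' 0)
    · exact (hC₂' 0 1).trans (t2' 0 0)
    · exact (hC₂' 0 2).trans (t2' 0 1)
    · exact (hC₂' 1 0).trans (t1' 1)
    · exact (hC₂' 1 1).trans (t2' 1 0)
    · exact (hC₂' 1 2).trans (t2' 1 1)
    · rw [hC₁' 2 1]
      exact h.c₃
  refine Painleve42.exists_normalForm hF hC₁ hC₂ (h2.conj h.isUnit_det_D) ?_
  have : -(∑ i, g.Q⁻¹ * A i * g.Q) = g.Q⁻¹ * (-(∑ i, A i)) * g.Q := by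
    rw [← Finset.sum_mul, ← Finset.mul_sum, Matrix.mul_neg, Matrix.neg_mul]
  rw [this]
  exact hinf.conj h.isUnit_det_D

end Stage

end Painleve42

/-! ### The shear that straightens the image of A₃ -/

namespace Painleve42

open Matrix

/-- A diagonalizable matrix with eigenvalues `θ` (`r` times) and `0` has a rank factorization. -/
theorem exists_factorization {r : ℕ} (hr : r ≤ 6) {θ : ℂ} {A : Mat6}
    (h : IsDiagonalizableTo A fun j => if (j : ℕ) < r then θ else 0) :
    ∃ (F : Matrix (Fin 6) (Fin r) ℂ) (R : Matrix (Fin r) (Fin 6) ℂ), A = F * R ∧ R * F = θ • 1 := by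
  obtain ⟨S, hS, rfl⟩ := h
  let E : Matrix (Fin 6) (Fin r) ℂ := (1 : Mat6).submatrix id (Fin.castLE hr)
  have hE : Eᵀ * E = 1 := by
    show ((1 : Mat6).submatrix id _)ᵀ * (1 : Mat6).submatrix id _ = 1
    rw [Matrix.transpose_submatrix, Matrix.transpose_one,
      ← Matrix.submatrix_mul _ _ _ id _ Function.bijective_id, Matrix.mul_one,
      Matrix.submatrix_one _ (Fin.castLE_injective hr)]
  have hD : (diagonal fun j : Fin 6 => if (j : ℕ) < r then θ else 0) = E * (θ • Eᵀ) := by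
    ext i j
    rw [Matrix.mul_apply]
    by_cases hi : (i : ℕ) < r
    · obtain ⟨k, rfl⟩ : ∃ k, i = Fin.castLE hr k := ⟨⟨i, hi⟩, rfl⟩
      rw [Finset.sum_eq_single k]
      · simp [E, Matrix.diagonal_apply, Matrix.one_apply, eq_comm]
      · intro l _ hl
        have : Fin.castLE hr k ≠ Fin.castLE hr l := fun e => hl (Fin.castLE_injective hr e).symm
        simp [E, hl.symm]
      · simp
    · rw [Finset.sum_eq_zero]
      · simp [Matrix.diagonal_apply, hi]
      · intro l _
        have : i ≠ Fin.castLE hr l := fun e => hi (by rw [e]; exact l.2)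
        simp [E, this]
  refine ⟨S * E, θ • Eᵀ * S⁻¹, ?_, ?_⟩
  · rw [hD]
    simp only [Matrix.mul_assoc]
  · rw [← Matrix.mul_assoc, Matrix.nonsing_inv_mul_cancel_right _ _ hS, Matrix.smul_mul, hE]

/-- Only the lower left blocks of `N` do not vanish. -/
def LowerBlocks (N : Mat6) : Prop := ∀ a b, a = 0 ∨ b ≠ 0 → blk N a b = 0

theorem LowerBlocks.mul_eq_zero {N N' : Mat6} (h : LowerBlocks N) (h' : LowerBlocks N') :
    N * N' = 0 := by
  refine ext_blk fun a b => ?_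
  rw [blk_mul, Finset.sum_eq_zero]
  · rfl
  · intro c _
    by_cases hc : c = 0
    · rw [h' c b (Or.inl hc), Matrix.mul_zero]
    · rw [h a c (Or.inr hc), Matrix.zero_mul]

theorem LowerBlocks.mul_blockDiag {N : Mat6} (h : LowerBlocks N) (D : Fin 3 → Mat2) :
    LowerBlocks (N * blockDiag D) := fun a b hab => by
  rw [blk_mul_blockDiag, h a b hab, Matrix.zero_mul]

theorem LowerBlocks.blockDiag_mul {N : Mat6} (h : LowerBlocks N) (D : Fin 3 → Mat2) :
    LowerBlocks (blockDiag D * N) := fun a b hab => by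
  rw [blk_blockDiag_mul, h a b hab, Matrix.mul_zero]

theorem one_sub_mul_one_add {N : Mat6} (h : LowerBlocks N) : (1 - N) * (1 + N) = 1 := by
  have := h.mul_eq_zero h
  rw [Matrix.sub_mul, Matrix.one_mul, Matrix.mul_add, Matrix.mul_one, this]
  abel

theorem one_add_mul_one_sub {N : Mat6} (h : LowerBlocks N) : (1 + N) * (1 - N) = 1 := by
  have := h.mul_eq_zero h
  rw [Matrix.mul_sub, Matrix.mul_one, Matrix.add_mul, Matrix.one_mul, this]
  abel

theorem LowerBlocks.conj_blockDiag {N : Mat6} (h : LowerBlocks N) (D : Fin 3 → Mat2) :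
    (1 - N) * blockDiag D * (1 + N) = blockDiag D + (blockDiag D * N - N * blockDiag D) := by
  have h0 : N * blockDiag D * N = 0 := (h.mul_blockDiag D).mul_eq_zero h
  simp only [Matrix.mul_add, Matrix.sub_mul, Matrix.one_mul, Matrix.mul_one, h0]
  abel

theorem diagonal_infinityEigenvalues (κ : Exponents) :
    diagonal κ.infinityEigenvalues = blockDiag fun a => ![κ.ρ₁, κ.ρ₂, κ.ρ₃] a • 1 := by
  refine ext_blk fun a b => ?_
  rw [blockDiag, blk_ofBlocks]
  ext r s
  fin_cases a <;> fin_cases b <;> fin_cases r <;> fin_cases s <;>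
    simp [blk, pair, Exponents.infinityEigenvalues]

/-- Products of lower left matrices vanish, so the conjugation changes the diagonal matrix only by a
commutator, which is again lower left. -/
theorem hasInfinityShape_shear {κ : Exponents} {N : Mat6} (h : LowerBlocks N) :
    HasInfinityShape κ ((1 - N) * diagonal κ.infinityEigenvalues * (1 + N)) := by
  rw [diagonal_infinityEigenvalues]
  set D : Fin 3 → Mat2 := fun a => ![κ.ρ₁, κ.ρ₂, κ.ρ₃] a • 1 with hD
  have hb (a b : Fin 3) (hab : a = 0 ∨ b ≠ 0) :
      blk ((1 - N) * blockDiag D * (1 + N)) a b = if a = b then D a else 0 := by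
    have e1 : blk (blockDiag D + (blockDiag D * N - N * blockDiag D)) a b =
        blk (blockDiag D) a b + (blk (blockDiag D * N) a b - blk (N * blockDiag D) a b) := rfl
    rw [h.conj_blockDiag, e1, h.blockDiag_mul D a b hab, h.mul_blockDiag D a b hab, sub_zero,
      add_zero, blockDiag, blk_ofBlocks]
  constructor <;> rw [hb _ _ (by decide)] <;> rfl

/-- The inclusion of the first two coordinates. -/
def inclusion : Matrix (Fin 6) (Fin 2) ℂ := (1 : Mat6).submatrix id (pair 0)

theorem inclusion_mul_apply {n : Type*} (X : Matrix (Fin 2) n ℂ) (a : Fin 3) (r : Fin 2) (j : n) :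
    (inclusion * X) (pair a r) j = if a = 0 then X r j else 0 := by
  rw [Matrix.mul_apply]
  by_cases h : a = 0
  · subst h
    simp [inclusion, Matrix.one_apply, pair_inj]
  · simp [inclusion, pair_inj, h]

theorem transpose_inclusion_mul {n : Type*} (X : Matrix (Fin 6) n ℂ) :
    inclusionᵀ * X = X.submatrix (pair 0) id := by
  show (1 : Mat6)ᵀ.submatrix (pair 0) id * X.submatrix id id = _
  rw [← Matrix.submatrix_mul _ _ _ id _ Function.bijective_id, Matrix.transpose_one, Matrix.one_mul]

theorem mul_inclusion {m : Type*} (X : Matrix m (Fin 6) ℂ) :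
    X * inclusion = X.submatrix id (pair 0) := by
  show X.submatrix id id * (1 : Mat6).submatrix id (pair 0) = _
  rw [← Matrix.submatrix_mul _ _ _ id _ Function.bijective_id, Matrix.mul_one]

theorem transpose_inclusion_mul_inclusion : inclusionᵀ * inclusion = 1 := by
  rw [transpose_inclusion_mul]
  ext r s
  simp [inclusion, Matrix.one_apply, pair_inj]

/-- The strictly lower triangular part of the gauge matrix that maps the span of the first two basis
vectors to the span of the columns of `w`. -/
noncomputable def shear (w : Matrix (Fin 6) (Fin 2) ℂ) : Mat6 :=
  (w * (w.submatrix (pair 0) id)⁻¹ - inclusion) * inclusionᵀ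

variable {w : Matrix (Fin 6) (Fin 2) ℂ}

theorem lowerBlocks_shear (hw : IsUnit (w.submatrix (pair 0) id).det) :
    LowerBlocks (shear w) := by
  intro a b hab
  have e : blk (shear w) a b = (w * (w.submatrix (pair 0) id)⁻¹ - inclusion).submatrix (pair a) id *
      inclusionᵀ.submatrix id (pair b) := Matrix.submatrix_mul _ _ _ id _ Function.bijective_id
  rw [e]
  rcases hab with rfl | hb
  · have : (w * (w.submatrix (pair 0) id)⁻¹ - inclusion).submatrix (pair 0) id = 0 := by
      rw [← transpose_inclusion_mul, Matrix.mul_sub, transpose_inclusion_mul_inclusion,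
        ← Matrix.mul_assoc, transpose_inclusion_mul, Matrix.mul_nonsing_inv _ hw, sub_self]
    rw [this, Matrix.zero_mul]
  · have : inclusionᵀ.submatrix id (pair b) = 0 := by
      ext r s
      simp [inclusion, pair_inj, hb.symm]
    rw [this, Matrix.mul_zero]

theorem one_add_shear_mul_inclusion :
    (1 + shear w) * inclusion = w * (w.submatrix (pair 0) id)⁻¹ := by
  rw [Matrix.add_mul, Matrix.one_mul, shear, Matrix.mul_assoc, transpose_inclusion_mul_inclusion,
    Matrix.mul_one, add_sub_cancel]

/-- The shear maps the span of the first two basis vectors onto the image of A, on which A acts as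
θ₃. Hence the conjugated matrix has its image in that span and is θ₃ there. -/
theorem hasImageShape_shear {κ : Exponents} {A : Mat6} {F : Matrix (Fin 6) (Fin 2) ℂ}
    {R : Matrix (Fin 2) (Fin 6) ℂ} {Z : Matrix (Fin 6) (Fin 2) ℂ} (hA : A = F * R)
    (hθ : κ.θ₃ ≠ 0) (hRF : R * F = κ.θ₃ • 1) (hw : w = A * Z)
    (hdet : IsUnit (w.submatrix (pair 0) id).det) :
    HasImageShape κ ((1 - shear w) * A * (1 + shear w)) := by
  have hN := lowerBlocks_shear hdet
  obtain ⟨S, hS⟩ : ∃ S, S = R * Z := ⟨_, rfl⟩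
  have hwS : w = F * S := by
    rw [hw, hA, hS, Matrix.mul_assoc]
  let β := inclusionᵀ * F
  have hβS : w.submatrix (pair 0) id = β * S := by
    rw [← transpose_inclusion_mul, hwS, ← Matrix.mul_assoc]
  have hdetS : IsUnit S.det := by
    rw [hβS, Matrix.det_mul] at hdet
    exact isUnit_of_mul_isUnit_right hdet
  have hF : F = (1 + shear w) * inclusion * β := by
    have h1 : β = w.submatrix (pair 0) id * S⁻¹ := by
      rw [hβS, Matrix.mul_nonsing_inv_cancel_right _ _ hdetS]
    rw [one_add_shear_mul_inclusion, h1, ← Matrix.mul_assoc,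
      Matrix.nonsing_inv_mul_cancel_right _ _ hdet, hwS,
      Matrix.mul_nonsing_inv_cancel_right _ _ hdetS]
  have hA' : (1 - shear w) * A * (1 + shear w) = inclusion * (β * R * (1 + shear w)) := by
    rw [hA]
    conv_lhs => rw [hF]
    simp only [← Matrix.mul_assoc]
    rw [one_sub_mul_one_add hN, Matrix.one_mul]
  have hβ : β * (R * ((1 + shear w) * inclusion)) = κ.θ₃ • 1 := by
    have h1 : R * ((1 + shear w) * inclusion) * β = κ.θ₃ • 1 := by
      rw [Matrix.mul_assoc, ← hF, hRF]
    have h2 : (κ.θ₃⁻¹ • (R * ((1 + shear w) * inclusion))) * β = 1 := by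
      rw [Matrix.smul_mul, h1, smul_smul, inv_mul_cancel₀ hθ, one_smul]
    have h3 := mul_eq_one_comm.1 h2
    rw [Matrix.mul_smul] at h3
    rw [← h3, smul_smul, mul_inv_cancel₀ hθ, one_smul]
  rw [hA']
  obtain ⟨T, hT⟩ : ∃ T, T = β * R * (1 + shear w) := ⟨_, rfl⟩
  have hT0 : T.submatrix id (pair 0) = κ.θ₃ • 1 := by
    rw [← mul_inclusion, hT, ← hβ]
    simp only [Matrix.mul_assoc]
  rw [← hT]
  have hb (a b : Fin 3) : blk (inclusion * T) a b =
      if a = 0 then T.submatrix id (pair b) else 0 := by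
    ext r s
    refine (inclusion_mul_apply T a r (pair b s)).trans ?_
    split_ifs <;> rfl
  refine ⟨?_, fun b => ?_, fun b => ?_⟩
  · rw [hb, if_pos rfl, hT0]
  · rw [hb, if_neg (by decide)]
  · rw [hb, if_neg (by decide)]

end Painleve42

/-! ### The complete gauge transformation -/

namespace Painleve42

open Matrix

/-- The system `A` after the gauge transformation that maps the image of the third residue matrix to
the span of the first two basis vectors. -/
noncomputable def sheared (Z₃ : Matrix (Fin 6) (Fin 2) ℂ) (A : Fin 3 → Mat6) : Fin 3 → Mat6 :=
  fun i => (1 - shear (A 2 * Z₃)) * A i * (1 + shear (A 2 * Z₃))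

section Gauge

variable (Z₁ Z₂ : Matrix (Fin 6) (Fin 3) ℂ) (Z₃ : Matrix (Fin 6) (Fin 2) ℂ)

/-- The gauge matrix that leads to the normal form, as a rational function of the system `A`. -/
noncomputable def gaugeMatrix (A : Fin 3 → Mat6) : Mat6 :=
  (1 + shear (A 2 * Z₃)) * (gaugeData Z₁ Z₂ (sheared Z₃ A)).Q

/-- The system `A` is generic with respect to the matrices `Z₁, Z₂, Z₃`. -/
structure IsGenericSystem (A : Fin 3 → Mat6) : Prop where
  image : ((A 2 * Z₃).submatrix (pair 0) id).det ≠ 0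
  generic : (gaugeData Z₁ Z₂ (sheared Z₃ A)).IsGeneric (sheared Z₃ A 0)

variable {Z₁ Z₂ Z₃}

/-- The scalar c does not affect the conjugation; it leaves room for the common denominator that
makes the gauge matrix polynomial. -/
theorem IsGenericSystem.exists_isNormalization {κ : Exponents} (hκ : κ.IsAdmissible)
    {A : Fin 3 → Mat6} (hA : A ∈ fuchsianSystems κ) (h : IsGenericSystem Z₁ Z₂ Z₃ A) {c : ℂ}
    (hc : c ≠ 0) : ∃ x, IsNormalization κ A (c • gaugeMatrix Z₁ Z₂ Z₃ A) x := by
  have hf (i : Fin 3) : ∃ (F : Matrix (Fin 6) (Fin (rk i)) ℂ) (R : Matrix (Fin (rk i)) (Fin 6) ℂ),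
      A i = F * R ∧ R * F = κ.θ i • 1 := by
    refine exists_factorization (rk_le i) ?_
    have := hA.1 i
    rwa [show κ.residueEigenvalues i = _ from funext (residueEigenvalues_apply κ i)] at this
  obtain ⟨F₁, R₁, hF₁, hR₁⟩ := hf 0
  obtain ⟨F₂, R₂, hF₂, hR₂⟩ := hf 1
  obtain ⟨F₃, R₃, hF₃, hR₃⟩ := hf 2
  have hdet : IsUnit ((A 2 * Z₃).submatrix (pair 0) id).det := isUnit_iff_ne_zero.2 h.image
  have hN := lowerBlocks_shear hdet
  have himage := hasImageShape_shear hF₃ hκ.θ₃_ne hR₃ rfl hdet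
  obtain ⟨N, hNd⟩ : ∃ N, N = shear (A 2 * Z₃) := ⟨_, rfl⟩
  have hA' (i : Fin 3) : sheared Z₃ A i = (1 - N) * A i * (1 + N) := by rw [hNd]; rfl
  rw [← hNd] at hN himage
  have hp := one_add_mul_one_sub hN
  have hm := one_sub_mul_one_add hN
  have hfac {n : ℕ} {θ : ℂ} {F : Matrix (Fin 6) (Fin n) ℂ} {R : Matrix (Fin n) (Fin 6) ℂ}
      (hR : R * F = θ • 1) : R * (1 + N) * ((1 - N) * F) = θ • 1 := by
    rw [Matrix.mul_assoc, ← Matrix.mul_assoc (1 + N), hp, Matrix.one_mul, hR]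
  have hassoc {n : ℕ} (F : Matrix (Fin 6) (Fin n) ℂ) (R : Matrix (Fin n) (Fin 6) ℂ) :
      (1 - N) * (F * R) * (1 + N) = (1 - N) * F * (R * (1 + N)) := by
    simp only [Matrix.mul_assoc]
  have hinf : HasInfinityShape κ (-(∑ i, sheared Z₃ A i)) := by
    have := hasInfinityShape_shear (κ := κ) hN
    rw [← hA.2] at this
    convert this using 1
    simp only [hA', Matrix.mul_neg, Matrix.neg_mul, Matrix.mul_sum, Matrix.sum_mul]
  obtain ⟨x, hx, hx1, hx2⟩ := h.generic.exists_normalForm rfl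
    (F₁ := (1 - N) * F₁) (R₁ := R₁ * (1 + N)) (F₂ := (1 - N) * F₂) (R₂ := R₂ * (1 + N))
    (by rw [hA', hF₁]; exact hassoc F₁ R₁) (hfac hR₁)
    (by rw [hA', hF₂]; exact hassoc F₂ R₂) (hfac hR₂)
    (by rw [hA']; exact himage) hinf
  have hQ := h.generic.isUnit_det_Q
  have hP : gaugeMatrix Z₁ Z₂ Z₃ A = (1 + N) * (gaugeData Z₁ Z₂ (sheared Z₃ A)).Q := by
    rw [hNd]; rfl
  set Q := (gaugeData Z₁ Z₂ (sheared Z₃ A)).Q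
  have hinv : (c⁻¹ • (Q⁻¹ * (1 - N))) * (c • gaugeMatrix Z₁ Z₂ Z₃ A) = 1 := by
    rw [hP, Matrix.smul_mul, Matrix.mul_smul, smul_smul, inv_mul_cancel₀ hc, one_smul,
      Matrix.mul_assoc, ← Matrix.mul_assoc (1 - N), hm, Matrix.one_mul, Matrix.nonsing_inv_mul _ hQ]
  refine ⟨x, Matrix.isUnit_det_of_left_inverse hinv, fun i => ?_, hx1, hx2⟩
  rw [Matrix.inv_eq_left_inv hinv, ← hx i, hA', hP]
  simp only [Matrix.smul_mul, Matrix.mul_smul, smul_smul, mul_inv_cancel₀ hc, one_smul,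
    Matrix.mul_assoc]

end Gauge

end Painleve42

/-! ### Genericity as a polynomial condition -/

namespace Painleve42

open Matrix

/-- The property `p` holds on the complement of a hypersurface that does not contain `A₀`. -/
def GenericallyAt (A₀ : Fin 3 → Mat6) (p : (Fin 3 → Mat6) → Prop) : Prop :=
  ∃ G : MvPolynomial (Fin 3 × Fin 6 × Fin 6) ℂ, evalEntries A₀ G ≠ 0 ∧
    ∀ A, evalEntries A G ≠ 0 → p A

theorem GenericallyAt.and {A₀ : Fin 3 → Mat6} {p p' : (Fin 3 → Mat6) → Prop}
    (h : GenericallyAt A₀ p) (h' : GenericallyAt A₀ p') : GenericallyAt A₀ fun A => p A ∧ p' A := by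
  obtain ⟨G, h0, h⟩ := h
  obtain ⟨G', h0', h'⟩ := h'
  refine ⟨G * G', ?_, fun A hA => ?_⟩
  · rw [RatAt.evalEntries_mul]
    exact mul_ne_zero h0 h0'
  · rw [RatAt.evalEntries_mul] at hA
    exact ⟨h A (left_ne_zero_of_mul hA), h' A (right_ne_zero_of_mul hA)⟩

theorem GenericallyAt.mono {A₀ : Fin 3 → Mat6} {p p' : (Fin 3 → Mat6) → Prop}
    (h : GenericallyAt A₀ p) (hp : ∀ A, p A → p' A) : GenericallyAt A₀ p' := by
  obtain ⟨G, h0, h⟩ := h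
  exact ⟨G, h0, fun A hA => hp A (h A hA)⟩

theorem RatAt.genericallyAt {A₀ : Fin 3 → Mat6} {f : (Fin 3 → Mat6) → ℂ} (hf : RatAt A₀ f)
    (h0 : f A₀ ≠ 0) : GenericallyAt A₀ fun A => f A ≠ 0 := by
  obtain ⟨N, D, hD, h⟩ := hf
  refine ⟨D * N, ?_, fun A hA => ?_⟩
  · rw [evalEntries_mul, ← h _ hD]
    exact mul_ne_zero hD (mul_ne_zero h0 hD)
  · rw [evalEntries_mul] at hA
    have h1 := right_ne_zero_of_mul hA
    rw [← h A (left_ne_zero_of_mul hA)] at h1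
    exact left_ne_zero_of_mul h1

/-- Near `A₀`, the entries of the vector function `v` are rational functions. -/
def RatVec {n : Type*} (A₀ : Fin 3 → Mat6) (v : (Fin 3 → Mat6) → n → ℂ) : Prop :=
  ∀ j, RatAt A₀ fun A => v A j

section

variable {A₀ : Fin 3 → Mat6}

theorem RatVec.wedge₂ {v w : (Fin 3 → Mat6) → Fin 2 → ℂ} (hv : RatVec A₀ v) (hw : RatVec A₀ w) :
    RatAt A₀ fun A => wedge₂ (v A) (w A) :=
  ((hv 0).mul (hw 1)).sub ((hv 1).mul (hw 0))

theorem RatVec.cols {v w : (Fin 3 → Mat6) → Fin 2 → ℂ} (hv : RatVec A₀ v) (hw : RatVec A₀ w) :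
    RatMat A₀ fun A => cols (v A) (w A) := by
  intro i j
  fin_cases i <;> fin_cases j
  exacts [hv 0, hw 0, hv 1, hw 1]

theorem RatVec.smul {n : Type*} {c : (Fin 3 → Mat6) → ℂ} {v : (Fin 3 → Mat6) → n → ℂ}
    (hc : RatAt A₀ c) (hv : RatVec A₀ v) : RatVec A₀ fun A => c A • v A :=
  fun j => hc.mul (hv j)

theorem RatVec.comp {m n : Type*} {v : (Fin 3 → Mat6) → n → ℂ} (hv : RatVec A₀ v) (e : m → n) :
    RatVec A₀ fun A => v A ∘ e := fun j => hv (e j)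

theorem RatVec.cross {v w : (Fin 3 → Mat6) → Fin 3 → ℂ} (hv : RatVec A₀ v) (hw : RatVec A₀ w) :
    RatVec A₀ fun A => crossProduct (v A) (w A) := by
  intro j
  simp only [cross_apply]
  fin_cases j
  · exact ((hv 1).mul (hw 2)).sub ((hv 2).mul (hw 1))
  · exact ((hv 2).mul (hw 0)).sub ((hv 0).mul (hw 2))
  · exact ((hv 0).mul (hw 1)).sub ((hv 1).mul (hw 0))

theorem RatMat.imageVec {V : (Fin 3 → Mat6) → Matrix (Fin 6) (Fin 3) ℂ} (hV : RatMat A₀ V)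
    (i j : Fin 6) : RatVec A₀ fun A => imageVec (V A) i j :=
  fun k => hV.mulVec (RatVec.cross (hV i) (hV j)) k

theorem RatMat.blockDiag {D : (Fin 3 → Mat6) → Fin 3 → Mat2}
    (hD : ∀ a, RatMat A₀ fun A => D A a) : RatMat A₀ fun A => blockDiag (D A) := by
  intro i j
  simp only [Painleve42.blockDiag, ofBlocks, Matrix.of_apply]
  split_ifs
  · exact hD _ _ _
  · exact RatAt.const A₀ 0

theorem RatMat.imageFactor {W : (Fin 3 → Mat6) → Matrix (Fin 6) (Fin 3) ℂ} (hW : RatMat A₀ W)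
    (h : (top3 (W A₀)).det ≠ 0) : RatMat A₀ fun A => imageFactor (W A) :=
  RatMat.mul (M := fun A => bot3 (W A)) (fun i j => hW (Fin.natAdd 3 i) j)
    (RatMat.inv (M := fun A => top3 (W A)) (fun i j => hW (Fin.castAdd 3 i) j) h)

theorem ratMat_shear {w : (Fin 3 → Mat6) → Matrix (Fin 6) (Fin 2) ℂ} (hw : RatMat A₀ w)
    (h : ((w A₀).submatrix (pair 0) id).det ≠ 0) : RatMat A₀ fun A => shear (w A) :=
  ((hw.mul ((hw.submatrix (pair 0) id).inv h)).sub (RatMat.const A₀ _)).mul (RatMat.const A₀ _)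

/-- The constituents of the gauge matrix are rational near `A₀`. -/
structure RatGaugeData (A₀ : Fin 3 → Mat6) (g : (Fin 3 → Mat6) → GaugeData) : Prop where
  V₁ : RatMat A₀ fun A => (g A).V₁
  V₂ : RatMat A₀ fun A => (g A).V₂
  X₁ : RatMat A₀ fun A => (g A).X₁
  X₂ : RatMat A₀ fun A => (g A).X₂
  Y₂ : RatMat A₀ fun A => (g A).Y₂

namespace RatGaugeData

variable {g : (Fin 3 → Mat6) → GaugeData} {M : Mat6}

theorem ê₁ (hg : RatGaugeData A₀ g) : RatVec A₀ fun A => (g A).ê₁ := (hg.V₁.imageVec 2 3).comp _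

theorem u₁ (hg : RatGaugeData A₀ g) : RatVec A₀ fun A => (g A).u₁ := (hg.V₁.imageVec 0 1).comp _

theorem u₂ (hg : RatGaugeData A₀ g) : RatVec A₀ fun A => (g A).u₂ := (hg.V₂.imageVec 0 1).comp _

theorem y (hg : RatGaugeData A₀ g) (h : (g A₀).IsGeneric M) : RatVec A₀ fun A => (g A).y :=
  fun j => (hg.Y₂.inv h.Y₂).mulVec hg.ê₁ j

theorem ê₂ (hg : RatGaugeData A₀ g) (h : (g A₀).IsGeneric M) : RatVec A₀ fun A => (g A).ê₂ :=
  fun j => (((hg.X₁.mul (hg.X₂.inv h.X₂)).adjugate).mulVec hg.ê₁ j).neg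

theorem α (hg : RatGaugeData A₀ g) (h : (g A₀).IsGeneric M) : RatAt A₀ fun A => (g A).α :=
  (((hg.y h).wedge₂ hg.u₂).div (hg.u₁.wedge₂ hg.u₂) h.u).neg

theorem D (hg : RatGaugeData A₀ g) (h : (g A₀).IsGeneric M) (a : Fin 3) :
    RatMat A₀ fun A => (g A).D a := by
  fin_cases a
  · exact hg.ê₁.cols (hg.ê₂ h)
  · exact (RatVec.smul (hg.α h) hg.u₁).cols (hg.y h)
  · exact (hg.X₂.inv h.X₂).mul ((hg.ê₂ h).cols hg.ê₁)

theorem Q (hg : RatGaugeData A₀ g) (h : (g A₀).IsGeneric M) : RatMat A₀ fun A => (g A).Q :=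
  RatMat.blockDiag (hg.D h)

theorem genericallyAt (hg : RatGaugeData A₀ g) {A' : (Fin 3 → Mat6) → Mat6} (hA' : RatMat A₀ A')
    (h : (g A₀).IsGeneric (A' A₀)) : GenericallyAt A₀ fun A => (g A).IsGeneric (A' A) := by
  have hQ := hg.Q h
  have hQi := hQ.inv h.isUnit_det_Q.ne_zero
  have hW₁ := hQi.mul hg.V₁
  have hW₂ := hQi.mul hg.V₂
  have hT₁ : RatMat A₀ fun A => top3 ((g A).Q⁻¹ * (g A).V₁) := hW₁.submatrix _ _
  have hT₂ : RatMat A₀ fun A => top3 ((g A).Q⁻¹ * (g A).V₂) := hW₂.submatrix _ _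
  have hB₁ := hW₁.imageFactor h.V₁
  have hB₂ := hW₂.imageFactor h.V₂
  exact ((hg.X₂.det.genericallyAt h.X₂).and ((hg.Y₂.det.genericallyAt h.Y₂).and
    (((hg.u₁.wedge₂ hg.u₂).genericallyAt h.u).and (((hg.D h 0).det.genericallyAt h.D₀).and
    (((hg.D h 1).det.genericallyAt h.D₁).and ((hT₁.det.genericallyAt h.V₁).and
    ((hT₂.det.genericallyAt h.V₂).and (((hB₁ 0 1).genericallyAt h.b₁).and
    (((hB₂ 1 2).genericallyAt h.b₆).and
    (((hQi.mul hA').mul hQ 2 4).genericallyAt h.c₃)))))))))).mono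
    fun A ⟨h1, h2, h3, h4, h5, h6, h7, h8, h9, h10⟩ => ⟨h1, h2, h3, h4, h5, h6, h7, h8, h9, h10⟩

end RatGaugeData

variable {Z₁ Z₂ : Matrix (Fin 6) (Fin 3) ℂ} {Z₃ : Matrix (Fin 6) (Fin 2) ℂ}

/-- If some system is generic, then generic systems have a normal form, which is reached by a gauge
matrix with polynomial entries. -/
theorem IsGenericSystem.exists_polynomial_gauge {κ : Exponents} (hκ : κ.IsAdmissible)
    (hA₀ : A₀ ∈ fuchsianSystems κ) (h : IsGenericSystem Z₁ Z₂ Z₃ A₀) :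
    ∃ (G : MvPolynomial (Fin 3 × Fin 6 × Fin 6) ℂ)
      (F : Matrix (Fin 6) (Fin 6) (MvPolynomial (Fin 3 × Fin 6 × Fin 6) ℂ)),
      (∃ A ∈ fuchsianSystems κ, evalEntries A G ≠ 0) ∧
      ∀ A ∈ fuchsianSystems κ, evalEntries A G ≠ 0 →
        ∃ x, IsNormalization κ A (F.map (evalEntries A)) x := by
  have hw : RatMat A₀ fun A => A 2 * Z₃ := (RatMat.residue A₀ 2).mul (RatMat.const A₀ Z₃)
  have hN := ratMat_shear hw h.image
  have h1 : RatMat A₀ fun _ => (1 : Mat6) := RatMat.const A₀ 1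
  have hA' (i : Fin 3) : RatMat A₀ fun A => sheared Z₃ A i :=
    ((h1.sub hN).mul (RatMat.residue A₀ i)).mul (h1.add hN)
  have hg : RatGaugeData A₀ fun A => gaugeData Z₁ Z₂ (sheared Z₃ A) :=
    ⟨(hA' 0).mul (RatMat.const A₀ Z₁), (hA' 1).mul (RatMat.const A₀ Z₂), (hA' 0).submatrix _ _,
      (hA' 1).submatrix _ _, (hA' 1).submatrix _ _⟩
  have hP : RatMat A₀ (gaugeMatrix Z₁ Z₂ Z₃) := (h1.add hN).mul (hg.Q h.generic)
  obtain ⟨D, N, hD, hDN⟩ := RatAt.exists_common_denominator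
    (f := fun s : Fin 6 × Fin 6 => fun A => gaugeMatrix Z₁ Z₂ Z₃ A s.1 s.2) fun s => hP s.1 s.2
  obtain ⟨G, hG, hGA⟩ := ((hw.submatrix (pair 0) id).det.genericallyAt h.image).and
    (hg.genericallyAt (hA' 0) h.generic)
  refine ⟨D * G, Matrix.of fun i j => N (i, j), ⟨A₀, hA₀, ?_⟩, fun A hA h0 => ?_⟩
  · rw [RatAt.evalEntries_mul]
    exact mul_ne_zero hD hG
  · rw [RatAt.evalEntries_mul] at h0
    have hDA := left_ne_zero_of_mul h0
    obtain ⟨g1, g2⟩ := hGA A (right_ne_zero_of_mul h0)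
    -- The numerators form the gauge matrix multiplied by the value of the common denominator.
    have e : (Matrix.of fun i j => N (i, j)).map (evalEntries A) =
        evalEntries A D • gaugeMatrix Z₁ Z₂ Z₃ A := by
      ext i j
      exact (hDN A hDA (i, j)).symm.trans (mul_comm _ _)
    rw [e]
    exact IsGenericSystem.exists_isNormalization hκ hA ⟨g1, g2⟩ hDA

end

end Painleve42

/-! ### From a normal form back to a Fuchsian system -/

namespace Painleve42

open Matrix

theorem IsDiagonalizableTo.conj {A L L' : Mat6} {d : Fin 6 → ℂ} (h : IsDiagonalizableTo A d)
    (hL : L * L' = 1) : IsDiagonalizableTo (L * A * L') d := by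
  obtain ⟨S, hS, rfl⟩ := h
  refine ⟨L * S, ?_, ?_⟩
  · rw [Matrix.det_mul]
    exact (Matrix.isUnit_det_of_right_inverse hL).mul hS
  · rw [Matrix.mul_inv_rev, Matrix.inv_eq_right_inv hL]
    simp only [Matrix.mul_assoc]

/-- The diagonalization of a product `(1 ; B) (θ - C B, C)`. -/
theorem fromRows_mul_fromCols_eq_conj {m n : Type*} [Fintype m] [Fintype n] [DecidableEq m]
    [DecidableEq n] {θ : ℂ} (hθ : θ ≠ 0) (B : Matrix n m ℂ) (C : Matrix m n ℂ) :
    fromBlocks 1 (-(θ⁻¹ • C)) B (1 - θ⁻¹ • (B * C)) *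
        fromBlocks (1 - θ⁻¹ • (C * B)) (θ⁻¹ • C) (-B) 1 = 1 ∧
      fromRows 1 B * fromCols (θ • 1 - C * B) C =
        fromBlocks 1 (-(θ⁻¹ • C)) B (1 - θ⁻¹ • (B * C)) *
          fromBlocks (θ • 1) 0 0 0 * fromBlocks (1 - θ⁻¹ • (C * B)) (θ⁻¹ • C) (-B) 1 := by
  constructor
  · rw [fromBlocks_multiply, ← fromBlocks_one]
    congr 1
    · simp
    · simp
    · simp only [Matrix.mul_sub, Matrix.sub_mul, Matrix.mul_one, Matrix.one_mul, Matrix.mul_neg,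
        Matrix.mul_smul, Matrix.smul_mul, Matrix.mul_assoc]
      abel
    · simp
  · rw [fromRows_mul_fromCols, fromBlocks_multiply, fromBlocks_multiply]
    congr 1
    · simp [smul_sub, smul_smul, hθ]
    · simp [smul_smul, hθ]
    · simp [smul_smul, hθ, Matrix.mul_sub]
    · simp [smul_smul, hθ]

theorem isDiagonalizableTo_submatrix {m n : Type*} [Fintype m] [Fintype n] [DecidableEq m]
    [DecidableEq n] (e : Fin 6 ≃ m ⊕ n) {θ : ℂ} (hθ : θ ≠ 0) (B : Matrix n m ℂ) (C : Matrix m n ℂ) :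
    IsDiagonalizableTo ((fromRows 1 B * fromCols (θ • 1 - C * B) C).submatrix e e)
      (Sum.elim (fun _ => θ) (fun _ => 0) ∘ e) := by
  obtain ⟨h1, h2⟩ := fromRows_mul_fromCols_eq_conj hθ B C
  set S := fromBlocks 1 (-(θ⁻¹ • C)) B (1 - θ⁻¹ • (B * C))
  set S' := fromBlocks (1 - θ⁻¹ • (C * B)) (θ⁻¹ • C) (-B) 1
  have hS : S.submatrix e e * S'.submatrix e e = 1 := by
    rw [Matrix.submatrix_mul_equiv, h1, Matrix.submatrix_one_equiv]
  refine ⟨S.submatrix e e, Matrix.isUnit_det_of_right_inverse hS, ?_⟩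
  rw [h2, Matrix.inv_eq_right_inv hS, ← Matrix.submatrix_mul_equiv _ _ _ e,
    ← Matrix.submatrix_mul_equiv _ _ _ e]
  congr 2
  ext i j
  rw [Matrix.submatrix_apply, Matrix.diagonal_apply, Function.comp_apply]
  by_cases hij : i = j
  · subst hij
    rcases e i with k | k <;> simp
  · have : e i ≠ e j := fun h => hij (e.injective h)
    rcases hi : e i with k | k <;> rcases hj : e j with l | l <;>
      simp_all

theorem isDiagonalizableTo_residues {κ : Exponents} (hκ : κ.IsAdmissible) (x : Vars) (i : Fin 3) :
    IsDiagonalizableTo (x.residues κ i) (κ.residueEigenvalues i) := by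
  have h3 (θ : ℂ) : Sum.elim (fun _ => θ) (fun _ => 0) ∘ (finSumFinEquiv (m := 3) (n := 3)).symm =
      ![θ, θ, θ, 0, 0, 0] := by
    ext j
    fin_cases j <;> rfl
  have h2 (θ : ℂ) : Sum.elim (fun _ => θ) (fun _ => 0) ∘ (finSumFinEquiv (m := 2) (n := 4)).symm =
      ![θ, θ, 0, 0, 0, 0] := by
    ext j
    fin_cases j <;> rfl
  fin_cases i
  · have := isDiagonalizableTo_submatrix (finSumFinEquiv (m := 3) (n := 3)).symm hκ.θ₁_ne x.B₁ x.C₁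
    rwa [h3] at this
  · have := isDiagonalizableTo_submatrix (finSumFinEquiv (m := 3) (n := 3)).symm hκ.θ₂_ne x.B₂ x.C₂
    rwa [h3] at this
  · have := isDiagonalizableTo_submatrix (finSumFinEquiv (m := 2) (n := 4)).symm hκ.θ₃_ne 0
      !![x.a₁₂, x.a₁₃, x.a₁₄, x.a₁₅; x.a₁₆, x.a₁₇, x.a₁₈, x.a₁₉]
    rw [h2] at this
    show IsDiagonalizableTo (x.residues κ 2) ![κ.θ₃, κ.θ₃, 0, 0, 0, 0]
    convert this using 1
    rw [fromRows_mul_fromCols, residues_two_entries]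
    ext i j
    obtain ⟨i, rfl⟩ := (finSumFinEquiv (m := 2) (n := 4)).surjective i
    obtain ⟨j, rfl⟩ := (finSumFinEquiv (m := 2) (n := 4)).surjective j
    rw [Matrix.submatrix_apply, Equiv.symm_apply_apply, Equiv.symm_apply_apply]
    rcases i with i | i <;> rcases j with j | j <;> fin_cases i <;> fin_cases j <;>
      simp [finSumFinEquiv]

theorem inclusion_mul_transpose_inclusion :
    inclusion * inclusionᵀ = blockDiag fun a => if a = 0 then 1 else 0 := by
  refine ext_blk fun a b => ?_
  rw [blockDiag, blk_ofBlocks]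
  ext r s
  refine (inclusion_mul_apply _ a r _).trans ?_
  fin_cases a <;> fin_cases b <;> fin_cases r <;> fin_cases s <;> rfl

/-- `shear` depends only on the span of the columns, and this span is the graph of N; so the shear
constructed from the image of A₃ is the one that produced the system from its normal form. -/
theorem shear_smul_one_add_mul_inclusion {N : Mat6} (hN : LowerBlocks N) {θ : ℂ} (hθ : θ ≠ 0) :
    ((θ • ((1 + N) * inclusion)).submatrix (pair 0) id) = θ • 1 ∧
      shear (θ • ((1 + N) * inclusion)) = N := by
  have h1 : (θ • ((1 + N) * inclusion)).submatrix (pair 0) id = θ • 1 := by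
    have h0 : (N * inclusion).submatrix (pair 0) id = 0 := by
      rw [mul_inclusion]
      exact hN 0 0 (Or.inl rfl)
    rw [← transpose_inclusion_mul, Matrix.mul_smul, Matrix.add_mul, Matrix.one_mul, Matrix.mul_add,
      transpose_inclusion_mul_inclusion, transpose_inclusion_mul, h0, add_zero]
  refine ⟨h1, ?_⟩
  have h2 : (θ • (1 : Mat2))⁻¹ = θ⁻¹ • 1 := by
    refine Matrix.inv_eq_left_inv ?_
    rw [Matrix.smul_mul, Matrix.one_mul, smul_smul, inv_mul_cancel₀ hθ, one_smul]
  rw [shear, h1, h2, Matrix.smul_mul, Matrix.mul_smul, smul_smul, mul_inv_cancel₀ hθ, one_smul,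
    Matrix.mul_one, Matrix.add_mul, Matrix.one_mul, add_sub_cancel_left, Matrix.mul_assoc,
    inclusion_mul_transpose_inclusion]
  refine ext_blk fun a b => ?_
  rw [blk_mul_blockDiag]
  split_ifs with hb
  · rw [Matrix.mul_one]
  · rw [Matrix.mul_zero, hN a b (Or.inr hb)]

/-- Conjugating the diagonal matrix adds (ρ_a - ρ₁)N in the lower left block of row a, and ρ₁ ≠ ρ₂,
ρ₃ allows solving for N block by block. -/
theorem residueInfinity_eq_conj {κ : Exponents} (hκ : κ.IsAdmissible) (x : Vars) :
    ∃ N, LowerBlocks N ∧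
      x.residueInfinity κ = (1 - N) * diagonal κ.infinityEigenvalues * (1 + N) := by
  let N : Mat6 := ofBlocks fun a b => if b = 0 ∧ a ≠ 0 then
    (![κ.ρ₁, κ.ρ₂, κ.ρ₃] a - κ.ρ₁)⁻¹ • blk (x.residueInfinity κ) a 0 else 0
  have hN : LowerBlocks N := fun a b hab => by
    rw [blk_ofBlocks, if_neg]
    rintro ⟨rfl, ha⟩
    exact hab.elim ha fun h => h rfl
  refine ⟨N, hN, ?_⟩
  rw [diagonal_infinityEigenvalues, hN.conj_blockDiag]
  refine ext_blk fun a b => ?_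
  set D : Fin 3 → Mat2 := fun a => ![κ.ρ₁, κ.ρ₂, κ.ρ₃] a • 1 with hD
  have e1 : blk (blockDiag D + (blockDiag D * N - N * blockDiag D)) a b =
      blk (blockDiag D) a b + (blk (blockDiag D * N) a b - blk (N * blockDiag D) a b) := rfl
  rw [e1, blk_mul_blockDiag, blk_blockDiag_mul, blockDiag, blk_ofBlocks, blk_ofBlocks]
  have h2 : κ.ρ₂ - κ.ρ₁ ≠ 0 := sub_ne_zero.2 hκ.ρ₁₂_ne.symm
  have h3 : κ.ρ₃ - κ.ρ₁ ≠ 0 := sub_ne_zero.2 hκ.ρ₁₃_ne.symm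
  have e2 (ρ : ℂ) (hρ : ρ - κ.ρ₁ ≠ 0) (S : Mat2) : S = (ρ - κ.ρ₁)⁻¹ • ρ • S -
      κ.ρ₁ • (ρ - κ.ρ₁)⁻¹ • S := by
    rw [smul_comm κ.ρ₁, ← smul_sub, ← sub_smul, smul_smul, inv_mul_cancel₀ hρ, one_smul]
  have hd (a b : Fin 3) (hab : a = 0 ∨ b ≠ 0) :
      blk (x.residueInfinity κ) a b = if a = b then D a else 0 := by
    ext r s
    fin_cases a <;> fin_cases b <;>
      first
      | exact absurd hab (by decide)
      | (fin_cases r <;> fin_cases s <;> simp [hD, blk, pair, Vars.residueInfinity])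
  by_cases hab : b = 0 ∧ a ≠ 0
  · obtain ⟨rfl, ha⟩ := hab
    rw [if_neg ha, if_pos ⟨rfl, ha⟩]
    fin_cases a
    · exact absurd rfl ha
    · simpa [hD] using e2 _ h2 _
    · simpa [hD] using e2 _ h3 _
  · rw [if_neg hab, Matrix.mul_zero, Matrix.zero_mul, sub_zero, add_zero]
    exact hd a b (by tauto)

end Painleve42

/-! ### Regular normal forms are fixed by the gauge procedure -/

namespace Painleve42

open Matrix

section Frame

variable (B : Matrix (Fin 3) (Fin 3) ℂ)

theorem top3_smul_frameRows (c : ℂ) : top3 (c • frameRows B) = c • 1 := by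
  ext i j
  have h : (finSumFinEquiv (m := 3) (n := 3)).symm (Fin.castAdd 3 i) = Sum.inl i :=
    finSumFinEquiv_symm_apply_castAdd i
  show c * fromRows 1 B ((finSumFinEquiv (m := 3) (n := 3)).symm (Fin.castAdd 3 i)) j = _
  rw [h]
  rfl

theorem bot3_smul_frameRows (c : ℂ) : bot3 (c • frameRows B) = c • B := by
  ext i j
  have h : (finSumFinEquiv (m := 3) (n := 3)).symm (Fin.natAdd 3 i) = Sum.inr i :=
    finSumFinEquiv_symm_apply_natAdd i
  show c * fromRows 1 B ((finSumFinEquiv (m := 3) (n := 3)).symm (Fin.natAdd 3 i)) j = _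
  rw [h]
  rfl

theorem smul_one_inv {n : Type*} [Fintype n] [DecidableEq n] {c : ℂ} (hc : c ≠ 0) :
    (c • (1 : Matrix n n ℂ))⁻¹ = c⁻¹ • 1 := by
  refine Matrix.inv_eq_left_inv ?_
  rw [Matrix.smul_mul, Matrix.one_mul, smul_smul, inv_mul_cancel₀ hc, one_smul]

theorem imageFactor_smul_frameRows {c : ℂ} (hc : c ≠ 0) : imageFactor (c • frameRows B) = B := by
  rw [imageFactor, top3_smul_frameRows, bot3_smul_frameRows, smul_one_inv hc, Matrix.mul_smul,
    Matrix.mul_one, smul_smul, inv_mul_cancel₀ hc, one_smul]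

theorem blockProduct_mul_frameRows (θ : ℂ) (C : Matrix (Fin 3) (Fin 3) ℂ) :
    blockProduct θ B C * frameRows B = θ • frameRows B := by
  rw [blockProduct_eq_frame, Matrix.mul_assoc, frameCols_mul_frameRows, Matrix.mul_smul,
    Matrix.mul_one]

theorem blockProduct_top_left (θ : ℂ) (C : Matrix (Fin 3) (Fin 3) ℂ) (i j : Fin 3) :
    blockProduct θ B C (Fin.castAdd 3 i) (Fin.castAdd 3 j) = (θ • 1 - C * B) i j := by
  have h (k : Fin 3) : (finSumFinEquiv (m := 3) (n := 3)).symm (Fin.castAdd 3 k) = Sum.inl k :=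
    finSumFinEquiv_symm_apply_castAdd k
  rw [blockProduct, Matrix.submatrix_apply, h, h, fromRows_mul_fromCols]
  simp

theorem smul_frameRows_apply (θ : ℂ) :
    (θ • frameRows B) 0 = ![θ, 0, 0] ∧ (θ • frameRows B) 1 = ![0, θ, 0] ∧
      (θ • frameRows B) 2 = ![0, 0, θ] ∧
      (θ • frameRows B) 3 = ![θ * B 0 0, θ * B 0 1, θ * B 0 2] := by
  have h (c : Fin 3 → ℂ) := frameRows_mulVec B c
  have hj (i : Fin 6) (j : Fin 3) : (θ • frameRows B) i j =
      θ * (frameRows B *ᵥ Pi.single j 1) i := by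
    rw [Matrix.mulVec_single_one]
    rfl
  refine ⟨?_, ?_, ?_, ?_⟩ <;> ext j <;> rw [hj]
  · rw [(h _).1]
    fin_cases j <;> simp
  · rw [(h _).2.1]
    fin_cases j <;> simp
  · rw [(h _).2.2.1]
    fin_cases j <;> simp
  · rw [(h _).2.2.2]
    fin_cases j <;> simp

theorem imageVec_frameRows_zero_one (θ : ℂ) :
    imageVec (θ • frameRows B) 0 1 2 = θ ^ 3 ∧
      imageVec (θ • frameRows B) 0 1 3 = θ ^ 3 * B 0 2 := by
  obtain ⟨h0, h1, h2, h3⟩ := smul_frameRows_apply B θ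
  have hc : crossProduct ((θ • frameRows B) 0) ((θ • frameRows B) 1) = ![0, 0, θ ^ 2] := by
    rw [h0, h1, cross_apply]
    simp [sq]
  constructor
  · show (θ • frameRows B) 2 ⬝ᵥ _ = _
    rw [hc, h2]
    simp
    ring
  · show (θ • frameRows B) 3 ⬝ᵥ _ = _
    rw [hc, h3]
    simp
    ring

theorem imageVec_frameRows_two_three (θ : ℂ) :
    imageVec (θ • frameRows B) 2 3 0 = -(θ ^ 3 * B 0 1) ∧
      imageVec (θ • frameRows B) 2 3 1 = θ ^ 3 * B 0 0 := by
  obtain ⟨h0, h1, h2, h3⟩ := smul_frameRows_apply B θ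
  have hc : crossProduct ((θ • frameRows B) 2) ((θ • frameRows B) 3) =
      ![-(θ ^ 2 * B 0 1), θ ^ 2 * B 0 0, 0] := by
    rw [h2, h3, cross_apply]
    simp [sq, mul_assoc]
  constructor
  · show (θ • frameRows B) 0 ⬝ᵥ _ = _
    rw [hc, h0]
    simp
    ring
  · show (θ • frameRows B) 1 ⬝ᵥ _ = _
    rw [hc, h1]
    simp
    ring

end Frame

theorem blockDiag_smul_one (c : ℂ) : (blockDiag fun _ => c • 1) = c • 1 := by
  refine ext_blk fun a b => ?_
  show _ = c • blk 1 a b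
  rw [blockDiag, blk_ofBlocks, blk_one]
  split_ifs
  · rfl
  · rw [smul_zero]

/-- The gauge matrix of a regular normal form is a scalar matrix. -/
theorem GaugeData.D_eq_of_normalForm {g : GaugeData} {θ₁ θ₂ b₁ b₆ b₇ c₂ c₄ : ℂ} (h₁ : θ₁ ≠ 0)
    (h₂ : θ₂ ≠ 0) (hb₆ : b₆ ≠ 0) (hê₁ : g.ê₁ = ![-(θ₁ ^ 3 * b₁), 0])
    (hu₁ : g.u₁ = ![θ₁ ^ 3, 0]) (hu₂ : g.u₂ = ![θ₂ ^ 3, θ₂ ^ 3]) (hX₁ : g.X₁ = !![c₂, c₄; 0, 1])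
    (hX₂ : g.X₂ = !![0, 1; 1, 0]) (hY₂ : g.Y₂ = !![-(1 + b₇), 1; -b₆, 0]) (a : Fin 3) :
    g.D a = -(θ₁ ^ 3 * b₁) • 1 := by
  obtain ⟨s, hs⟩ : ∃ s, s = -(θ₁ ^ 3 * b₁) := ⟨_, rfl⟩
  rw [← hs] at hê₁ ⊢
  have hX₂i : g.X₂⁻¹ = !![0, 1; 1, 0] := by
    rw [hX₂]
    refine Matrix.inv_eq_left_inv ?_
    ext i j
    fin_cases i <;> fin_cases j <;> simp [Matrix.mul_apply]
  have hY₂i : g.Y₂⁻¹ = !![0, -b₆⁻¹; 1, -((1 + b₇) * b₆⁻¹)] := by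
    rw [hY₂]
    refine Matrix.inv_eq_left_inv ?_
    ext i j
    fin_cases i <;> fin_cases j <;> simp [Matrix.mul_apply, hb₆]
  have hy : g.y = ![0, s] := by
    rw [GaugeData.y, hY₂i, hê₁]
    ext i
    fin_cases i <;> simp [Matrix.mulVec, dotProduct]
  have hê₂ : g.ê₂ = ![0, s] := by
    rw [GaugeData.ê₂, hX₂i, hX₁, hê₁]
    ext i
    fin_cases i <;> simp [Matrix.adjugate_fin_two]
  have hα : g.α * θ₁ ^ 3 = s := by
    rw [GaugeData.α, hy, hu₁, hu₂, wedge₂, wedge₂]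
    simp
    field_simp
  fin_cases a
  · show cols g.ê₁ g.ê₂ = _
    rw [hê₁, hê₂, cols]
    ext i j
    fin_cases i <;> fin_cases j <;> simp
  · show cols (g.α • g.u₁) g.y = _
    rw [hy, hu₁, cols]
    ext i j
    fin_cases i <;> fin_cases j <;> simp [hα]
  · show g.X₂⁻¹ * cols g.ê₂ g.ê₁ = _
    rw [hX₂i, hê₁, hê₂, cols]
    ext i j
    fin_cases i <;> fin_cases j <;> simp [Matrix.mul_apply]

/-- On a regular normal form the gauge matrix is the scalar -θ₁³b₁, so each genericity condition
reduces to the nonvanishing of θ₁, θ₂, b₁, b₆ or c₃, or is automatic. -/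
theorem isGeneric_of_isRegular {κ : Exponents} (hκ : κ.IsAdmissible) {x : Vars} (hx : x.IsRegular) :
    (gaugeData (frameRows x.B₁) (frameRows x.B₂) (x.residues κ)).IsGeneric (x.residues κ 0) := by
  obtain ⟨g, hg⟩ : ∃ g, g = gaugeData (frameRows x.B₁) (frameRows x.B₂) (x.residues κ) := ⟨_, rfl⟩
  have hV₁ : g.V₁ = κ.θ₁ • frameRows x.B₁ := by
    rw [hg]
    exact blockProduct_mul_frameRows _ _ _
  have hV₂ : g.V₂ = κ.θ₂ • frameRows x.B₂ := by
    rw [hg]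
    exact blockProduct_mul_frameRows _ _ _
  have hê₁ : g.ê₁ = ![-(κ.θ₁ ^ 3 * x.b₁), 0] := by
    obtain ⟨e0, e1⟩ := imageVec_frameRows_two_three x.B₁ κ.θ₁
    ext i
    fin_cases i
    · simpa [GaugeData.ê₁, hV₁, pair, Vars.B₁] using e0
    · simpa [GaugeData.ê₁, hV₁, pair, Vars.B₁] using e1
  have hu₁ : g.u₁ = ![κ.θ₁ ^ 3, 0] := by
    obtain ⟨e0, e1⟩ := imageVec_frameRows_zero_one x.B₁ κ.θ₁
    ext i
    fin_cases i
    · simpa [GaugeData.u₁, hV₁, pair, Vars.B₁] using e0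
    · simpa [GaugeData.u₁, hV₁, pair, Vars.B₁] using e1
  have hu₂ : g.u₂ = ![κ.θ₂ ^ 3, κ.θ₂ ^ 3] := by
    obtain ⟨e0, e1⟩ := imageVec_frameRows_zero_one x.B₂ κ.θ₂
    ext i
    fin_cases i
    · simpa [GaugeData.u₂, hV₂, pair, Vars.B₂] using e0
    · simpa [GaugeData.u₂, hV₂, pair, Vars.B₂] using e1
  have hX₁ : g.X₁ = !![x.c₂, x.c₄; 0, 1] := by
    rw [hg]
    show blk (blockProduct _ _ _) 0 2 = _
    ext i j
    fin_cases i <;> fin_cases j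
    exacts [blockProduct_top_right κ.θ₁ x.B₁ x.C₁ 0 1, blockProduct_top_right κ.θ₁ x.B₁ x.C₁ 0 2,
      blockProduct_top_right κ.θ₁ x.B₁ x.C₁ 1 1, blockProduct_top_right κ.θ₁ x.B₁ x.C₁ 1 2]
  have hX₂ : g.X₂ = !![0, 1; 1, 0] := by
    rw [hg]
    show blk (blockProduct _ _ _) 0 2 = _
    ext i j
    fin_cases i <;> fin_cases j
    exacts [blockProduct_top_right κ.θ₂ x.B₂ x.C₂ 0 1, blockProduct_top_right κ.θ₂ x.B₂ x.C₂ 0 2,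
      blockProduct_top_right κ.θ₂ x.B₂ x.C₂ 1 1, blockProduct_top_right κ.θ₂ x.B₂ x.C₂ 1 2]
  have hY₂ : g.Y₂ = !![-(1 + x.b₇), 1; -x.b₆, 0] := by
    rw [hg]
    show blk (blockProduct _ _ _) 0 1 = _
    ext i j
    fin_cases i <;> fin_cases j
    · refine (blockProduct_top_left x.B₂ κ.θ₂ x.C₂ 0 2).trans ?_
      simp [Vars.B₂, Vars.C₂]
    · exact blockProduct_top_right κ.θ₂ x.B₂ x.C₂ 0 0
    · refine (blockProduct_top_left x.B₂ κ.θ₂ x.C₂ 1 2).trans ?_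
      simp [Vars.B₂, Vars.C₂]
    · exact blockProduct_top_right κ.θ₂ x.B₂ x.C₂ 1 0
  have hD := GaugeData.D_eq_of_normalForm hκ.θ₁_ne hκ.θ₂_ne hx.2.1 hê₁ hu₁ hu₂ hX₁ hX₂ hY₂
  have hs : -(κ.θ₁ ^ 3 * x.b₁) ≠ 0 := neg_ne_zero.2 (mul_ne_zero (pow_ne_zero _ hκ.θ₁_ne) hx.1)
  set s := -(κ.θ₁ ^ 3 * x.b₁)
  have hQ : g.Q = s • 1 := by
    rw [GaugeData.Q, funext hD, blockDiag_smul_one]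
  have hW₁ : g.Q⁻¹ * g.V₁ = (s⁻¹ * κ.θ₁) • frameRows x.B₁ := by
    rw [hQ, smul_one_inv hs, hV₁, Matrix.smul_mul, Matrix.one_mul, smul_smul]
  have hW₂ : g.Q⁻¹ * g.V₂ = (s⁻¹ * κ.θ₂) • frameRows x.B₂ := by
    rw [hQ, smul_one_inv hs, hV₂, Matrix.smul_mul, Matrix.one_mul, smul_smul]
  have h1 : s⁻¹ * κ.θ₁ ≠ 0 := mul_ne_zero (inv_ne_zero hs) hκ.θ₁_ne
  have h2 : s⁻¹ * κ.θ₂ ≠ 0 := mul_ne_zero (inv_ne_zero hs) hκ.θ₂_ne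
  rw [← hg]
  refine ⟨?_, ?_, ?_, ?_, ?_, ?_, ?_, ?_, ?_, ?_⟩
  · rw [hX₂]
    simp
  · rw [hY₂]
    simpa using hx.2.1
  · rw [hu₁, hu₂]
    simpa [wedge₂] using ⟨hκ.θ₁_ne, hκ.θ₂_ne⟩
  · rw [hD]
    simpa using hs
  · rw [hD]
    simpa using hs
  · rw [hW₁, top3_smul_frameRows]
    simpa using h1
  · rw [hW₂, top3_smul_frameRows]
    simpa using h2
  · rw [hW₁, imageFactor_smul_frameRows _ h1]
    exact hx.1
  · rw [hW₂, imageFactor_smul_frameRows _ h2]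
    exact hx.2.1
  · have : g.Q⁻¹ * x.residues κ 0 * g.Q = x.residues κ 0 := by
      rw [hQ, smul_one_inv hs, Matrix.smul_mul, Matrix.one_mul, Matrix.smul_mul, Matrix.mul_smul,
        Matrix.mul_one, smul_smul, inv_mul_cancel₀ hs, one_smul]
    rw [this, show x.residues κ 0 2 4 = x.c₃ from blockProduct_top_right κ.θ₁ x.B₁ x.C₁ 2 1]
    exact hx.2.2

/-- Generic systems have a normal form, which is reached by a gauge matrix with polynomial
entries. -/
theorem exists_polynomial_gauge {κ : Exponents} (hκ : κ.IsAdmissible) :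
    ∃ (G : MvPolynomial (Fin 3 × Fin 6 × Fin 6) ℂ)
      (F : Matrix (Fin 6) (Fin 6) (MvPolynomial (Fin 3 × Fin 6 × Fin 6) ℂ)),
      (∃ A ∈ fuchsianSystems κ, evalEntries A G ≠ 0) ∧
      ∀ A ∈ fuchsianSystems κ, evalEntries A G ≠ 0 →
        ∃ x, IsNormalization κ A (F.map (evalEntries A)) x := by
  obtain ⟨d, hd⟩ := exists_isRegular κ
  obtain ⟨hx, hx', -⟩ := hd.toVars hκ
  set x := d.toVars κ
  obtain ⟨N, hN, hT⟩ := residueInfinity_eq_conj hκ x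
  have hp := one_add_mul_one_sub hN
  have hm := one_sub_mul_one_add hN
  -- Undoing the shear diagonalizes Ã_∞, so A is a genuine Fuchsian system. With `Z₃ = (1 + N) *
  -- inclusion`, a basis of the image of `A 2`, the procedure recovers N and returns to the normal
  -- form.
  let A : Fin 3 → Mat6 := fun i => (1 + N) * x.residues κ i * (1 - N)
  have hA : A ∈ fuchsianSystems κ := by
    refine ⟨fun i => (isDiagonalizableTo_residues hκ x i).conj hp, ?_⟩
    have h1 : -(∑ i, A i) = (1 + N) * (-(∑ i, x.residues κ i)) * (1 - N) := by
      simp only [A, Matrix.mul_neg, Matrix.neg_mul, Matrix.mul_sum, Matrix.sum_mul]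
    have h2 : -(∑ i, x.residues κ i) = x.residueInfinity κ := hx
    rw [h1, h2, hT]
    simp only [← Matrix.mul_assoc]
    rw [hp, Matrix.one_mul, Matrix.mul_assoc, hp, Matrix.mul_one]
  have hw : A 2 * ((1 + N) * inclusion) = κ.θ₃ • ((1 + N) * inclusion) := by
    have h1 : x.residues κ 2 * inclusion = κ.θ₃ • inclusion := by
      rw [mul_inclusion, residues_two_entries]
      ext i j
      fin_cases i <;> fin_cases j <;> simp [inclusion, pair, Matrix.one_apply]
    show (1 + N) * x.residues κ 2 * (1 - N) * ((1 + N) * inclusion) = _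
    rw [Matrix.mul_assoc _ (1 - N), ← Matrix.mul_assoc (1 - N), hm, Matrix.one_mul,
      Matrix.mul_assoc, h1, Matrix.mul_smul]
  obtain ⟨hτ, hshear⟩ := shear_smul_one_add_mul_inclusion hN hκ.θ₃_ne
  have hs : sheared ((1 + N) * inclusion) A = x.residues κ := by
    funext i
    rw [sheared, hw, hshear]
    show (1 - N) * ((1 + N) * x.residues κ i * (1 - N)) * (1 + N) = _
    simp only [← Matrix.mul_assoc]
    rw [hm, Matrix.one_mul, Matrix.mul_assoc, hm, Matrix.mul_one]
  refine IsGenericSystem.exists_polynomial_gauge hκ hA (Z₁ := frameRows x.B₁)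
    (Z₂ := frameRows x.B₂) (Z₃ := (1 + N) * inclusion) ⟨?_, ?_⟩
  · rw [hw, hτ]
    simpa using hκ.θ₃_ne
  · rw [hs]
    exact isGeneric_of_isRegular hκ hx'

end Painleve42

theorem mainTheorem7 (κ : Painleve42.Exponents) (hκ : κ.IsAdmissible) :
    -- Generic systems can be brought to a regular normal form, by a gauge matrix whose entries
    -- are polynomials in the entries of the residue matrices.
    (∃ (G : MvPolynomial (Fin 3 × Fin 6 × Fin 6) ℂ)
        (F : Matrix (Fin 6) (Fin 6) (MvPolynomial (Fin 3 × Fin 6 × Fin 6) ℂ)),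
      (∃ A ∈ Painleve42.fuchsianSystems κ, Painleve42.evalEntries A G ≠ 0) ∧
      ∀ A ∈ Painleve42.fuchsianSystems κ, Painleve42.evalEntries A G ≠ 0 →
        ∃ x : Painleve42.Vars,
          Painleve42.IsNormalization κ A (F.map (Painleve42.evalEntries A)) x) ∧
    -- The constraints that are used in the elimination.
    (∀ x : Painleve42.Vars, x.IsNormalForm κ →
      x.c₃ + x.c₆ = 0 ∧ x.c₅ + x.c₇ = 0 ∧
      x.lam 0 * x.mu 0 + x.mu 0 * x.mu 4 - κ.θ₂ - κ.ρ₂ = 0 ∧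
      x.lam 0 * x.mu 0 - x.lam 2 * x.mu 2 - x.lam 4 * x.mu 4 - κ.θ₁ - κ.θ₂ - 2 * κ.ρ₂ = 0) ∧
    -- `(q, p)` is a coordinate system on the regular normal forms.
    (∀ t : ℂ, t ≠ 0 → t ≠ 1 →
      (∀ x y : Painleve42.Vars, x.IsNormalForm κ → x.IsRegular → y.IsNormalForm κ → y.IsRegular →
        x.q t = y.q t → x.p κ t = y.p κ t → x = y) ∧
      ∃ D : Painleve42.PhasePoly, D ≠ 0 ∧ ∀ q p : Fin 3 → ℂ,
        ((∃ x : Painleve42.Vars, x.IsNormalForm κ ∧ x.IsRegular ∧ x.q t = q ∧ x.p κ t = p) ↔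
          Painleve42.evalAt q p D ≠ 0)) ∧
    -- These coordinates are canonical, at each stage of the elimination.
    (∀ t : ℂ, t ≠ 0 → t ≠ 1 → ∀ W : Set (ℂ × ℂ), IsOpen W →
      ∀ (B : (i : Fin 3) → ℂ × ℂ → Matrix (Fin 6) (Fin (Painleve42.rk i)) ℂ)
        (C : (i : Fin 3) → ℂ × ℂ → Matrix (Fin (Painleve42.rk i)) (Fin 6) ℂ)
        (P : ℂ × ℂ → Painleve42.Mat6) (x : ℂ × ℂ → Painleve42.Vars),
      (∀ i k l, DifferentiableOn ℂ (fun z => B i z k l) W) →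
      (∀ i k l, DifferentiableOn ℂ (fun z => C i z k l) W) →
      (∀ k l, DifferentiableOn ℂ (fun z => P z k l) W) →
      (∀ z ∈ W, (fun i => B i z * C i z) ∈ Painleve42.fuchsianSystems κ) →
      (∀ z ∈ W, Painleve42.IsNormalization κ (fun i => B i z * C i z) (P z) (x z)) →
      ∀ z ∈ W,
        (∀ j, DifferentiableAt ℂ (fun w => (x w).b j) z ∧
          DifferentiableAt ℂ (fun w => (x w).c j) z) ∧
        Painleve42.symplecticForm B C z
          = ∑ j, Painleve42.wedge (fun w => (x w).b j) (fun w => (x w).c j) z ∧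
        Painleve42.symplecticForm B C z
          = ∑ j, Painleve42.wedge (fun w => (x w).lam j) (fun w => (x w).mu j) z ∧
        Painleve42.symplecticForm B C z
          = ∑ j, Painleve42.wedge (fun w => (x w).q t j) (fun w => (x w).p κ t j) z) ∧
    -- The Hamiltonian in these coordinates is the polynomial one, up to a function of `t`.
    (∀ t : ℂ, t ≠ 0 → t ≠ 1 → ∃ k : ℂ, ∀ x : Painleve42.Vars, x.IsNormalForm κ → x.IsRegular →
      t * (t - 1) * (x.schlesingerHamiltonian κ t
          + x.q t 1 * x.p κ t 1 / t + x.q t 2 * x.p κ t 2 / t)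
        = Painleve42.evalAt (x.q t) (x.p κ t) (Painleve42.hamiltonian κ t) + k) ∧
    -- Along an isomonodromic deformation, `(q, p)` satisfies the polynomial Hamiltonian system.
    (∀ U : Set ℂ, IsOpen U → (0 : ℂ) ∉ U → (1 : ℂ) ∉ U →
      ∀ (A : ℂ → Fin 3 → Painleve42.Mat6) (P : ℂ → Painleve42.Mat6) (x : ℂ → Painleve42.Vars),
      (∀ t ∈ U, A t ∈ Painleve42.fuchsianSystems κ) →
      Painleve42.SolvesSchlesinger U A →
      (∀ k l, DifferentiableOn ℂ (fun t => P t k l) U) →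
      (∀ t ∈ U, Painleve42.IsNormalization κ (A t) (P t) (x t)) →
      Painleve42.SolvesHamiltonianSystem κ U (fun t => (x t).q t) (fun t => (x t).p κ t)) := by
  refine ⟨Painleve42.exists_polynomial_gauge hκ, fun x h => ?_,
    fun t ht _ => ⟨fun x y hx hx' hy hy' hq hp => ?_, ?_⟩,
    fun t ht _ W hW B C P x hB hC hP hM hx z hz => ?_, fun t ht ht' => ?_,
    fun U hU h0 h1 A P x hM hA hP hx => ?_⟩
  · have hr := (Painleve42.isNormalForm_iff κ x).1 h
    refine ⟨?_, ?_, hr.core_e₁, hr.core_e₂⟩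
    · rw [hr.c₆_eq, add_neg_cancel]
    · rw [hr.c₇_eq, add_neg_cancel]
  · exact Painleve42.coordinates_injective hκ ht hx hx' hy hy' hq hp
  · exact ⟨_, Painleve42.singularLocus_ne_zero ht, Painleve42.coordinates_range hκ ht⟩
  · have hW' := hW.mem_nhds hz
    have hev : ∀ᶠ w in nhds z, w ∈ W := hW'
    exact Painleve42.symplecticForm_eq hκ ht (fun i k l => (hB i k l).differentiableAt hW')
      (fun i k l => (hC i k l).differentiableAt hW') (fun k l => (hP k l).differentiableAt hW')
      (hev.mono hM) (hev.mono hx)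
  · exact ⟨_, fun x h hx => Painleve42.schlesingerHamiltonian_eq hκ ht ht' h hx⟩
  · exact Painleve42.solvesHamiltonianSystem hκ hU h0 h1 hM hA hP hx
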